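/- **Theorem.** For $\varepsilon>0$ let $$D_\varepsilon=\{(z,w)\in\mathbb C^2 : z\ne 0,\ w\neq 0,\ (\log|z|)^2+(\log|w|)^2<\varepsilon^2\},\qquad M_\varepsilon=\partial D_\varepsilon .$$ Then, for every $\varepsilon>0$: 1. $D_\varepsilon$ is a bounded strictly pseudoconvex domain with smooth boundary, and $M_\varepsilon$ is a non-empty compact smooth real hypersurface of $\mathbb C^2$ that is strictly pseudoconvex for the CR structure induced from $\mathbb C^2$. 2. $M_\varepsilon$ has no umbilical points. That is, at no point $p\in M_\varepsilon$ do there exist holomorphic coordinates $(z,w)$ of $\mathbb C^2$ centred at $p$ in which $M_\varepsilon$ is approximated by the sphere $\operatorname{Im}w=|z|^2$ to order six, $\operatorname{Im} w=|z|^2+O(|(z,\operatorname{Re}w)|^7)$; in other words, in Chern–Moser normal form $$\operatorname{Im} w=|z|^2+2\operatorname{Re}(c\,z^2\bar z^4)+O(|(z,\operatorname{Re}w)|^7)$$ the coefficient $c$ never vanishes. Moreover E. Cartan's umbilical tensor $$Q=\frac{\det A_3(\rho)}{J^{25/3}},\qquad J=\det\begin{pmatrix}\rho_z&\bar L\rho_z\\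 \rho_w&\bar L\rho_w\end{pmatrix},\qquad L=-\rho_w\partial_z+\rho_z\partial_w,$$ is non-zero at every point of $M_\varepsilon$, for every smooth local defining function $\rho$ of $M_\varepsilon$; here $A_3(\rho)$ is the $5\times5$ matrix whose $j$-th column, $j=0,\dots,4$, is $\bar L^j$ applied to the column with entries $\rho_w^3,\ \rho_z\rho_w^2,\ \rho_z^2\rho_w,\ \rho_z^3,\ \rho_{ZZ}(L,L)=\rho_{zz}\rho_w^2-2\rho_{zw}\rho_z\rho_w+\rho_{ww}\rho_z^2$. 3. $D_\varepsilon$ is biholomorphic to the Grauert tube of radius $\sqrt2\,\varepsilon$ of the flat torus $\mathbb T^2=\mathbb R^2/(2\pi\mathbb Z)^2$, that is, to $\{\rho<2\varepsilon^2\}\subset\mathbb C^2/(2\pi\mathbb Z)^2$ for a non-negative smooth Kähler potential $\rho$ on $\mathbb C^2/(2\pi\mathbb Z)^2$ with $\{\rho=0\}=\mathbb T^2$, whose Kähler metric (with Kähler form $\tfrac i2\partial\bar\partial\rho$) restricts to the flat metric of $\mathbb T^2$, and with $(\partial\bar\partial\sqrt\rho)^2=0$ off $\mathbb T^2$. 4.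 $M_\varepsilon$ is locally homogeneous (for any $p,q\in M_\varepsilon$ there is a biholomorphic map from a neighbourhood of $p$ to a neighbourhood of $q$ that takes $p$ to $q$ and $M_\varepsilon$ to $M_\varepsilon$) and nowhere spherical (no neighbourhood of a point of $M_\varepsilon$ is mapped biholomorphically onto an open subset of $\mathbb C^2$ so that $M_\varepsilon$ goes to the unit sphere). -/

import Mathlib

open scoped ContDiff Topology

noncomputable section

namespace CRUmbilic

/-- The Wirtinger derivative `∂f(v) = ∑ j, v j * ∂f/∂Z j` of a (real differentiable) function on
`ℂ²` in the direction `v`; it is complex linear in `v`. -/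
def wirt (v : ℂ × ℂ) (f : ℂ × ℂ → ℂ) (p : ℂ × ℂ) : ℂ :=
  (fderiv ℝ f p v - Complex.I * fderiv ℝ f p (Complex.I • v)) / 2

/-- The conjugate Wirtinger derivative `∑ j, conj (v j) * ∂f/∂(conj (Z j))`; it is conjugate linear
in `v`. -/
def wirtBar (v : ℂ × ℂ) (f : ℂ × ℂ → ℂ) (p : ℂ × ℂ) : ℂ :=
  (fderiv ℝ f p v + Complex.I * fderiv ℝ f p (Complex.I • v)) / 2

/-- `f_z`, `f_w`, and the derivatives with respect to `conj z`, `conj w`. -/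
def dZ (f : ℂ × ℂ → ℂ) : ℂ × ℂ → ℂ := wirt (1, 0) f
def dW (f : ℂ × ℂ → ℂ) : ℂ × ℂ → ℂ := wirt (0, 1) f
def dZbar (f : ℂ × ℂ → ℂ) : ℂ × ℂ → ℂ := wirtBar (1, 0) f
def dWbar (f : ℂ × ℂ → ℂ) : ℂ × ℂ → ℂ := wirtBar (0, 1) f

/-- A real function regarded as a complex-valued one. -/
def cplx (r : ℂ × ℂ → ℝ) : ℂ × ℂ → ℂ := fun x => (r x : ℂ)

/-- The Levi form `∑ j k, r_{j, conj k} * v j * conj (v k)`, a real number for real `r`. -/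
def leviForm (r : ℂ × ℂ → ℝ) (p v : ℂ × ℂ) : ℝ := (wirt v (wirtBar v (cplx r)) p).re

/-- `r` is a smooth local defining function at `p ∈ M` of the real hypersurface `M ⊆ ℂ²`. -/
def IsLocalDefiningFunction (M : Set (ℂ × ℂ)) (r : ℂ × ℂ → ℝ) (p : ℂ × ℂ) : Prop :=
  p ∈ M ∧ ∃ U : Set (ℂ × ℂ), IsOpen U ∧ p ∈ U ∧ ContDiffOn ℝ ∞ r U ∧
    (∀ x ∈ U, x ∈ M ↔ r x = 0) ∧ ∀ x ∈ U, x ∈ M → fderiv ℝ r x ≠ 0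

/-- The Levi form of `r` at `p` is positive on the complex tangent space `{v | ∂r(v) = 0}`. -/
def IsLeviPositive (r : ℂ × ℂ → ℝ) (p : ℂ × ℂ) : Prop :=
  ∀ v : ℂ × ℂ, v ≠ 0 → wirt v (cplx r) p = 0 → 0 < leviForm r p v

/-- `M` is an embedded smooth real hypersurface of `ℂ²` which, with the CR structure induced from
`ℂ²`, is strictly pseudoconvex (the Levi form is definite; the sign of `r` is free). -/
def IsStrictlyPseudoconvexHypersurface (M : Set (ℂ × ℂ)) : Prop :=
  ∀ p ∈ M, ∃ r : ℂ × ℂ → ℝ, IsLocalDefiningFunction M r p ∧ IsLeviPositive r p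

/-- `D` is a bounded domain in `ℂ²` with smooth boundary that is strictly pseudoconvex from the
side of `D` (the local defining functions are negative exactly on `D`). -/
def IsBoundedStrictlyPseudoconvexDomain (D : Set (ℂ × ℂ)) : Prop :=
  IsOpen D ∧ IsConnected D ∧ Bornology.IsBounded D ∧
    ∀ p ∈ frontier D, ∃ r : ℂ × ℂ → ℝ, IsLocalDefiningFunction (frontier D) r p ∧
      (∀ᶠ x in 𝓝 p, x ∈ D ↔ r x < 0) ∧ IsLeviPositive r p

/-- In suitable holomorphic coordinates `(z, w) = Φ⁻¹` centred at `p`, the hypersurface `M` is in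
Chern-Moser normal form through order six with coefficient `c`:
`Im w = |z|² + 2 Re (c z² (conj z)⁴) + O(|(z, Re w)|⁷)`.
All terms of a normal form other than these have order at least seven. Only the jet of order six
of the coordinates matters, so formal and convergent coordinates are interchangeable here. -/
def HasChernMoserCoefficient (M : Set (ℂ × ℂ)) (p : ℂ × ℂ) (c : ℂ) : Prop :=
  ∃ (r : ℂ × ℂ → ℝ) (Φ : ℂ × ℂ → ℂ × ℂ), IsLocalDefiningFunction M r p ∧
    AnalyticAt ℂ Φ 0 ∧ Φ 0 = p ∧ Function.Bijective (fderiv ℂ Φ 0) ∧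
    (fun x : ℂ × ℝ => r (Φ (x.1, (x.2 : ℂ) + Complex.I *
      ((‖x.1‖ ^ 2 + 2 * (c * x.1 ^ 2 * (starRingEnd ℂ x.1) ^ 4).re : ℝ) : ℂ))))
      =O[𝓝 0] fun x : ℂ × ℝ => ‖x‖ ^ 7

/-- `p` is an umbilical point of `M`: the Chern-Moser coefficient `c` vanishes, that is, in
suitable holomorphic coordinates at `p` the sphere `Im w = |z|²` approximates `M` to order six and
not just to the generic order five. -/
def IsUmbilical (M : Set (ℂ × ℂ)) (p : ℂ × ℂ) : Prop := HasChernMoserCoefficient M p 0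

/-- The (0,1)-vector field conjugate to `L = -ρ_w ∂/∂z + ρ_z ∂/∂w`, acting on functions. -/
def Lbar (ρ f : ℂ × ℂ → ℂ) : ℂ × ℂ → ℂ :=
  fun x => -dWbar ρ x * dZbar f x + dZbar ρ x * dWbar f x

/-- The complex Hessian `ρ_{ZZ}(L, L)`. -/
def hessLL (ρ : ℂ × ℂ → ℂ) : ℂ × ℂ → ℂ := fun x =>
  dZ (dZ ρ) x * dW ρ x ^ 2 - 2 * dW (dZ ρ) x * dZ ρ x * dW ρ x + dW (dW ρ) x * dZ ρ x ^ 2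

/-- First column of the matrix `A₃`. -/
def colA3 (ρ : ℂ × ℂ → ℂ) : Fin 5 → ℂ × ℂ → ℂ :=
  ![fun x => dW ρ x ^ 3, fun x => dZ ρ x * dW ρ x ^ 2, fun x => dZ ρ x ^ 2 * dW ρ x,
    fun x => dZ ρ x ^ 3, hessLL ρ]

/-- The 5 by 5 matrix `A₃`; column `j` is the first one differentiated `j` times by `Lbar`. -/
def matA3 (ρ : ℂ × ℂ → ℂ) (p : ℂ × ℂ) : Matrix (Fin 5) (Fin 5) ℂ :=
  Matrix.of fun i j => ((Lbar ρ)^[(j : ℕ)] (colA3 ρ i)) p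

/-- The Levi determinant, equal on `{ρ = 0}` to Fefferman's complex Monge-Ampere operator. -/
def leviDet (ρ : ℂ × ℂ → ℂ) (p : ℂ × ℂ) : ℂ :=
  Matrix.det !![dZ ρ p, Lbar ρ (dZ ρ) p; dW ρ p, Lbar ρ (dW ρ) p]

/-- Cartan's umbilical tensor `Q = det A₃ / J ^ (25/3)` computed with the defining function `r`. -/
def umbilicalTensor (r : ℂ × ℂ → ℝ) (p : ℂ × ℂ) : ℂ :=
  (matA3 (cplx r) p).det / leviDet (cplx r) p ^ (25 / 3 : ℂ)

/-- The germs of `M` at `p` and of `N` at `q` are biholomorphically equivalent. -/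
def LocallyEquivalent (M : Set (ℂ × ℂ)) (p : ℂ × ℂ) (N : Set (ℂ × ℂ)) (q : ℂ × ℂ) : Prop :=
  ∃ h : OpenPartialHomeomorph (ℂ × ℂ) (ℂ × ℂ), p ∈ h.source ∧ h p = q ∧
    DifferentiableOn ℂ h h.source ∧ DifferentiableOn ℂ h.symm h.target ∧
    ∀ x ∈ h.source, x ∈ M ↔ h x ∈ N

/-- Any two points of `M` have biholomorphically equivalent germs. -/
def IsLocallyHomogeneous (M : Set (ℂ × ℂ)) : Prop :=
  ∀ p ∈ M, ∀ q ∈ M, LocallyEquivalent M p M q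

/-- The unit sphere of `ℂ²`. -/
def sphere3 : Set (ℂ × ℂ) := {x | ‖x.1‖ ^ 2 + ‖x.2‖ ^ 2 = 1}

/-- `M` is spherical at `p`: near `p` it is biholomorphic to a piece of the unit sphere. -/
def IsSphericalAt (M : Set (ℂ × ℂ)) (p : ℂ × ℂ) : Prop :=
  ∃ q ∈ sphere3, LocallyEquivalent M p sphere3 q

/-- `ρ` is the lift to `ℂ²` of a Grauert tube potential on `ℂ²/(2πℤ)²`, the complexification of the
flat torus `ℝ²/(2πℤ)²`: a Kähler potential with zero set the torus, whose Kähler metric (of the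
form `i/2 ∂∂̄ρ`) restricts to the flat metric, and whose square root satisfies the homogeneous
complex Monge-Ampere equation off the torus. -/
structure IsFlatTorusPotential (ρ : ℂ × ℂ → ℝ) : Prop where
  smooth : ContDiff ℝ ∞ ρ
  nonneg : ∀ x, 0 ≤ ρ x
  periodic : ∀ (x : ℂ × ℂ) (m n : ℤ),
    ρ (x.1 + 2 * Real.pi * m, x.2 + 2 * Real.pi * n) = ρ x
  kaehler : ∀ x v : ℂ × ℂ, v ≠ 0 → 0 < leviForm ρ x v
  zero_iff : ∀ x, ρ x = 0 ↔ x.1.im = 0 ∧ x.2.im = 0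
  metric : ∀ a b s t : ℝ,
    leviForm ρ ((a : ℂ), (b : ℂ)) ((s : ℂ), (t : ℂ)) = s ^ 2 + t ^ 2
  mongeAmpere : ∀ x : ℂ × ℂ, ρ x ≠ 0 →
    Matrix.det
      !![dZ (dZbar (cplx fun y => √(ρ y))) x, dZ (dWbar (cplx fun y => √(ρ y))) x;
         dW (dZbar (cplx fun y => √(ρ y))) x, dW (dWbar (cplx fun y => √(ρ y))) x] = 0

/-- `D` is biholomorphic to the Grauert tube `{ρ < s²}/(2πℤ)²` of radius `s` of the flat torus
`ℝ²/(2πℤ)²`, by a map whose lift to the tube `{ρ < s²}` in `ℂ²` is `H`. -/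
def IsFlatTorusGrauertTube (s : ℝ) (D : Set (ℂ × ℂ)) : Prop :=
  ∃ (ρ : ℂ × ℂ → ℝ) (H : ℂ × ℂ → ℂ × ℂ), IsFlatTorusPotential ρ ∧
    DifferentiableOn ℂ H {x | ρ x < s ^ 2} ∧
    (∀ x, ρ x < s ^ 2 → Function.Bijective (fderiv ℂ H x)) ∧
    H '' {x | ρ x < s ^ 2} = D ∧
    ∀ x y, ρ x < s ^ 2 → ρ y < s ^ 2 →
      (H x = H y ↔ ∃ m n : ℤ, y = (x.1 + 2 * Real.pi * m, x.2 + 2 * Real.pi * n))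

/-- The domain `(log |z|)² + (log |w|)² < ε²`; points with `z w = 0` do not belong to it. -/
def domainD (ε : ℝ) : Set (ℂ × ℂ) :=
  {x | x.1 ≠ 0 ∧ x.2 ≠ 0 ∧ Real.log ‖x.1‖ ^ 2 + Real.log ‖x.2‖ ^ 2 < ε ^ 2}

end CRUmbilic

end

/-!
The argument rests on two properties of the determinant of Cartan's matrix `A₃`.

* It is a relative invariant. If `r` vanishes to order seven along `{s = 0}`, the gradients of `r`
  and `s` are proportional to order six, and every column of `A₃(r)` is, modulo the previous ones, a
  multiple of the corresponding column of `A₃(s)` (`WirtingerAlgebra.det_matrixA3_change`). So the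
  vanishing of `det A₃` at a point depends neither on the defining function nor on more than the jet
  of order six of the hypersurface.
* It vanishes for the sphere in any holomorphic coordinates: the defining function is then
  `f α + g β + γ` with `f`, `g` holomorphic and `α`, `β`, `γ` antiholomorphic, so the Hessian
  `ρ_{ZZ}(L, L)` is a cubic form in the gradient whose coefficients are holomorphic, hence
  annihilated by the (0,1) field, and the rows of `A₃` are dependent
  (`WirtingerAlgebra.det_matrixA3_eq_zero`).

Hence a hypersurface with `det A₃ ≠ 0` has no umbilical and no spherical point
(`exists_det_matA3_eq_zero_of_isUmbilical`, `exists_det_matA3_eq_zero_of_isSphericalAt`). For the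
hypersurface `a² + b² = ε²`, `a = log |z|`, `b = log |w|`, the (0,1) field is a multiple of the
angular field `-b ∂/∂a + a ∂/∂b`, and the entries of the first column of `A₃` are combinations, with
coefficients annihilated by the field, of `E³, E² Ē, E Ē², Ē³, E Ē`, `E = a + i b`. These are
eigenvectors with five distinct eigenvalues, so `det A₃` is a Vandermonde determinant up to non-zero
factors (`WirtingerAlgebra.LogCoordinates.det_matrixA3_ne_zero`).

All these computations take place in the algebra of germs of smooth functions with its four
commuting Wirtinger derivations, and vanishing to order `k` along a hypersurface is abstracted into
a filtration by ideals which the tangential fields lower by at most one step.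

The statements on the domain itself follow from the covering `(z, w) ↦ (e^{iz}, e^{iw})` by the tube
`|Im Z| < ε`, whose fibres are the orbits of `(2πℤ)²`. The potential `2 |Im Z|²` makes this tube the
Grauert tube of the torus, and the real translations and rotations of `ℂ²` are transitive on its
boundary.
-/

noncomputable section

namespace CRUmbilic

/-! ### Derivations and determinants of iterated derivatives -/

section Derivations

variable {R : Type*} [CommRing R] [Algebra ℂ R]

theorem iterate_derivation_smul_mul (D : Derivation ℂ R R) (h k : R) (j : ℕ) :
    ∃ t : ℕ → R, (∀ l, j < l → t l = 0) ∧ t j = k * h ^ j ∧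
      ∀ f, (h • D)^[j] (k * f) = ∑ l ∈ Finset.range (j + 1), t l * D^[l] f := by
  induction j with
  | zero =>
    refine ⟨fun l => if l = 0 then k else 0, ?_, by simp, by simp⟩
    intro l hl
    simp [hl.ne']
  | succ j ih =>
    obtain ⟨t, ht, htj, hf⟩ := ih
    refine ⟨fun l => h * (D (t l) + if l = 0 then 0 else t (l - 1)), ?_, ?_, ?_⟩
    · intro l hl
      have h1 : t l = 0 := ht l (by omega)
      have h2 : t (l - 1) = 0 := ht _ (by omega)
      simp [h1, h2]
    · simp [ht (j + 1) (by omega), htj]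
      ring
    · intro f
      rw [Function.iterate_succ_apply', hf]
      have e1 : ∀ n, ∑ l ∈ Finset.range n, D (t l * D^[l] f)
          = ∑ l ∈ Finset.range n, D (t l) * D^[l] f
            + ∑ l ∈ Finset.range n, t l * D^[l + 1] f := by
        intro n
        rw [← Finset.sum_add_distrib]
        refine Finset.sum_congr rfl fun l _ => ?_
        rw [Derivation.leibniz, Function.iterate_succ_apply']
        simp only [smul_eq_mul]
        ring
      have e2 : ∑ l ∈ Finset.range (j + 1 + 1), h * (D (t l) + if l = 0 then 0 else t (l - 1))
            * D^[l] f
          = h * (∑ l ∈ Finset.range (j + 1 + 1), D (t l) * D^[l] f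
            + ∑ l ∈ Finset.range (j + 1 + 1), (if l = 0 then 0 else t (l - 1)) * D^[l] f) := by
        rw [← Finset.sum_add_distrib, Finset.mul_sum]
        exact Finset.sum_congr rfl fun l _ => by ring
      rw [e2, Derivation.smul_apply, map_sum, e1, Finset.sum_range_succ' (fun l =>
        (if l = 0 then 0 else t (l - 1)) * D^[l] f), Finset.sum_range_succ (fun l =>
        D (t l) * D^[l] f) (j + 1), ht (j + 1) (by omega)]
      simp

/-- Rescaling a derivation and the functions it differentiates multiplies the matrix of iterated
derivatives by a triangular one. -/
theorem det_iterate_derivation_smul_mul {n : ℕ} (D : Derivation ℂ R R) (h k : R)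
    (c : Fin n → R) :
    (Matrix.of fun i j : Fin n => (h • D)^[(j : ℕ)] (k * c i)).det
      = (Matrix.of fun i j : Fin n => D^[(j : ℕ)] (c i)).det * ∏ j : Fin n, k * h ^ (j : ℕ) := by
  choose t ht htj hf using iterate_derivation_smul_mul D h k
  have hT : (Matrix.of fun l j : Fin n => t j l).BlockTriangular id := by
    intro l j hlj
    exact ht _ _ hlj
  have hdet := Matrix.det_of_isUpperTriangular hT
  have : (Matrix.of fun i j : Fin n => (h • D)^[(j : ℕ)] (k * c i))
      = (Matrix.of fun i j : Fin n => D^[(j : ℕ)] (c i)) *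
        (Matrix.of fun l j : Fin n => t j l) := by
    ext i j
    rw [Matrix.mul_apply, Matrix.of_apply, hf]
    simp only [Matrix.of_apply]
    rw [Finset.sum_fin_eq_sum_range, ← Finset.sum_subset
      (Finset.range_subset_range.2 (Nat.succ_le_of_lt j.2))]
    · refine Finset.sum_congr rfl fun l hl => ?_
      rw [dif_pos (lt_of_lt_of_le (Finset.mem_range.1 hl) (Nat.succ_le_of_lt j.2)), mul_comm]
    · intro l hl hl'
      rw [dif_pos (Finset.mem_range.1 hl), ht _ _ (by simpa using hl')]
      simp
  rw [this, Matrix.det_mul, hdet]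
  simp [htj]

theorem iterate_derivation_const_mul (D : Derivation ℂ R R) {c : R} (hc : D c = 0) (f : R)
    (j : ℕ) : D^[j] (c * f) = c * D^[j] f := by
  induction j with
  | zero => rfl
  | succ j ih => simp [Function.iterate_succ_apply', ih, hc]

theorem iterate_derivation_sum (D : Derivation ℂ R R) {ι : Type*} (s : Finset ι) (f : ι → R)
    (j : ℕ) : D^[j] (∑ i ∈ s, f i) = ∑ i ∈ s, D^[j] (f i) := by
  induction j with
  | zero => rfl
  | succ j ih => simp [Function.iterate_succ_apply', ih]

end Derivations

theorem mul_sub_mul_mem {R : Type*} [CommRing R] {I : Ideal R} {a b c d : R} (h1 : a - b ∈ I)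
    (h2 : c - d ∈ I) : a * c - b * d ∈ I := by
  have : a * c - b * d = c * (a - b) + b * (c - d) := by ring
  rw [this]
  exact I.add_mem (I.mul_mem_left _ h1) (I.mul_mem_left _ h2)

/-- A commutative algebra of germs of complex valued functions on `ℂ²`, seen through its four
Wirtinger derivations `∂/∂z`, `∂/∂w`, `∂/∂(conj z)`, `∂/∂(conj w)`, which commute. -/
structure WirtingerAlgebra (R : Type*) [CommRing R] [Algebra ℂ R] where
  /-- `∂/∂z` -/
  z : Derivation ℂ R R
  /-- `∂/∂w` -/
  w : Derivation ℂ R R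
  /-- `∂/∂(conj z)` -/
  zbar : Derivation ℂ R R
  /-- `∂/∂(conj w)` -/
  wbar : Derivation ℂ R R
  w_z : ∀ f, w (z f) = z (w f)
  zbar_z : ∀ f, zbar (z f) = z (zbar f)
  zbar_w : ∀ f, zbar (w f) = w (zbar f)
  wbar_z : ∀ f, wbar (z f) = z (wbar f)
  wbar_w : ∀ f, wbar (w f) = w (wbar f)

namespace WirtingerAlgebra

variable {R : Type*} [CommRing R] [Algebra ℂ R] (W : WirtingerAlgebra R)

/-- The (1,0) field `L = -s_w ∂/∂z + s_z ∂/∂w`. -/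
def fieldL (s : R) : Derivation ℂ R R := (-(W.w s)) • W.z + W.z s • W.w

/-- The (0,1) field `-s_{conj w} ∂/∂(conj z) + s_{conj z} ∂/∂(conj w)`. -/
def fieldLbar (s : R) : Derivation ℂ R R := (-(W.wbar s)) • W.zbar + W.zbar s • W.wbar

/-- The complex Hessian `s_{ZZ}(L, L)`. -/
def hess (s : R) : R :=
  W.z (W.z s) * W.w s ^ 2 - 2 * W.w (W.z s) * W.z s * W.w s + W.w (W.w s) * W.z s ^ 2

/-- First column of `A₃(s)`. -/
def col (s : R) : Fin 5 → R :=
  ![W.w s ^ 3, W.z s * W.w s ^ 2, W.z s ^ 2 * W.w s, W.z s ^ 3, W.hess s]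

/-- The matrix `A₃(s)`. -/
def matrixA3 (s : R) : Matrix (Fin 5) (Fin 5) R :=
  Matrix.of fun i j => (W.fieldLbar s)^[(j : ℕ)] (W.col s i)

/-- The Levi determinant `J(s)`. -/
def levi (s : R) : R :=
  W.z s * W.fieldLbar s (W.w s) - W.fieldLbar s (W.z s) * W.w s

theorem fieldL_apply (s f : R) : W.fieldL s f = -(W.w s) * W.z f + W.z s * W.w f := rfl

theorem fieldLbar_apply (s f : R) :
    W.fieldLbar s f = -(W.wbar s) * W.zbar f + W.zbar s * W.wbar f := rfl

theorem hess_eq (s : R) :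
    W.hess s = -(W.w s) * W.fieldL s (W.z s) + W.z s * W.fieldL s (W.w s) := by
  rw [hess, fieldL_apply, fieldL_apply, W.w_z]
  ring

/-! ### Change of defining function -/

/-- A decreasing filtration by ideals, to be thought of as the functions vanishing to order `k`
along `{s = 0}`, that is lowered by at most one step by the tangential fields of `s`. -/
structure TangentialFiltration (s : R) (J : ℕ → Ideal R) : Prop where
  anti : Antitone J
  fieldL_mem : ∀ k f, f ∈ J (k + 1) → W.fieldL s f ∈ J k
  fieldLbar_mem : ∀ k f, f ∈ J (k + 1) → W.fieldLbar s f ∈ J k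

section Change

variable {W} {s r u : R} {J : ℕ → Ideal R} {n : ℕ}

/-- If `r` vanishes to order `n + 1` along `{s = 0}`, the (1,0) gradients of `r` and `s` are
proportional to order `n`. -/
theorem gradient_sub_mem (hJ : W.TangentialFiltration s J)
    (hu : (W.z s * W.zbar s + W.w s * W.wbar s) * u = 1) (hr : r ∈ J (n + 1)) :
    W.z r - (W.z r * W.zbar s + W.w r * W.wbar s) * u * W.z s ∈ J n ∧
      W.w r - (W.z r * W.zbar s + W.w r * W.wbar s) * u * W.w s ∈ J n := by
  have h := hJ.fieldL_mem n r hr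
  have e1 : W.z r - (W.z r * W.zbar s + W.w r * W.wbar s) * u * W.z s
      = (-(W.wbar s) * u) * W.fieldL s r := by
    rw [fieldL_apply]
    linear_combination (-W.z r) * hu
  have e2 : W.w r - (W.z r * W.zbar s + W.w r * W.wbar s) * u * W.w s
      = (W.zbar s * u) * W.fieldL s r := by
    rw [fieldL_apply]
    linear_combination (-W.w r) * hu
  exact ⟨e1 ▸ (J n).mul_mem_left _ h, e2 ▸ (J n).mul_mem_left _ h⟩

theorem gradientBar_sub_mem (hJ : W.TangentialFiltration s J)
    (hu : (W.z s * W.zbar s + W.w s * W.wbar s) * u = 1) (hr : r ∈ J (n + 1)) :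
    W.zbar r - (W.zbar r * W.z s + W.wbar r * W.w s) * u * W.zbar s ∈ J n ∧
      W.wbar r - (W.zbar r * W.z s + W.wbar r * W.w s) * u * W.wbar s ∈ J n := by
  have h := hJ.fieldLbar_mem n r hr
  have e1 : W.zbar r - (W.zbar r * W.z s + W.wbar r * W.w s) * u * W.zbar s
      = (-(W.w s) * u) * W.fieldLbar s r := by
    rw [fieldLbar_apply]
    linear_combination (-W.zbar r) * hu
  have e2 : W.wbar r - (W.zbar r * W.z s + W.wbar r * W.w s) * u * W.wbar s
      = (W.z s * u) * W.fieldLbar s r := by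
    rw [fieldLbar_apply]
    linear_combination (-W.wbar r) * hu
  exact ⟨e1 ▸ (J n).mul_mem_left _ h, e2 ▸ (J n).mul_mem_left _ h⟩

variable {h h' : R}

theorem fieldL_sub_mem (hz : W.z r - h * W.z s ∈ J n) (hw : W.w r - h * W.w s ∈ J n) (f : R) :
    W.fieldL r f - h * W.fieldL s f ∈ J n := by
  have : W.fieldL r f - h * W.fieldL s f
      = (-(W.z f)) * (W.w r - h * W.w s) + W.w f * (W.z r - h * W.z s) := by
    simp only [fieldL_apply]
    ring
  rw [this]
  exact (J n).add_mem ((J n).mul_mem_left _ hw) ((J n).mul_mem_left _ hz)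

theorem fieldLbar_sub_mem (hz : W.zbar r - h' * W.zbar s ∈ J n)
    (hw : W.wbar r - h' * W.wbar s ∈ J n) (f : R) :
    W.fieldLbar r f - h' * W.fieldLbar s f ∈ J n := by
  have : W.fieldLbar r f - h' * W.fieldLbar s f
      = (-(W.zbar f)) * (W.wbar r - h' * W.wbar s) + W.wbar f * (W.zbar r - h' * W.zbar s) := by
    simp only [fieldLbar_apply]
    ring
  rw [this]
  exact (J n).add_mem ((J n).mul_mem_left _ hw) ((J n).mul_mem_left _ hz)

/-- The Hessian along `L` scales like a cubic form: the terms with derivatives of the factor `h`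
cancel because `L s = 0`. -/
theorem hess_sub_mem (hJ : W.TangentialFiltration s J) (hz : W.z r - h * W.z s ∈ J (n + 1))
    (hw : W.w r - h * W.w s ∈ J (n + 1)) : W.hess r - h ^ 3 * W.hess s ∈ J n := by
  have hle : J (n + 1) ≤ J n := hJ.anti n.le_succ
  have a1 := fieldL_sub_mem hz hw (W.z r)
  have a2 := fieldL_sub_mem hz hw (W.w r)
  have b1 := hJ.fieldL_mem n _ hz
  have b2 := hJ.fieldL_mem n _ hw
  have : W.hess r - h ^ 3 * W.hess s
      = (-(W.w r)) * (W.fieldL r (W.z r) - h * W.fieldL s (W.z r))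
        + W.z r * (W.fieldL r (W.w r) - h * W.fieldL s (W.w r))
        + (-(W.w r) * h) * W.fieldL s (W.z r - h * W.z s)
        + (W.z r * h) * W.fieldL s (W.w r - h * W.w s)
        + (-(h * W.fieldL s (h * W.z s))) * (W.w r - h * W.w s)
        + (h * W.fieldL s (h * W.w s)) * (W.z r - h * W.z s) := by
    rw [hess_eq, hess_eq, map_sub, map_sub, Derivation.leibniz, Derivation.leibniz]
    simp only [smul_eq_mul]
    ring
  rw [this]
  refine (J n).add_mem ((J n).add_mem ((J n).add_mem ((J n).add_mem ((J n).add_mem ?_ ?_) ?_) ?_)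
    ?_) ?_ <;> apply (J n).mul_mem_left
  exacts [hle a1, hle a2, b1, b2, hle hw, hle hz]

theorem col_sub_mem (hJ : W.TangentialFiltration s J) (hz : W.z r - h * W.z s ∈ J (n + 1))
    (hw : W.w r - h * W.w s ∈ J (n + 1)) (i : Fin 5) :
    W.col r i - h ^ 3 * W.col s i ∈ J n := by
  have hz' := hJ.anti n.le_succ hz
  have hw' := hJ.anti n.le_succ hw
  have key : ∀ {a b c a' b' c' : R}, a - h * a' ∈ J n → b - h * b' ∈ J n → c - h * c' ∈ J n →
      a * b * c - h ^ 3 * (a' * b' * c') ∈ J n := by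
    intro a b c a' b' c' ha hb hc
    have := mul_sub_mul_mem (mul_sub_mul_mem ha hb) hc
    convert this using 1
    ring
  fin_cases i
  · convert key hw' hw' hw' using 1
    simp [col]; ring
  · convert key hz' hw' hw' using 1
    simp [col]; ring
  · convert key hz' hz' hw' using 1
    simp [col]; ring
  · convert key hz' hz' hz' using 1
    simp [col]; ring
  · exact hess_sub_mem hJ hz hw

theorem iterate_sub_mem (hJ : W.TangentialFiltration s J)
    (hz : W.zbar r - h' * W.zbar s ∈ J n) (hw : W.wbar r - h' * W.wbar s ∈ J n)
    {f g : R} {j m : ℕ} (hfg : f - g ∈ J (m + j)) (hmn : m + j ≤ n + 1) :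
    (W.fieldLbar r)^[j] f - (h' • W.fieldLbar s)^[j] g ∈ J m := by
  induction j generalizing m with
  | zero => exact hfg
  | succ j ih =>
    have h1 := ih (m := m + 1) (by convert hfg using 2; omega) (by omega)
    have h2 := hJ.fieldLbar_mem m _ h1
    have h3 := hJ.anti (show m ≤ n by omega) (fieldLbar_sub_mem hz hw ((W.fieldLbar r)^[j] f))
    rw [Function.iterate_succ_apply', Function.iterate_succ_apply', Derivation.smul_apply,
      smul_eq_mul]
    rw [map_sub] at h2
    convert (J m).add_mem h3 ((J m).mul_mem_left h' h2) using 1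
    ring

/-- Transformation law of the determinant of `A₃`: it is enough that the gradients be proportional
to order six, since the Hessian and the four iterations of the (0,1) field each lose one order. -/
theorem det_matrixA3_change (hJ : W.TangentialFiltration s J) (ev : R →ₐ[ℂ] ℂ)
    (hev : ∀ f ∈ J 1, ev f = 0)
    (hz : W.z r - h * W.z s ∈ J 6) (hw : W.w r - h * W.w s ∈ J 6)
    (hz' : W.zbar r - h' * W.zbar s ∈ J 6) (hw' : W.wbar r - h' * W.wbar s ∈ J 6) :
    ev (W.matrixA3 r).det = ev (W.matrixA3 s).det * ∏ j : Fin 5, ev (h ^ 3 * h' ^ (j : ℕ)) := by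
  have h1 : ev.mapMatrix (W.matrixA3 r)
      = ev.mapMatrix (Matrix.of fun i j : Fin 5 =>
          (h' • W.fieldLbar s)^[(j : ℕ)] (h ^ 3 * W.col s i)) := by
    ext i j
    rw [← sub_eq_zero]
    simp only [AlgHom.mapMatrix_apply, Matrix.map_apply, matrixA3, Matrix.of_apply]
    rw [← map_sub]
    refine hev _ (iterate_sub_mem hJ hz' hw' (hJ.anti ?_ (col_sub_mem (n := 5) hJ hz hw i)) ?_)
    all_goals omega
  rw [AlgHom.map_det, h1, ← AlgHom.map_det, det_iterate_derivation_smul_mul, map_mul, map_prod]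
  rfl

theorem levi_change (hJ : W.TangentialFiltration s J) (ev : R →ₐ[ℂ] ℂ)
    (hev : ∀ f ∈ J 1, ev f = 0)
    (hz : W.z r - h * W.z s ∈ J 2) (hw : W.w r - h * W.w s ∈ J 2)
    (hz' : W.zbar r - h' * W.zbar s ∈ J 2) (hw' : W.wbar r - h' * W.wbar s ∈ J 2) :
    ev (W.levi r) = ev (h ^ 2 * h' * W.levi s) := by
  have hle : J 2 ≤ J 1 := hJ.anti (by norm_num)
  have key : ∀ {f g : R}, f - g ∈ J 2 → ev (W.fieldLbar r f) = ev (h' * W.fieldLbar s g) := by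
    intro f g hfg
    rw [← sub_eq_zero, ← map_sub]
    exact hev _ (iterate_sub_mem (j := 1) (m := 1) (n := 2) hJ hz' hw' hfg (by norm_num))
  have e1 : ev (W.z r) = ev (h * W.z s) := by
    rw [← sub_eq_zero, ← map_sub]; exact hev _ (hle hz)
  have e2 : ev (W.w r) = ev (h * W.w s) := by
    rw [← sub_eq_zero, ← map_sub]; exact hev _ (hle hw)
  rw [levi, map_sub, map_mul, map_mul, key hz, key hw, e1, e2, levi, Derivation.leibniz,
    Derivation.leibniz]
  simp only [smul_eq_mul, map_mul, map_add, map_sub, map_pow]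
  ring

end Change

/-! ### Hypersurfaces with vanishing Hessian in suitable holomorphic coordinates -/

theorem fieldLbar_eq_zero {f : R} (h1 : W.zbar f = 0) (h2 : W.wbar f = 0) (s : R) :
    W.fieldLbar s f = 0 := by
  rw [fieldLbar_apply, h1, h2]
  simp

/-- A defining function `s = f α + g β + γ` with `f, g` holomorphic and `α, β, γ` antiholomorphic,
such as that of the sphere in any holomorphic coordinates, has degenerate `A₃`: its Hessian is a
cubic form in the gradient with holomorphic coefficients. -/
theorem det_matrixA3_eq_zero {s f g α β γ : R} (hs : s = f * α + g * β + γ)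
    (hf : W.zbar f = 0 ∧ W.wbar f = 0) (hg : W.zbar g = 0 ∧ W.wbar g = 0)
    (hα : W.z α = 0 ∧ W.w α = 0) (hβ : W.z β = 0 ∧ W.w β = 0) (hγ : W.z γ = 0 ∧ W.w γ = 0)
    (ev : R →ₐ[ℂ] ℂ) (hd : ev (W.z f * W.w g - W.w f * W.z g) ≠ 0) :
    ev (W.matrixA3 s).det = 0 := by
  set δ := W.z f * W.w g - W.w f * W.z g with hδ
  have hz : W.z s = W.z f * α + W.z g * β := by
    simp [hs, hα, hβ, hγ, Derivation.leibniz]; ring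
  have hw : W.w s = W.w f * α + W.w g * β := by
    simp [hs, hα, hβ, hγ, Derivation.leibniz]; ring
  have hol : ∀ {x : R}, W.zbar x = 0 ∧ W.wbar x = 0 →
      (W.zbar (W.z x) = 0 ∧ W.wbar (W.z x) = 0) ∧ (W.zbar (W.w x) = 0 ∧ W.wbar (W.w x) = 0) := by
    rintro x ⟨h1, h2⟩
    simp [W.zbar_z, W.zbar_w, W.wbar_z, W.wbar_w, h1, h2]
  have hfz := (hol hf).1
  have hfw := (hol hf).2
  have hgz := (hol hg).1
  have hgw := (hol hg).2
  have hα' : δ * α = W.w g * W.z s - W.z g * W.w s := by rw [hz, hw]; ring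
  have hβ' : δ * β = W.z f * W.w s - W.w f * W.z s := by rw [hz, hw]; ring
  -- coefficients of the second derivatives of `s` in terms of its first derivatives
  set A : R → R → R := fun x y => x * W.w g - y * W.w f with hA
  set B : R → R → R := fun x y => y * W.z f - x * W.z g with hB
  have key : ∀ x y, δ * (x * α + y * β) = A x y * W.z s + B x y * W.w s := by
    intro x y
    linear_combination x * hα' + y * hβ'
  have hzz : W.z (W.z s) = W.z (W.z f) * α + W.z (W.z g) * β := by
    simp [hz, hα, hβ, Derivation.leibniz]; ring
  have hwz : W.w (W.z s) = W.w (W.z f) * α + W.w (W.z g) * β := by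
    simp [hz, hα, hβ, Derivation.leibniz]; ring
  have hww : W.w (W.w s) = W.w (W.w f) * α + W.w (W.w g) * β := by
    simp [hw, hα, hβ, Derivation.leibniz]; ring
  set a1 := A (W.z (W.z f)) (W.z (W.z g)) with ha1
  set b1 := B (W.z (W.z f)) (W.z (W.z g)) with hb1
  set a2 := A (W.w (W.z f)) (W.w (W.z g)) with ha2
  set b2 := B (W.w (W.z f)) (W.w (W.z g)) with hb2
  set a3 := A (W.w (W.w f)) (W.w (W.w g)) with ha3
  set b3 := B (W.w (W.w f)) (W.w (W.w g)) with hb3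
  set c : Fin 5 → R := ![b1, a1 - 2 * b2, b3 - 2 * a2, a3, -δ] with hc
  have hsum : ∑ i, c i * W.col s i = 0 := by
    have h1 := key (W.z (W.z f)) (W.z (W.z g))
    have h2 := key (W.w (W.z f)) (W.w (W.z g))
    have h3 := key (W.w (W.w f)) (W.w (W.w g))
    rw [← hzz] at h1
    rw [← hwz] at h2
    rw [← hww] at h3
    simp [Fin.sum_univ_five, hc, col, hess]
    linear_combination (-(W.w s ^ 2)) * h1 + 2 * W.z s * W.w s * h2 - W.z s ^ 2 * h3
  have hc0 : ∀ i, W.fieldLbar s (c i) = 0 := by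
    have hAB : ∀ x y, W.zbar x = 0 ∧ W.wbar x = 0 → W.zbar y = 0 ∧ W.wbar y = 0 →
        (W.fieldLbar s (A x y) = 0 ∧ W.fieldLbar s (B x y) = 0) := by
      intro x y hx hy
      constructor <;> apply fieldLbar_eq_zero <;>
        simp [hA, hB, Derivation.leibniz, hx, hy, hfz, hfw, hgz, hgw]
    have p1 := hAB _ _ (hol hfz).1 (hol hgz).1
    have p2 := hAB _ _ (hol hfz).2 (hol hgz).2
    have p3 := hAB _ _ (hol hfw).2 (hol hgw).2
    have p4 : W.fieldLbar s δ = 0 := by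
      apply fieldLbar_eq_zero <;> simp [hδ, Derivation.leibniz, hfz, hfw, hgz, hgw]
    have h2 : W.fieldLbar s 2 = 0 := by
      simpa using (W.fieldLbar s).map_natCast 2
    intro i
    fin_cases i <;> simp [hc, Derivation.leibniz, p1, p2, p3, p4, ha1, ha2, ha3, hb1, hb2, hb3, h2]
  rw [AlgHom.map_det, ← Matrix.exists_vecMul_eq_zero_iff]
  refine ⟨fun i => ev (c i), fun h0 => hd ?_, ?_⟩
  · simpa [hc] using congrFun h0 4
  · ext j
    have h1 : (W.fieldLbar s)^[(j : ℕ)] (∑ i, c i * W.col s i) = 0 := by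
      rw [hsum]
      clear hsum
      induction (j : ℕ) with
      | zero => rfl
      | succ m ih => rw [Function.iterate_succ_apply', ih, map_zero]
    rw [iterate_derivation_sum] at h1
    simp only [iterate_derivation_const_mul _ (hc0 _)] at h1
    have h2 := congrArg ev h1
    simpa [Matrix.vecMul, dotProduct, matrixA3] using h2

end WirtingerAlgebra

/-! ### The hypersurface `(log |z|)² + (log |w|)² = ε²` -/

namespace WirtingerAlgebra

variable {R : Type*} [CommRing R] [Algebra ℂ R]

/-- Elements that behave like `a = log |z|`, `b = log |w|`, the coordinates `z`, `w`, their
conjugates, and the inverses of these four. -/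
structure LogCoordinates (W : WirtingerAlgebra R) where
  (a b z w zc wc zi wi zci wci : R)
  z_mul : z * zi = 1
  w_mul : w * wi = 1
  zc_mul : zc * zci = 1
  wc_mul : wc * wci = 1
  z_a : W.z a = (1 / 2 : ℂ) • zi
  w_a : W.w a = 0
  zbar_a : W.zbar a = (1 / 2 : ℂ) • zci
  wbar_a : W.wbar a = 0
  z_b : W.z b = 0
  w_b : W.w b = (1 / 2 : ℂ) • wi
  zbar_b : W.zbar b = 0
  wbar_b : W.wbar b = (1 / 2 : ℂ) • wci
  z_zi : W.z zi = -zi ^ 2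
  w_zi : W.w zi = 0
  w_wi : W.w wi = -wi ^ 2
  zbar_z : W.zbar z = 0
  wbar_z : W.wbar z = 0
  zbar_w : W.zbar w = 0
  wbar_w : W.wbar w = 0
  zbar_zi : W.zbar zi = 0
  wbar_zi : W.wbar zi = 0
  zbar_wi : W.zbar wi = 0
  wbar_wi : W.wbar wi = 0

variable {W : WirtingerAlgebra R} (C : W.LogCoordinates) (e : ℂ)

namespace LogCoordinates

/-- The defining function `a² + b² - e`. -/
def defFun : R := C.a ^ 2 + C.b ^ 2 - algebraMap ℂ R e

/-- The multiple of `fieldLbar` that acts on functions of `a` and `b` as half the angular field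
`-b ∂/∂a + a ∂/∂b`. -/
def rot : Derivation ℂ R R := (C.zc * C.wc) • W.fieldLbar (C.defFun e)

theorem half_two (x : R) : (1 / 2 : ℂ) • (2 * x) = x := by
  rw [two_mul, ← two_smul ℂ x, smul_smul]
  norm_num

theorem z_defFun : W.z (C.defFun e) = C.a * C.zi := by
  simp only [defFun, map_sub, map_add, Derivation.leibniz_pow, C.z_a, C.z_b,
    Derivation.map_algebraMap]
  simp only [Nat.add_one_sub_one, pow_one, smul_eq_mul, nsmul_eq_mul, Nat.cast_ofNat, mul_zero,
    add_zero, sub_zero, mul_smul_comm]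
  rw [half_two]

theorem w_defFun : W.w (C.defFun e) = C.b * C.wi := by
  simp only [defFun, map_sub, map_add, Derivation.leibniz_pow, C.w_a, C.w_b,
    Derivation.map_algebraMap]
  simp only [Nat.add_one_sub_one, pow_one, smul_eq_mul, nsmul_eq_mul, Nat.cast_ofNat, mul_zero,
    zero_add, sub_zero, mul_smul_comm]
  rw [half_two]

theorem zbar_defFun : W.zbar (C.defFun e) = C.a * C.zci := by
  simp only [defFun, map_sub, map_add, Derivation.leibniz_pow, C.zbar_a, C.zbar_b,
    Derivation.map_algebraMap]
  simp only [Nat.add_one_sub_one, pow_one, smul_eq_mul, nsmul_eq_mul, Nat.cast_ofNat, mul_zero,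
    add_zero, sub_zero, mul_smul_comm]
  rw [half_two]

theorem wbar_defFun : W.wbar (C.defFun e) = C.b * C.wci := by
  simp only [defFun, map_sub, map_add, Derivation.leibniz_pow, C.wbar_a, C.wbar_b,
    Derivation.map_algebraMap]
  simp only [Nat.add_one_sub_one, pow_one, smul_eq_mul, nsmul_eq_mul, Nat.cast_ofNat, mul_zero,
    zero_add, sub_zero, mul_smul_comm]
  rw [half_two]

theorem fieldLbar_eq : W.fieldLbar (C.defFun e) = (C.zci * C.wci) • C.rot e := by
  ext f
  simp only [rot, Derivation.smul_apply, smul_eq_mul]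
  linear_combination (-(C.wc * C.wci) * W.fieldLbar (C.defFun e) f) * C.zc_mul
    - W.fieldLbar (C.defFun e) f * C.wc_mul

theorem rot_a : C.rot e C.a = -((1 / 2 : ℂ) • C.b) := by
  simp only [rot, Derivation.smul_apply, smul_eq_mul, fieldLbar_apply, C.zbar_a, C.wbar_a,
    wbar_defFun, mul_zero, add_zero, Algebra.smul_def]
  linear_combination (-(algebraMap ℂ R (1 / 2)) * C.b) * C.zc_mul
    + (-(algebraMap ℂ R (1 / 2)) * C.b * (C.zc * C.zci)) * C.wc_mul

theorem rot_b : C.rot e C.b = (1 / 2 : ℂ) • C.a := by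
  simp only [rot, Derivation.smul_apply, smul_eq_mul, fieldLbar_apply, C.zbar_b, C.wbar_b,
    zbar_defFun, mul_zero, zero_add, Algebra.smul_def]
  linear_combination ((algebraMap ℂ R (1 / 2)) * C.a) * C.zc_mul
    + ((algebraMap ℂ R (1 / 2)) * C.a * (C.zc * C.zci)) * C.wc_mul

theorem rot_z : C.rot e C.z = 0 := by
  simp [rot, fieldLbar_apply, C.zbar_z, C.wbar_z]

theorem rot_w : C.rot e C.w = 0 := by
  simp [rot, fieldLbar_apply, C.zbar_w, C.wbar_w]

theorem fieldLbar_zi : W.fieldLbar (C.defFun e) C.zi = 0 := by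
  simp [fieldLbar_apply, C.zbar_zi, C.wbar_zi]

theorem fieldLbar_wi : W.fieldLbar (C.defFun e) C.wi = 0 := by
  simp [fieldLbar_apply, C.zbar_wi, C.wbar_wi]

theorem levi_defFun : W.levi (C.defFun e)
    = (1 / 2 : ℂ) • (C.zi * C.wi * C.zci * C.wci * (C.a ^ 2 + C.b ^ 2)) := by
  have ha : W.fieldLbar (C.defFun e) C.a = C.zci * C.wci * -((1 / 2 : ℂ) • C.b) := by
    rw [fieldLbar_eq, Derivation.smul_apply, rot_a, smul_eq_mul]
  have hb : W.fieldLbar (C.defFun e) C.b = C.zci * C.wci * ((1 / 2 : ℂ) • C.a) := by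
    rw [fieldLbar_eq, Derivation.smul_apply, rot_b, smul_eq_mul]
  rw [levi, z_defFun, w_defFun, Derivation.leibniz, Derivation.leibniz, fieldLbar_zi, fieldLbar_wi,
    ha, hb]
  simp only [smul_eq_mul, Algebra.smul_def]
  ring

theorem hess_defFun : W.hess (C.defFun e) = C.zi ^ 2 * C.wi ^ 2 *
    ((1 / 2 : ℂ) • (C.a ^ 2 + C.b ^ 2) - C.a * C.b ^ 2 - C.a ^ 2 * C.b) := by
  simp only [hess, z_defFun, w_defFun, Derivation.leibniz, C.z_a, C.z_zi, C.w_a, C.w_zi, C.w_b,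
    C.w_wi, smul_eq_mul, Algebra.smul_def]
  ring

/-- The eigenvectors of the angular field: with `E = a + i b`, the products `E³`, `E² Ē`, `E Ē²`,
`Ē³`, `E Ē`, written as cubic or quadratic forms. -/
def eigenvector : Fin 5 → R :=
  let E := C.a + Complex.I • C.b
  let F := C.a - Complex.I • C.b
  ![E ^ 3, E ^ 2 * F, E * F ^ 2, F ^ 3, E * F]

/-- The eigenvalues of the angular field on `eigenvector`. -/
def eigenvalue : Fin 5 → ℂ :=
  ![3 / 2 * Complex.I, 1 / 2 * Complex.I, -(1 / 2) * Complex.I, -(3 / 2) * Complex.I, 0]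

theorem derivation_mul_of_eigenvectors (D : Derivation ℂ R R) {x y : R} {c d : ℂ}
    (hx : D x = c • x) (hy : D y = d • y) : D (x * y) = (c + d) • (x * y) := by
  rw [Derivation.leibniz, hx, hy]
  simp only [smul_eq_mul, Algebra.smul_def, map_add]
  ring

theorem rot_eigenvector (i : Fin 5) :
    C.rot e (C.eigenvector i) = eigenvalue i • C.eigenvector i := by
  have hI : algebraMap ℂ R Complex.I * algebraMap ℂ R Complex.I = -1 := by
    rw [← map_mul, Complex.I_mul_I, map_neg, map_one]
  have hE : C.rot e (C.a + Complex.I • C.b)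
      = (1 / 2 * Complex.I : ℂ) • (C.a + Complex.I • C.b) := by
    simp only [map_add, Derivation.map_smul, rot_a, rot_b]
    simp only [Algebra.smul_def, map_mul]
    linear_combination (-(algebraMap ℂ R (1 / 2)) * C.b) * hI
  have hF : C.rot e (C.a - Complex.I • C.b)
      = (-(1 / 2) * Complex.I : ℂ) • (C.a - Complex.I • C.b) := by
    simp only [map_sub, Derivation.map_smul, rot_a, rot_b]
    simp only [Algebra.smul_def, map_mul, map_neg]
    linear_combination (-(algebraMap ℂ R (1 / 2)) * C.b) * hI
  have hEE := derivation_mul_of_eigenvectors _ hE hE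
  have hFF := derivation_mul_of_eigenvectors _ hF hF
  fin_cases i
  · convert derivation_mul_of_eigenvectors _ hEE hE using 2 <;> simp [eigenvector, eigenvalue] <;>
      ring
  · convert derivation_mul_of_eigenvectors _ hEE hF using 2 <;> simp [eigenvector, eigenvalue] <;>
      ring
  · convert derivation_mul_of_eigenvectors _ hE hFF using 2 <;> simp [eigenvector, eigenvalue] <;>
      ring
  · convert derivation_mul_of_eigenvectors _ hFF hF using 2 <;> simp [eigenvector, eigenvalue] <;>
      ring
  · convert derivation_mul_of_eigenvectors _ hE hF using 2 <;> simp [eigenvector, eigenvalue]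

/-- The coefficients, annihilated by the angular field, of the eigenvectors in terms of the first
column of `A₃`. -/
def coeff : Matrix (Fin 5) (Fin 5) R :=
  let i := algebraMap ℂ R Complex.I
  let p := C.w ^ 3
  let q := C.z * C.w ^ 2
  let r := C.z ^ 2 * C.w
  let s := C.z ^ 3
  !![-i * p, -3 * q, 3 * i * r, s, 0;
    i * p, q, i * r, s, 0;
    -i * p, q, -i * r, s, 0;
    i * p, -3 * q, -3 * i * r, s, 0;
    0, 2 * q, 2 * r, 0, 2 * C.z ^ 2 * C.w ^ 2]

theorem rot_coeff (i k : Fin 5) : C.rot e (C.coeff i k) = 0 := by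
  have h2 : ∀ n : ℕ, C.rot e (n : R) = 0 := fun n => (C.rot e).map_natCast n
  have h2' := h2 2
  have h3' := h2 3
  push_cast at h2' h3'
  fin_cases i <;> fin_cases k <;>
    simp [coeff, Derivation.leibniz, Derivation.leibniz_pow, rot_z, rot_w, h2', h3']

theorem sum_coeff (i : Fin 5) :
    ∑ k, C.coeff i k * W.col (C.defFun e) k = C.eigenvector i := by
  have hI : algebraMap ℂ R Complex.I ^ 2 = -1 := by
    rw [← map_pow, Complex.I_sq, map_neg, map_one]
  have hz : ∀ n, C.z ^ n * C.zi ^ n = 1 := fun n => by rw [← mul_pow, C.z_mul, one_pow]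
  have hw : ∀ n, C.w ^ n * C.wi ^ n = 1 := fun n => by rw [← mul_pow, C.w_mul, one_pow]
  have h2 : 2 * algebraMap ℂ R (1 / 2) = 1 := by
    rw [← map_ofNat (algebraMap ℂ R) 2, ← map_mul]
    norm_num
  have e1 : C.w ^ 3 * (C.b * C.wi) ^ 3 = C.b ^ 3 := by
    rw [mul_pow]; linear_combination C.b ^ 3 * hw 3
  have e2 : C.z * C.w ^ 2 * (C.a * C.zi * (C.b * C.wi) ^ 2) = C.a * C.b ^ 2 := by
    linear_combination C.a * C.b ^ 2 * C.z_mul + C.z * C.zi * C.a * C.b ^ 2 * hw 2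
  have e3 : C.z ^ 2 * C.w * ((C.a * C.zi) ^ 2 * (C.b * C.wi)) = C.a ^ 2 * C.b := by
    linear_combination C.a ^ 2 * C.b * C.w_mul + C.w * C.wi * C.a ^ 2 * C.b * hz 2
  have e4 : C.z ^ 3 * (C.a * C.zi) ^ 3 = C.a ^ 3 := by
    rw [mul_pow]; linear_combination C.a ^ 3 * hz 3
  have e5 : C.z ^ 2 * C.w ^ 2 * W.hess (C.defFun e)
      = (1 / 2 : ℂ) • (C.a ^ 2 + C.b ^ 2) - C.a * C.b ^ 2 - C.a ^ 2 * C.b := by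
    rw [hess_defFun]
    generalize (1 / 2 : ℂ) • (C.a ^ 2 + C.b ^ 2) - C.a * C.b ^ 2 - C.a ^ 2 * C.b = y
    linear_combination y * hw 2 + C.w ^ 2 * C.wi ^ 2 * y * hz 2
  rw [Algebra.smul_def] at e5
  simp only [Fin.sum_univ_five, col, z_defFun, w_defFun, Matrix.cons_val]
  generalize W.hess (C.defFun e) = H at e5 ⊢
  generalize C.a * C.zi = x at e2 e3 e4 ⊢
  generalize C.b * C.wi = y at e1 e2 e3 ⊢
  generalize hJ : algebraMap ℂ R Complex.I = J at hI
  fin_cases i <;> simp [eigenvector, coeff, Algebra.smul_def, hJ]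
  · linear_combination (-J) * e1 - 3 * e2 + 3 * J * e3 + e4 - (3 * C.a * C.b ^ 2 + C.b ^ 3 * J) * hI
  · linear_combination J * e1 + e2 + J * e3 + e4 + (C.a * C.b ^ 2 + C.b ^ 3 * J) * hI
  · linear_combination (-J) * e1 + e2 - J * e3 + e4 + (C.a * C.b ^ 2 - C.b ^ 3 * J) * hI
  · linear_combination J * e1 - 3 * e2 - 3 * J * e3 + e4 - (3 * C.a * C.b ^ 2 - C.b ^ 3 * J) * hI
  · linear_combination 2 * e2 + 2 * e3 + 2 * e5 + (C.a ^ 2 + C.b ^ 2) * h2 + C.b ^ 2 * hI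

/-- A constant matrix for the angular field turns the first column of `A₃` into eigenvectors, and
`A₃` itself into a Vandermonde matrix with rescaled rows. -/
theorem det_matrixA3_ne_zero (ev : R →ₐ[ℂ] ℂ) (hab : ev (C.a ^ 2 + C.b ^ 2) ≠ 0) :
    ev (W.matrixA3 (C.defFun e)).det ≠ 0 := by
  have hu : ∀ x y : R, x * y = 1 → ev y ≠ 0 := by
    intro x y hxy h0
    simpa [h0] using congrArg ev hxy
  have h1 := det_iterate_derivation_smul_mul (C.rot e) (C.zci * C.wci) 1 (W.col (C.defFun e))
  simp only [one_mul, ← fieldLbar_eq] at h1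
  rw [matrixA3, h1, map_mul]
  refine mul_ne_zero (fun h0 => ?_) ?_
  · have h2 : C.coeff * (Matrix.of fun i j : Fin 5 => (C.rot e)^[(j : ℕ)] (W.col (C.defFun e) i))
        = Matrix.of fun i j : Fin 5 => eigenvalue i ^ (j : ℕ) • C.eigenvector i := by
      ext i j
      rw [Matrix.mul_apply, Matrix.of_apply]
      simp only [Matrix.of_apply, ← iterate_derivation_const_mul _ (C.rot_coeff e i _)]
      rw [← iterate_derivation_sum, sum_coeff]
      induction (j : ℕ) with
      | zero => simp
      | succ m ih =>
        rw [Function.iterate_succ_apply', ih, Derivation.map_smul, rot_eigenvector, smul_smul,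
          pow_succ]
    have h3 := congrArg (fun M : Matrix (Fin 5) (Fin 5) R => ev M.det) h2
    simp only [Matrix.det_mul, map_mul, h0, mul_zero] at h3
    have h4 : (ev : R →+* ℂ).mapMatrix
        (Matrix.of fun i j : Fin 5 => eigenvalue i ^ (j : ℕ) • C.eigenvector i)
        = Matrix.of fun i j => ev (C.eigenvector i) * Matrix.vandermonde eigenvalue i j := by
      ext i j
      simp [Matrix.vandermonde_apply, mul_comm]
    have h5 : ev (Matrix.of fun i j : Fin 5 => eigenvalue i ^ (j : ℕ) • C.eigenvector i).det
        = (∏ i, ev (C.eigenvector i)) * (Matrix.vandermonde eigenvalue).det := by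
      rw [← Matrix.det_mul_column, ← h4]
      exact RingHom.map_det (ev : R →+* ℂ) _
    rw [h5] at h3
    refine (mul_ne_zero (Finset.prod_ne_zero_iff.2 fun i _ => ?_)
      (Matrix.det_vandermonde_ne_zero_iff.2 ?_)) h3.symm
    · have h6 : ev (C.a ^ 2 + C.b ^ 2)
          = (ev C.a + Complex.I * ev C.b) * (ev C.a - Complex.I * ev C.b) := by
        simp only [map_add, map_pow]
        linear_combination (ev C.b) ^ 2 * Complex.I_sq
      rw [h6] at hab
      have hl := left_ne_zero_of_mul hab
      have hr := right_ne_zero_of_mul hab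
      fin_cases i <;> simp [eigenvector, hl, hr]
    · intro i j hij
      have him := congrArg Complex.im hij
      fin_cases i <;> fin_cases j <;> first | rfl | (exfalso; norm_num [eigenvalue] at him)
  · rw [map_prod]
    refine Finset.prod_ne_zero_iff.2 fun j _ => ?_
    rw [map_pow, map_mul]
    exact pow_ne_zero _ (mul_ne_zero (hu _ _ C.zc_mul) (hu _ _ C.wc_mul))

end LogCoordinates

end WirtingerAlgebra

/-! ### The algebra of germs of smooth functions -/

/-- Germs of complex valued functions form a complex algebra. -/
instance germAlgebra (p : ℂ × ℂ) : Algebra ℂ (Filter.Germ (𝓝 p) ℂ) :=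
  Algebra.ofModule
    (fun c f g => by
      induction f using Filter.Germ.inductionOn
      induction g using Filter.Germ.inductionOn
      simp only [← Filter.Germ.coe_smul, ← Filter.Germ.coe_mul, smul_mul_assoc])
    (fun c f g => by
      induction f using Filter.Germ.inductionOn
      induction g using Filter.Germ.inductionOn
      simp only [← Filter.Germ.coe_smul, ← Filter.Germ.coe_mul, mul_smul_comm])

/-- The algebra of germs at `p` of smooth complex valued functions. -/
def SmoothGerm (p : ℂ × ℂ) : Subalgebra ℂ (Filter.Germ (𝓝 p) ℂ) where
  carrier := {φ | ∃ f : ℂ × ℂ → ℂ, ContDiffAt ℝ ∞ f p ∧ (f : Filter.Germ (𝓝 p) ℂ) = φ}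
  mul_mem' := by
    rintro _ _ ⟨f, hf, rfl⟩ ⟨g, hg, rfl⟩
    exact ⟨f * g, hf.mul hg, rfl⟩
  add_mem' := by
    rintro _ _ ⟨f, hf, rfl⟩ ⟨g, hg, rfl⟩
    exact ⟨f + g, hf.add hg, rfl⟩
  algebraMap_mem' c := by
    refine ⟨fun _ => c, contDiffAt_const, ?_⟩
    rw [Algebra.algebraMap_eq_smul_one]
    change _ = c • ((1 : ℂ × ℂ → ℂ) : Filter.Germ (𝓝 p) ℂ)
    rw [← Filter.Germ.coe_smul]
    congr 1
    ext x
    simp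

variable {p : ℂ × ℂ}

/-- The germ at `p` of a function that is smooth at `p`. -/
def toGerm (f : ℂ × ℂ → ℂ) (hf : ContDiffAt ℝ ∞ f p) : SmoothGerm p :=
  ⟨(f : Filter.Germ (𝓝 p) ℂ), f, hf, rfl⟩

theorem exists_toGerm (φ : SmoothGerm p) : ∃ f hf, toGerm f hf = φ := by
  obtain ⟨_, f, hf, rfl⟩ := φ
  exact ⟨f, hf, rfl⟩

theorem toGerm_eq_iff {f g : ℂ × ℂ → ℂ} (hf : ContDiffAt ℝ ∞ f p) (hg : ContDiffAt ℝ ∞ g p) :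
    toGerm f hf = toGerm g hg ↔ f =ᶠ[𝓝 p] g := by
  rw [← Filter.Germ.coe_eq]
  exact Subtype.ext_iff

theorem toGerm_add {f g : ℂ × ℂ → ℂ} (hf : ContDiffAt ℝ ∞ f p) (hg : ContDiffAt ℝ ∞ g p) :
    toGerm f hf + toGerm g hg = toGerm (fun x => f x + g x) (hf.add hg) := rfl

theorem toGerm_sub {f g : ℂ × ℂ → ℂ} (hf : ContDiffAt ℝ ∞ f p) (hg : ContDiffAt ℝ ∞ g p) :
    toGerm f hf - toGerm g hg = toGerm (fun x => f x - g x) (hf.sub hg) := rfl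

theorem toGerm_mul {f g : ℂ × ℂ → ℂ} (hf : ContDiffAt ℝ ∞ f p) (hg : ContDiffAt ℝ ∞ g p) :
    toGerm f hf * toGerm g hg = toGerm (fun x => f x * g x) (hf.mul hg) := rfl

theorem toGerm_smul {f : ℂ × ℂ → ℂ} (hf : ContDiffAt ℝ ∞ f p) (c : ℂ) :
    c • toGerm f hf = toGerm (fun x => c • f x) (hf.const_smul c) := rfl

theorem toGerm_algebraMap (c : ℂ) :
    algebraMap ℂ (SmoothGerm p) c = toGerm (fun _ => c) contDiffAt_const := by
  rw [Algebra.algebraMap_eq_smul_one]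
  change c • toGerm (fun _ => 1) contDiffAt_const = _
  rw [toGerm_smul]
  simp

theorem toGerm_one : (1 : SmoothGerm p) = toGerm (fun _ => 1) contDiffAt_const := rfl

/-- The value of a germ at the base point. -/
def evalGerm (p : ℂ × ℂ) : SmoothGerm p →ₐ[ℂ] ℂ where
  toRingHom := Filter.Germ.valueRingHom.comp (SmoothGerm p).val.toRingHom
  commutes' c := by rw [toGerm_algebraMap]; rfl

theorem evalGerm_toGerm {f : ℂ × ℂ → ℂ} (hf : ContDiffAt ℝ ∞ f p) :
    evalGerm p (toGerm f hf) = f p := rfl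

theorem exists_mul_eq_one {φ : SmoothGerm p} (h : evalGerm p φ ≠ 0) : ∃ u, φ * u = 1 := by
  obtain ⟨f, hf, rfl⟩ := exists_toGerm φ
  rw [evalGerm_toGerm] at h
  refine ⟨toGerm (fun x => (f x)⁻¹) (hf.inv h), ?_⟩
  rw [toGerm_mul, toGerm_one, toGerm_eq_iff]
  filter_upwards [hf.continuousAt.eventually_ne h] with x hx
  exact mul_inv_cancel₀ hx

theorem contDiffAt_fderiv_apply {f : ℂ × ℂ → ℂ} (hf : ContDiffAt ℝ ∞ f p) (v : ℂ × ℂ) :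
    ContDiffAt ℝ ∞ (fun x => fderiv ℝ f x v) p :=
  (hf.fderiv_right (by simp)).clm_apply contDiffAt_const

theorem eventually_differentiableAt {f : ℂ × ℂ → ℂ} (hf : ContDiffAt ℝ ∞ f p) :
    ∀ᶠ x in 𝓝 p, DifferentiableAt ℝ f x := by
  filter_upwards [(hf.of_le (m := 1) (by simp)).eventually (by simp)] with x hx
  exact hx.differentiableAt (by simp)

/-- The derivative in the constant direction `v`, on all germs. -/
def germDeriv (p v : ℂ × ℂ) : Filter.Germ (𝓝 p) ℂ → Filter.Germ (𝓝 p) ℂ :=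
  Quotient.map (fun f x => fderiv ℝ f x v) fun _ _ h => by
    filter_upwards [Filter.EventuallyEq.fderiv (𝕜 := ℝ) h] with x hx
    rw [hx]

/-- The derivative in the constant direction `v` as a derivation of smooth germs. -/
def dirDeriv (p v : ℂ × ℂ) : Derivation ℂ (SmoothGerm p) (SmoothGerm p) where
  toFun φ := ⟨germDeriv p v φ, by
    obtain ⟨f, hf, rfl⟩ := exists_toGerm φ
    exact ⟨_, contDiffAt_fderiv_apply hf v, rfl⟩⟩
  map_add' φ ψ := by
    obtain ⟨f, hf, rfl⟩ := exists_toGerm φ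
    obtain ⟨g, hg, rfl⟩ := exists_toGerm ψ
    refine (toGerm_eq_iff (contDiffAt_fderiv_apply (hf.add hg) v)
      ((contDiffAt_fderiv_apply hf v).add (contDiffAt_fderiv_apply hg v))).2 ?_
    filter_upwards [eventually_differentiableAt hf, eventually_differentiableAt hg] with x h1 h2
    rw [fderiv_fun_add h1 h2]
    rfl
  map_smul' c φ := by
    obtain ⟨f, hf, rfl⟩ := exists_toGerm φ
    refine (toGerm_eq_iff (contDiffAt_fderiv_apply (hf.const_smul c) v)
      ((contDiffAt_fderiv_apply hf v).const_smul c)).2 ?_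
    filter_upwards [eventually_differentiableAt hf] with x h1
    rw [fderiv_fun_const_smul h1]
    rfl
  map_one_eq_zero' := by
    refine (toGerm_eq_iff (contDiffAt_fderiv_apply contDiffAt_const v) contDiffAt_const).2 ?_
    refine Filter.Eventually.of_forall fun x => ?_
    change fderiv ℝ (fun _ => (1 : ℂ)) x v = 0
    simp
  leibniz' φ ψ := by
    obtain ⟨f, hf, rfl⟩ := exists_toGerm φ
    obtain ⟨g, hg, rfl⟩ := exists_toGerm ψ
    refine (toGerm_eq_iff (contDiffAt_fderiv_apply (hf.mul hg) v)
      ((hf.mul (contDiffAt_fderiv_apply hg v)).add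
        (hg.mul (contDiffAt_fderiv_apply hf v)))).2 ?_
    filter_upwards [eventually_differentiableAt hf, eventually_differentiableAt hg] with x h1 h2
    rw [fderiv_fun_mul h1 h2]
    rfl

theorem dirDeriv_toGerm {f : ℂ × ℂ → ℂ} (hf : ContDiffAt ℝ ∞ f p) (v : ℂ × ℂ) :
    dirDeriv p v (toGerm f hf)
      = toGerm (fun x => fderiv ℝ f x v) (contDiffAt_fderiv_apply hf v) := rfl

theorem dirDeriv_comm (u v : ℂ × ℂ) (φ : SmoothGerm p) :
    dirDeriv p u (dirDeriv p v φ) = dirDeriv p v (dirDeriv p u φ) := by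
  obtain ⟨f, hf, rfl⟩ := exists_toGerm φ
  simp only [dirDeriv_toGerm]
  rw [toGerm_eq_iff]
  have h2 : ContDiffAt ℝ 2 f p := hf.of_le (WithTop.coe_le_coe.2 (le_top : (2 : ℕ∞) ≤ ⊤))
  filter_upwards [h2.eventually (by simp)] with x hx
  have hd : DifferentiableAt ℝ (fderiv ℝ f) x :=
    (hx.fderiv_right (m := 1) (by norm_num)).differentiableAt (by simp)
  rw [fderiv_clm_apply hd (differentiableAt_const _),
    fderiv_clm_apply hd (differentiableAt_const _)]
  have := hx.isSymmSndFDerivAt (by simp)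
  simpa using this u v

theorem contDiffAt_wirt {f : ℂ × ℂ → ℂ} (hf : ContDiffAt ℝ ∞ f p) (v : ℂ × ℂ) :
    ContDiffAt ℝ ∞ (wirt v f) p :=
  ((contDiffAt_fderiv_apply hf v).sub
    (contDiffAt_const.mul (contDiffAt_fderiv_apply hf _))).div_const _

theorem contDiffAt_wirtBar {f : ℂ × ℂ → ℂ} (hf : ContDiffAt ℝ ∞ f p) (v : ℂ × ℂ) :
    ContDiffAt ℝ ∞ (wirtBar v f) p :=
  ((contDiffAt_fderiv_apply hf v).add
    (contDiffAt_const.mul (contDiffAt_fderiv_apply hf _))).div_const _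

/-- `wirt v` as a derivation of smooth germs. -/
def wirtDer (p v : ℂ × ℂ) : Derivation ℂ (SmoothGerm p) (SmoothGerm p) :=
  (1 / 2 : ℂ) • (dirDeriv p v - Complex.I • dirDeriv p (Complex.I • v))

/-- `wirtBar v` as a derivation of smooth germs. -/
def wirtBarDer (p v : ℂ × ℂ) : Derivation ℂ (SmoothGerm p) (SmoothGerm p) :=
  (1 / 2 : ℂ) • (dirDeriv p v + Complex.I • dirDeriv p (Complex.I • v))

theorem wirtDer_toGerm {f : ℂ × ℂ → ℂ} (hf : ContDiffAt ℝ ∞ f p) (v : ℂ × ℂ) :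
    wirtDer p v (toGerm f hf) = toGerm (wirt v f) (contDiffAt_wirt hf v) := by
  simp only [wirtDer, Derivation.smul_apply, Derivation.sub_apply, dirDeriv_toGerm, toGerm_smul,
    toGerm_sub]
  rw [toGerm_eq_iff]
  refine Filter.Eventually.of_forall fun x => ?_
  simp only [wirt, smul_eq_mul]
  ring

theorem wirtBarDer_toGerm {f : ℂ × ℂ → ℂ} (hf : ContDiffAt ℝ ∞ f p) (v : ℂ × ℂ) :
    wirtBarDer p v (toGerm f hf) = toGerm (wirtBar v f) (contDiffAt_wirtBar hf v) := by
  simp only [wirtBarDer, Derivation.smul_apply, Derivation.add_apply, dirDeriv_toGerm,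
    toGerm_smul, toGerm_add]
  rw [toGerm_eq_iff]
  refine Filter.Eventually.of_forall fun x => ?_
  simp only [wirtBar, smul_eq_mul]
  ring

/-- The Wirtinger derivations of smooth germs. -/
def germWirtinger (p : ℂ × ℂ) : WirtingerAlgebra (SmoothGerm p) where
  z := wirtDer p (1, 0)
  w := wirtDer p (0, 1)
  zbar := wirtBarDer p (1, 0)
  wbar := wirtBarDer p (0, 1)
  w_z f := by
    simp only [wirtDer, Derivation.smul_apply, Derivation.sub_apply, Derivation.map_smul, map_sub,
      dirDeriv_comm (0, 1), dirDeriv_comm (Complex.I • (0, 1))]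
    module
  zbar_z f := by
    simp only [wirtDer, wirtBarDer, Derivation.smul_apply, Derivation.sub_apply,
      Derivation.add_apply, Derivation.map_smul, map_sub, map_add,
      dirDeriv_comm (Complex.I • (1, 0)) (1, 0)]
    module
  zbar_w f := by
    simp only [wirtDer, wirtBarDer, Derivation.smul_apply, Derivation.sub_apply,
      Derivation.add_apply, Derivation.map_smul, map_sub, map_add,
      dirDeriv_comm (1, 0), dirDeriv_comm (Complex.I • (1, 0))]
    module
  wbar_z f := by
    simp only [wirtDer, wirtBarDer, Derivation.smul_apply, Derivation.sub_apply,
      Derivation.add_apply, Derivation.map_smul, map_sub, map_add,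
      dirDeriv_comm (0, 1), dirDeriv_comm (Complex.I • (0, 1))]
    module
  wbar_w f := by
    simp only [wirtDer, wirtBarDer, Derivation.smul_apply, Derivation.sub_apply,
      Derivation.add_apply, Derivation.map_smul, map_sub, map_add,
      dirDeriv_comm (Complex.I • (0, 1)) (0, 1)]
    module

/-- The function `f` is smooth at `p` with germ `φ`. -/
def HasGerm (f : ℂ × ℂ → ℂ) (φ : SmoothGerm p) : Prop := ∃ hf : ContDiffAt ℝ ∞ f p, toGerm f hf = φ

theorem hasGerm_toGerm {f : ℂ × ℂ → ℂ} (hf : ContDiffAt ℝ ∞ f p) : HasGerm f (toGerm f hf) :=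
  ⟨hf, rfl⟩

namespace HasGerm

variable {f g : ℂ × ℂ → ℂ} {φ ψ : SmoothGerm p}

theorem eval (h : HasGerm f φ) : evalGerm p φ = f p := by
  obtain ⟨hf, rfl⟩ := h
  rfl

theorem eq_iff (hf : HasGerm f φ) (hg : HasGerm g ψ) : φ = ψ ↔ f =ᶠ[𝓝 p] g := by
  obtain ⟨hf, rfl⟩ := hf
  obtain ⟨hg, rfl⟩ := hg
  exact toGerm_eq_iff hf hg

theorem add (hf : HasGerm f φ) (hg : HasGerm g ψ) : HasGerm (fun x => f x + g x) (φ + ψ) := by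
  obtain ⟨hf, rfl⟩ := hf
  obtain ⟨hg, rfl⟩ := hg
  exact ⟨hf.add hg, rfl⟩

theorem sub (hf : HasGerm f φ) (hg : HasGerm g ψ) : HasGerm (fun x => f x - g x) (φ - ψ) := by
  obtain ⟨hf, rfl⟩ := hf
  obtain ⟨hg, rfl⟩ := hg
  exact ⟨hf.sub hg, rfl⟩

theorem mul (hf : HasGerm f φ) (hg : HasGerm g ψ) : HasGerm (fun x => f x * g x) (φ * ψ) := by
  obtain ⟨hf, rfl⟩ := hf
  obtain ⟨hg, rfl⟩ := hg
  exact ⟨hf.mul hg, rfl⟩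

theorem neg (hf : HasGerm f φ) : HasGerm (fun x => -f x) (-φ) := by
  obtain ⟨hf, rfl⟩ := hf
  exact ⟨hf.neg, rfl⟩

theorem pow (hf : HasGerm f φ) (n : ℕ) : HasGerm (fun x => f x ^ n) (φ ^ n) := by
  obtain ⟨hf, rfl⟩ := hf
  exact ⟨hf.pow n, Subtype.ext rfl⟩

theorem const (c : ℂ) : HasGerm (fun _ => c) (algebraMap ℂ (SmoothGerm p) c) :=
  ⟨contDiffAt_const, (toGerm_algebraMap c).symm⟩

theorem smul (hf : HasGerm f φ) (c : ℂ) : HasGerm (fun x => c • f x) (c • φ) := by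
  obtain ⟨hf, rfl⟩ := hf
  exact ⟨hf.const_smul c, rfl⟩

theorem wirt (hf : HasGerm f φ) (v : ℂ × ℂ) : HasGerm (wirt v f) (wirtDer p v φ) := by
  obtain ⟨hf, rfl⟩ := hf
  exact ⟨contDiffAt_wirt hf v, (wirtDer_toGerm hf v).symm⟩

theorem wirtBar (hf : HasGerm f φ) (v : ℂ × ℂ) : HasGerm (wirtBar v f) (wirtBarDer p v φ) := by
  obtain ⟨hf, rfl⟩ := hf
  exact ⟨contDiffAt_wirtBar hf v, (wirtBarDer_toGerm hf v).symm⟩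

theorem dZ (hf : HasGerm f φ) : HasGerm (dZ f) ((germWirtinger p).z φ) := hf.wirt _

theorem dW (hf : HasGerm f φ) : HasGerm (dW f) ((germWirtinger p).w φ) := hf.wirt _

theorem dZbar (hf : HasGerm f φ) : HasGerm (dZbar f) ((germWirtinger p).zbar φ) := hf.wirtBar _

theorem dWbar (hf : HasGerm f φ) : HasGerm (dWbar f) ((germWirtinger p).wbar φ) := hf.wirtBar _

theorem Lbar (hg : HasGerm g ψ) (hf : HasGerm f φ) :
    HasGerm (Lbar g f) ((germWirtinger p).fieldLbar ψ φ) :=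
  (hg.dWbar.neg.mul hf.dZbar).add (hg.dZbar.mul hf.dWbar)

theorem colA3 (hf : HasGerm f φ) (i : Fin 5) :
    HasGerm (colA3 f i) ((germWirtinger p).col φ i) := by
  have h2 : HasGerm (fun _ => (2 : ℂ)) (2 : SmoothGerm p) := by
    have := HasGerm.const (p := p) 2
    rwa [map_ofNat] at this
  fin_cases i
  · exact hf.dW.pow 3
  · exact hf.dZ.mul (hf.dW.pow 2)
  · exact (hf.dZ.pow 2).mul hf.dW
  · exact hf.dZ.pow 3
  · exact ((hf.dZ.dZ.mul (hf.dW.pow 2)).sub (((h2.mul hf.dZ.dW).mul hf.dZ).mul hf.dW)).add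
      (hf.dW.dW.mul (hf.dZ.pow 2))

theorem iterate_Lbar_colA3 (hf : HasGerm f φ) (i : Fin 5) (m : ℕ) :
    HasGerm ((CRUmbilic.Lbar f)^[m] (CRUmbilic.colA3 f i))
      (((germWirtinger p).fieldLbar φ)^[m] ((germWirtinger p).col φ i)) := by
  induction m with
  | zero => exact hf.colA3 i
  | succ m ih =>
    rw [Function.iterate_succ_apply', Function.iterate_succ_apply']
    exact hf.Lbar ih

theorem det_matA3 (hf : HasGerm f φ) :
    (matA3 f p).det = evalGerm p ((germWirtinger p).matrixA3 φ).det := by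
  refine Eq.trans (congrArg Matrix.det ?_)
    (RingHom.map_det (evalGerm p : SmoothGerm p →+* ℂ) _).symm
  ext i j
  exact (hf.iterate_Lbar_colA3 i j).eval.symm

theorem leviDet (hf : HasGerm f φ) :
    leviDet f p = evalGerm p ((germWirtinger p).levi φ) := by
  rw [CRUmbilic.leviDet, Matrix.det_fin_two_of]
  exact ((hf.dZ.mul (hf.Lbar hf.dW)).sub ((hf.Lbar hf.dZ).mul hf.dW)).eval.symm

end HasGerm

/-! ### Wirtinger derivatives of explicit functions -/

section Wirtinger

variable {f : ℂ × ℂ → ℂ} {x v : ℂ × ℂ}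

theorem wirt_of_hasFDerivAt {L : ℂ × ℂ →L[ℝ] ℂ} (h : HasFDerivAt f L x) (v : ℂ × ℂ) :
    wirt v f x = (L v - Complex.I * L (Complex.I • v)) / 2 := by
  rw [wirt, h.fderiv]

theorem wirtBar_of_hasFDerivAt {L : ℂ × ℂ →L[ℝ] ℂ} (h : HasFDerivAt f L x) (v : ℂ × ℂ) :
    wirtBar v f x = (L v + Complex.I * L (Complex.I • v)) / 2 := by
  rw [wirtBar, h.fderiv]

theorem wirt_of_holomorphic {L : ℂ × ℂ →L[ℂ] ℂ} (h : HasFDerivAt f L x) (v : ℂ × ℂ) :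
    wirt v f x = L v := by
  rw [wirt_of_hasFDerivAt (h.restrictScalars ℝ)]
  simp only [ContinuousLinearMap.coe_restrictScalars', map_smul, smul_eq_mul]
  linear_combination (-(L v) / 2) * Complex.I_mul_I

theorem wirtBar_of_holomorphic {L : ℂ × ℂ →L[ℂ] ℂ} (h : HasFDerivAt f L x) (v : ℂ × ℂ) :
    wirtBar v f x = 0 := by
  rw [wirtBar_of_hasFDerivAt (h.restrictScalars ℝ)]
  simp only [ContinuousLinearMap.coe_restrictScalars', map_smul, smul_eq_mul]
  linear_combination ((L v) / 2) * Complex.I_mul_I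

theorem fderiv_conj_comp (f : ℂ × ℂ → ℂ) (x v : ℂ × ℂ) :
    fderiv ℝ (fun y => starRingEnd ℂ (f y)) x v = starRingEnd ℂ (fderiv ℝ f x v) := by
  have : (fun y => starRingEnd ℂ (f y)) = Complex.conjCLE ∘ f := rfl
  rw [this, Complex.conjCLE.comp_fderiv]
  simp

theorem wirt_conj_comp (f : ℂ × ℂ → ℂ) (x v : ℂ × ℂ) :
    wirt v (fun y => starRingEnd ℂ (f y)) x = starRingEnd ℂ (wirtBar v f x) := by
  simp [wirt, wirtBar, fderiv_conj_comp, sub_eq_add_neg, map_ofNat]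

theorem wirtBar_conj_comp (f : ℂ × ℂ → ℂ) (x v : ℂ × ℂ) :
    wirtBar v (fun y => starRingEnd ℂ (f y)) x = starRingEnd ℂ (wirt v f x) := by
  simp [wirt, wirtBar, fderiv_conj_comp, map_ofNat]

theorem wirtBar_cplx (r : ℂ × ℂ → ℝ) (x v : ℂ × ℂ) :
    wirtBar v (cplx r) x = starRingEnd ℂ (wirt v (cplx r) x) := by
  rw [← wirtBar_conj_comp]
  simp only [cplx, Complex.conj_ofReal]
  rfl

theorem fderiv_apply_eq (f : ℂ × ℂ → ℂ) (x v : ℂ × ℂ) :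
    fderiv ℝ f x v = wirt v f x + wirtBar v f x := by
  simp only [wirt, wirtBar]
  ring

theorem fderiv_apply_split (f : ℂ × ℂ → ℂ) (x v : ℂ × ℂ) :
    fderiv ℝ f x v = v.1.re * fderiv ℝ f x (1, 0) + v.1.im * fderiv ℝ f x (Complex.I • (1, 0))
      + v.2.re * fderiv ℝ f x (0, 1) + v.2.im * fderiv ℝ f x (Complex.I • (0, 1)) := by
  have hv : v = v.1.re • (1, 0) + v.1.im • (Complex.I • (1, 0)) + v.2.re • (0, 1)
      + v.2.im • (Complex.I • ((0, 1) : ℂ × ℂ)) := by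
    ext <;> simp
  conv_lhs => rw [hv]
  simp only [map_add, map_smul, Complex.real_smul]

theorem wirt_eq (f : ℂ × ℂ → ℂ) (x v : ℂ × ℂ) :
    wirt v f x = v.1 * dZ f x + v.2 * dW f x := by
  have h1 : v.1 = v.1.re + v.1.im * Complex.I := (Complex.re_add_im _).symm
  have h2 : v.2 = v.2.re + v.2.im * Complex.I := (Complex.re_add_im _).symm
  rw [h1, h2, wirt, fderiv_apply_split f x v, fderiv_apply_split f x (Complex.I • v), dZ, dW, wirt,
    wirt]
  simp only [Prod.smul_fst, Prod.smul_snd, smul_eq_mul, Complex.I_mul_re, Complex.I_mul_im]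
  push_cast
  linear_combination ((v.1.im / 2 : ℂ) * fderiv ℝ f x (Complex.I • (1, 0))
    + (v.2.im / 2 : ℂ) * fderiv ℝ f x (Complex.I • (0, 1))) * Complex.I_mul_I

theorem dZ_ne_zero_or_dW_ne_zero {r : ℂ × ℂ → ℝ} (hr : DifferentiableAt ℝ r x)
    (h : fderiv ℝ r x ≠ 0) : dZ (cplx r) x ≠ 0 ∨ dW (cplx r) x ≠ 0 := by
  by_contra! h0
  refine h (ContinuousLinearMap.ext fun v => ?_)
  have h1 : fderiv ℝ (cplx r) x v = (fderiv ℝ r x v : ℂ) := by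
    have := (Complex.ofRealCLM.hasFDerivAt.comp x hr.hasFDerivAt).fderiv
    rw [show cplx r = Complex.ofRealCLM ∘ r from rfl, this]
    rfl
  have h2 := fderiv_apply_eq (cplx r) x v
  rw [h1, wirtBar_cplx, wirt_eq, h0.1, h0.2] at h2
  simpa using h2

end Wirtinger

theorem contDiffAt_cplx {r : ℂ × ℂ → ℝ} {p : ℂ × ℂ} (hr : ContDiffAt ℝ ∞ r p) :
    ContDiffAt ℝ ∞ (cplx r) p :=
  Complex.ofRealCLM.contDiff.contDiffAt.comp p hr

/-! ### Functions vanishing on a hypersurface -/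

/-- If `f` vanishes on the smooth hypersurface `{s = 0}`, its differential there is a multiple of
that of `s`, by Lagrange multipliers. -/
theorem exists_fderiv_eq_mul {s : ℂ × ℂ → ℝ} {f : ℂ × ℂ → ℂ} {x : ℂ × ℂ}
    (hs : ContDiffAt ℝ 1 s x) (hf : ContDiffAt ℝ 1 f x) (hds : fderiv ℝ s x ≠ 0) (hsx : s x = 0)
    (h : ∀ᶠ y in 𝓝 x, s y = 0 → f y = 0) :
    ∃ c : ℂ, ∀ v, fderiv ℝ f x v = c * fderiv ℝ (cplx s) x v := by
  have hs' : HasStrictFDerivAt s (fderiv ℝ s x) x := hs.hasStrictFDerivAt (by simp)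
  have hf' : HasStrictFDerivAt f (fderiv ℝ f x) x := hf.hasStrictFDerivAt (by simp)
  have hfx : f x = 0 := h.self_of_nhds hsx
  have key : ∀ A : ℂ →L[ℝ] ℝ, ∃ c : ℝ, ∀ v, A (fderiv ℝ f x v) = c * fderiv ℝ s x v := by
    intro A
    have hA : HasStrictFDerivAt (A ∘ f) (A.comp (fderiv ℝ f x)) x :=
      A.hasStrictFDerivAt.comp x hf'
    have hext : IsLocalExtrOn (A ∘ f) {y | s y = s x} x := by
      left
      filter_upwards [nhdsWithin_le_nhds h, self_mem_nhdsWithin] with y hy hy'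
      simp only [Function.comp_apply, hfx, hy (hy'.trans hsx), le_refl]
    obtain ⟨a, b, hab, h0⟩ := hext.exists_multipliers_of_hasStrictFDerivAt_1d hs' hA
    have hb : b ≠ 0 := by
      rintro rfl
      rw [zero_smul, add_zero, smul_eq_zero] at h0
      exact hab (by simp [h0.resolve_right hds])
    refine ⟨-a / b, fun v => ?_⟩
    have := DFunLike.congr_fun h0 v
    simp only [_root_.add_apply, _root_.smul_apply,
      ContinuousLinearMap.comp_apply, smul_eq_mul, _root_.zero_apply] at this
    field_simp
    linarith
  obtain ⟨c, hc⟩ := key Complex.reCLM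
  obtain ⟨d, hd⟩ := key Complex.imCLM
  refine ⟨⟨c, d⟩, fun v => ?_⟩
  have h1 : fderiv ℝ (cplx s) x v = (fderiv ℝ s x v : ℂ) := by
    have := (Complex.ofRealCLM.hasFDerivAt.comp x hs'.hasFDerivAt).fderiv
    rw [show cplx s = Complex.ofRealCLM ∘ s from rfl, this]
    rfl
  rw [h1]
  apply Complex.ext
  · simpa using hc v
  · simpa using hd v

/-- The ideal of germs of functions that vanish on `M` near `p`. -/
def vanishingIdeal (M : Set (ℂ × ℂ)) (p : ℂ × ℂ) : Ideal (SmoothGerm p) where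
  carrier := {φ | ∃ f, HasGerm f φ ∧ ∀ᶠ x in 𝓝 p, x ∈ M → f x = 0}
  zero_mem' := ⟨_, ⟨contDiffAt_const, rfl⟩, Filter.Eventually.of_forall fun _ _ => rfl⟩
  add_mem' := by
    rintro _ _ ⟨f, hf, hf0⟩ ⟨g, hg, hg0⟩
    refine ⟨_, hf.add hg, ?_⟩
    filter_upwards [hf0, hg0] with x h1 h2 hx
    simp [h1 hx, h2 hx]
  smul_mem' := by
    rintro φ _ ⟨g, hg, hg0⟩
    obtain ⟨f, hf, rfl⟩ := exists_toGerm φ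
    refine ⟨_, (hasGerm_toGerm hf).mul hg, ?_⟩
    filter_upwards [hg0] with x h2 hx
    simp [h2 hx]

section Tangential

variable {M : Set (ℂ × ℂ)} {p : ℂ × ℂ} {s : ℂ × ℂ → ℝ} {σ : SmoothGerm p}

theorem IsLocalDefiningFunction.contDiffAt (h : IsLocalDefiningFunction M s p) :
    ContDiffAt ℝ ∞ s p := by
  obtain ⟨-, U, hU, hpU, hs, -, -⟩ := h
  exact hs.contDiffAt (hU.mem_nhds hpU)

theorem IsLocalDefiningFunction.fderiv_ne_zero (h : IsLocalDefiningFunction M s p) :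
    fderiv ℝ s p ≠ 0 := by
  obtain ⟨hp, U, hU, hpU, hs, -, hd⟩ := h
  exact hd p hpU hp

/-- Along `M`, the differential of a function that vanishes on `M` is a multiple of that of the
defining function. -/
theorem eventually_wirt_eq_mul (h : IsLocalDefiningFunction M s p) {f : ℂ × ℂ → ℂ}
    (hf : ContDiffAt ℝ ∞ f p) (hf0 : ∀ᶠ x in 𝓝 p, x ∈ M → f x = 0) :
    ∀ᶠ x in 𝓝 p, x ∈ M → ∃ c : ℂ, ∀ v, wirt v f x = c * wirt v (cplx s) x ∧
      wirtBar v f x = c * wirtBar v (cplx s) x := by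
  have hf1 := (hf.of_le (m := 1) (by simp)).eventually (by simp)
  obtain ⟨-, U, hU, hpU, hs, hM, hd⟩ := h
  filter_upwards [hf1, hU.mem_nhds hpU, hf0.eventually_nhds] with x hx hxU hx0 hxM
  have hsx : ContDiffAt ℝ 1 s x := (hs.contDiffAt (hU.mem_nhds hxU)).of_le (by simp)
  obtain ⟨c, hc⟩ := exists_fderiv_eq_mul hsx hx (hd x hxU hxM) ((hM x hxU).1 hxM) (by
    filter_upwards [hx0, hU.mem_nhds hxU] with y hy hyU hsy
    exact hy ((hM y hyU).2 hsy))
  refine ⟨c, fun v => ?_⟩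
  simp only [wirt, wirtBar, hc]
  constructor <;> ring

/-- Tangential fields preserve the ideal of `M`, so the constant filtration is tangential. -/
theorem tangentialFiltration_vanishingIdeal (h : IsLocalDefiningFunction M s p)
    (hσ : HasGerm (cplx s) σ) :
    (germWirtinger p).TangentialFiltration σ fun _ => vanishingIdeal M p where
  anti := antitone_const
  fieldL_mem := by
    rintro - φ ⟨f, hf, hf0⟩
    refine ⟨_, (hσ.dW.neg.mul hf.dZ).add (hσ.dZ.mul hf.dW), ?_⟩
    filter_upwards [eventually_wirt_eq_mul h hf.1 hf0] with x hx hxM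
    obtain ⟨c, hc⟩ := hx hxM
    simp only [dZ, dW, hc]
    ring
  fieldLbar_mem := by
    rintro - φ ⟨f, hf, hf0⟩
    refine ⟨_, (hσ.dWbar.neg.mul hf.dZbar).add (hσ.dZbar.mul hf.dWbar), ?_⟩
    filter_upwards [eventually_wirt_eq_mul h hf.1 hf0] with x hx hxM
    obtain ⟨c, hc⟩ := hx hxM
    simp only [dZbar, dWbar, hc]
    ring

/-- The gradient of a real function with non-zero differential is a unimodular row. -/
theorem exists_gradient_mul_eq_one (hσ : HasGerm (cplx s) σ) (hs : DifferentiableAt ℝ s p)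
    (hds : fderiv ℝ s p ≠ 0) :
    ∃ u, ((germWirtinger p).z σ * (germWirtinger p).zbar σ
      + (germWirtinger p).w σ * (germWirtinger p).wbar σ) * u = 1 := by
  apply exists_mul_eq_one
  rw [((hσ.dZ.mul hσ.dZbar).add (hσ.dW.mul hσ.dWbar)).eval]
  simp only [dZbar, dWbar, wirtBar_cplx]
  change dZ (cplx s) p * starRingEnd ℂ (dZ (cplx s) p)
    + dW (cplx s) p * starRingEnd ℂ (dW (cplx s) p) ≠ 0
  rw [Complex.mul_conj, Complex.mul_conj, ← Complex.ofReal_add, Complex.ofReal_ne_zero]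
  rcases dZ_ne_zero_or_dW_ne_zero hs hds with h0 | h0
  · exact (add_pos_of_pos_of_nonneg (Complex.normSq_pos.2 h0) (Complex.normSq_nonneg _)).ne'
  · exact (add_pos_of_nonneg_of_pos (Complex.normSq_nonneg _) (Complex.normSq_pos.2 h0)).ne'

/-- The values of `det A₃` and of the Levi determinant for two defining functions of the same
hypersurface differ by a non-zero factor. -/
theorem invariants_ne_zero_of_isLocalDefiningFunction {r : ℂ × ℂ → ℝ}
    (hs : IsLocalDefiningFunction M s p) (hr : IsLocalDefiningFunction M r p)
    (hA : (matA3 (cplx s) p).det ≠ 0) (hl : leviDet (cplx s) p ≠ 0) :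
    (matA3 (cplx r) p).det ≠ 0 ∧ leviDet (cplx r) p ≠ 0 := by
  have hσ := hasGerm_toGerm (contDiffAt_cplx hs.contDiffAt)
  have hτ := hasGerm_toGerm (contDiffAt_cplx hr.contDiffAt)
  set σ := toGerm (cplx s) (contDiffAt_cplx hs.contDiffAt)
  set τ := toGerm (cplx r) (contDiffAt_cplx hr.contDiffAt)
  have hJ := tangentialFiltration_vanishingIdeal hs hσ
  have hev : ∀ f ∈ vanishingIdeal M p, (evalGerm p) f = 0 := by
    rintro _ ⟨f, hf, hf0⟩
    exact hf.eval.trans (hf0.self_of_nhds hs.1)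
  have hτI : τ ∈ vanishingIdeal M p := by
    refine ⟨_, hτ, ?_⟩
    obtain ⟨-, U, hU, hpU, -, hM, -⟩ := hr
    filter_upwards [hU.mem_nhds hpU] with x hx hxM
    simp [cplx, (hM x hx).1 hxM]
  obtain ⟨u, hu⟩ := exists_gradient_mul_eq_one hσ (hs.contDiffAt.differentiableAt (by simp))
    hs.fderiv_ne_zero
  obtain ⟨hz, hw⟩ := WirtingerAlgebra.gradient_sub_mem (n := 0) hJ hu hτI
  obtain ⟨hz', hw'⟩ := WirtingerAlgebra.gradientBar_sub_mem (n := 0) hJ hu hτI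
  set h := ((germWirtinger p).z τ * (germWirtinger p).zbar σ
      + (germWirtinger p).w τ * (germWirtinger p).wbar σ) * u
  set h' := ((germWirtinger p).zbar τ * (germWirtinger p).z σ
      + (germWirtinger p).wbar τ * (germWirtinger p).w σ) * u
  have hgrad := dZ_ne_zero_or_dW_ne_zero (hr.contDiffAt.differentiableAt (by simp))
    hr.fderiv_ne_zero
  have key : ∀ {a b c : SmoothGerm p} {f : ℂ × ℂ → ℂ}, HasGerm f a →
      a - b * c ∈ vanishingIdeal M p → f p ≠ 0 → evalGerm p b ≠ 0 := by
    intro a b c f hf hmem hfp hb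
    have h1 : evalGerm p (a - b * c) = 0 := hev _ hmem
    rw [map_sub, map_mul, hb, zero_mul, sub_zero, hf.eval] at h1
    exact hfp h1
  have hh : evalGerm p h ≠ 0 := by
    rcases hgrad with h0 | h0
    · exact key hτ.dZ hz h0
    · exact key hτ.dW hw h0
  have hh' : evalGerm p h' ≠ 0 := by
    rcases hgrad with h0 | h0
    · exact key hτ.dZbar hz' (by rw [dZbar, wirtBar_cplx]; exact (map_ne_zero _).2 h0)
    · exact key hτ.dWbar hw' (by rw [dWbar, wirtBar_cplx]; exact (map_ne_zero _).2 h0)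
  constructor
  · rw [hτ.det_matA3]
    rw [hσ.det_matA3] at hA
    have := WirtingerAlgebra.det_matrixA3_change hJ (evalGerm p) hev
      hz hw hz' hw'
    refine ne_of_eq_of_ne this (mul_ne_zero hA (Finset.prod_ne_zero_iff.2 fun j _ => ?_))
    rw [map_mul, map_pow, map_pow]
    exact mul_ne_zero (pow_ne_zero _ hh) (pow_ne_zero _ hh')
  · rw [hτ.leviDet]
    rw [hσ.leviDet] at hl
    have := WirtingerAlgebra.levi_change hJ (evalGerm p) hev
      hz hw hz' hw'
    refine ne_of_eq_of_ne this ?_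
    rw [map_mul, map_mul, map_pow]
    exact mul_ne_zero (mul_ne_zero (pow_ne_zero _ hh) hh') hl

end Tangential

/-! ### The logarithmic defining function -/

theorem hasFDerivAt_log_norm {z : ℂ} (hz : z ≠ 0) :
    HasFDerivAt (fun y : ℂ => Real.log ‖y‖)
      (Complex.reCLM.comp ((ContinuousLinearMap.toSpanSingleton ℂ z⁻¹).restrictScalars ℝ)) z := by
  have h1 : HasDerivAt (fun y : ℂ => Complex.log (y / z)) z⁻¹ z := by
    have := ((hasDerivAt_id z).div_const z).clog (by simp [hz])
    simpa [hz] using this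
  have h2 := Complex.reCLM.hasFDerivAt.comp z (h1.hasFDerivAt.restrictScalars ℝ)
  refine (h2.add_const (Real.log ‖z‖)).congr_of_eventuallyEq ?_
  filter_upwards [isOpen_ne.mem_nhds hz] with y hy
  simp only [Function.comp_apply, Complex.reCLM_apply, Complex.log_re, norm_div]
  rw [Real.log_div (norm_ne_zero_iff.2 hy) (norm_ne_zero_iff.2 hz)]
  ring

/-- The function `log |z|`, as a complex-valued one. -/
def logFst (x : ℂ × ℂ) : ℂ := (Real.log ‖x.1‖ : ℝ)

/-- The function `log |w|`. -/
def logSnd (x : ℂ × ℂ) : ℂ := (Real.log ‖x.2‖ : ℝ)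

section Log

variable {x : ℂ × ℂ}

theorem hasFDerivAt_logFst (h : x.1 ≠ 0) : ∃ L : ℂ × ℂ →L[ℝ] ℂ, HasFDerivAt logFst L x ∧
    ∀ v : ℂ × ℂ, L v = ((x.1⁻¹ * v.1).re : ℝ) := by
  refine ⟨_, Complex.ofRealCLM.hasFDerivAt.comp x ((hasFDerivAt_log_norm h).comp x
    hasFDerivAt_fst), fun v => ?_⟩
  simp [mul_comm]

theorem hasFDerivAt_logSnd (h : x.2 ≠ 0) : ∃ L : ℂ × ℂ →L[ℝ] ℂ, HasFDerivAt logSnd L x ∧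
    ∀ v : ℂ × ℂ, L v = ((x.2⁻¹ * v.2).re : ℝ) := by
  refine ⟨_, Complex.ofRealCLM.hasFDerivAt.comp x ((hasFDerivAt_log_norm h).comp x
    hasFDerivAt_snd), fun v => ?_⟩
  simp [mul_comm]

theorem re_sub_I_mul_re (c : ℂ) :
    (((c.re : ℝ) : ℂ) - Complex.I * ((Complex.I * c).re : ℝ)) / 2 = c / 2 := by
  apply Complex.ext <;> simp

theorem re_add_I_mul_re (c : ℂ) :
    (((c.re : ℝ) : ℂ) + Complex.I * ((Complex.I * c).re : ℝ)) / 2 = starRingEnd ℂ c / 2 := by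
  apply Complex.ext <;> simp

theorem mul_I_smul_fst (c : ℂ) (v : ℂ × ℂ) :
    c * (Complex.I • v).1 = Complex.I * (c * v.1) := mul_left_comm _ _ _

theorem mul_I_smul_snd (c : ℂ) (v : ℂ × ℂ) :
    c * (Complex.I • v).2 = Complex.I * (c * v.2) := mul_left_comm _ _ _

theorem wirt_logFst (h : x.1 ≠ 0) (v : ℂ × ℂ) : wirt v logFst x = x.1⁻¹ * v.1 / 2 := by
  obtain ⟨L, hL, hLv⟩ := hasFDerivAt_logFst h
  rw [wirt_of_hasFDerivAt hL, hLv, hLv, mul_I_smul_fst, re_sub_I_mul_re]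

theorem wirtBar_logFst (h : x.1 ≠ 0) (v : ℂ × ℂ) :
    wirtBar v logFst x = starRingEnd ℂ (x.1⁻¹ * v.1) / 2 := by
  obtain ⟨L, hL, hLv⟩ := hasFDerivAt_logFst h
  rw [wirtBar_of_hasFDerivAt hL, hLv, hLv, mul_I_smul_fst, ← re_add_I_mul_re]

theorem wirt_logSnd (h : x.2 ≠ 0) (v : ℂ × ℂ) : wirt v logSnd x = x.2⁻¹ * v.2 / 2 := by
  obtain ⟨L, hL, hLv⟩ := hasFDerivAt_logSnd h
  rw [wirt_of_hasFDerivAt hL, hLv, hLv, mul_I_smul_snd, re_sub_I_mul_re]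

theorem wirtBar_logSnd (h : x.2 ≠ 0) (v : ℂ × ℂ) :
    wirtBar v logSnd x = starRingEnd ℂ (x.2⁻¹ * v.2) / 2 := by
  obtain ⟨L, hL, hLv⟩ := hasFDerivAt_logSnd h
  rw [wirtBar_of_hasFDerivAt hL, hLv, hLv, mul_I_smul_snd, ← re_add_I_mul_re]

theorem contDiffAt_log_norm_fst (h : x.1 ≠ 0) :
    ContDiffAt ℝ ∞ (fun y : ℂ × ℂ => Real.log ‖y.1‖) x :=
  (contDiffAt_fst.norm ℝ h).log (norm_ne_zero_iff.2 h)

theorem contDiffAt_log_norm_snd (h : x.2 ≠ 0) :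
    ContDiffAt ℝ ∞ (fun y : ℂ × ℂ => Real.log ‖y.2‖) x :=
  (contDiffAt_snd.norm ℝ h).log (norm_ne_zero_iff.2 h)

theorem contDiffAt_logFst (h : x.1 ≠ 0) : ContDiffAt ℝ ∞ logFst x :=
  contDiffAt_cplx (contDiffAt_log_norm_fst h)

theorem contDiffAt_logSnd (h : x.2 ≠ 0) : ContDiffAt ℝ ∞ logSnd x :=
  contDiffAt_cplx (contDiffAt_log_norm_snd h)

theorem contDiffAt_conj {f : ℂ × ℂ → ℂ} (hf : ContDiffAt ℝ ∞ f x) :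
    ContDiffAt ℝ ∞ (fun y => starRingEnd ℂ (f y)) x :=
  Complex.conjCLE.contDiff.contDiffAt.comp x hf

theorem contDiffAt_inv_fst (h : x.1 ≠ 0) :
    ContDiffAt ℝ ∞ (fun y : ℂ × ℂ => y.1⁻¹) x := contDiffAt_fst.inv h

theorem contDiffAt_inv_snd (h : x.2 ≠ 0) :
    ContDiffAt ℝ ∞ (fun y : ℂ × ℂ => y.2⁻¹) x := contDiffAt_snd.inv h

theorem hasFDerivAt_inv_fst (h : x.1 ≠ 0) : ∃ L : ℂ × ℂ →L[ℂ] ℂ,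
    HasFDerivAt (fun y : ℂ × ℂ => y.1⁻¹) L x ∧ ∀ v, L v = -(x.1⁻¹) ^ 2 * v.1 := by
  refine ⟨_, (hasDerivAt_inv h).hasFDerivAt.comp x hasFDerivAt_fst, fun v => ?_⟩
  simp [mul_comm]

theorem hasFDerivAt_inv_snd (h : x.2 ≠ 0) : ∃ L : ℂ × ℂ →L[ℂ] ℂ,
    HasFDerivAt (fun y : ℂ × ℂ => y.2⁻¹) L x ∧ ∀ v, L v = -(x.2⁻¹) ^ 2 * v.2 := by
  refine ⟨_, (hasDerivAt_inv h).hasFDerivAt.comp x hasFDerivAt_snd, fun v => ?_⟩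
  simp [mul_comm]

/-- The logarithmic coordinates in the algebra of germs at a point off the axes. -/
def germLogCoordinates (p : ℂ × ℂ) (h1 : p.1 ≠ 0) (h2 : p.2 ≠ 0) :
    (germWirtinger p).LogCoordinates :=
  have n1 : ∀ᶠ y in 𝓝 p, y.1 ≠ 0 := continuousAt_fst.eventually_ne h1
  have n2 : ∀ᶠ y in 𝓝 p, y.2 ≠ 0 := continuousAt_snd.eventually_ne h2
  have ca := hasGerm_toGerm (contDiffAt_logFst h1)
  have cb := hasGerm_toGerm (contDiffAt_logSnd h2)
  have cz := hasGerm_toGerm (contDiffAt_fst (𝕜 := ℝ) (n := ∞) (p := p))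
  have cw := hasGerm_toGerm (contDiffAt_snd (𝕜 := ℝ) (n := ∞) (p := p))
  have czi := hasGerm_toGerm (contDiffAt_inv_fst h1)
  have cwi := hasGerm_toGerm (contDiffAt_inv_snd h2)
  have czc := hasGerm_toGerm (contDiffAt_conj cz.1)
  have cwc := hasGerm_toGerm (contDiffAt_conj cw.1)
  have czci := hasGerm_toGerm (contDiffAt_conj czi.1)
  have cwci := hasGerm_toGerm (contDiffAt_conj cwi.1)
  have c0 : HasGerm (fun _ => (0 : ℂ)) (0 : SmoothGerm p) := ⟨contDiffAt_const, rfl⟩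
  have c1 : HasGerm (fun _ => (1 : ℂ)) (1 : SmoothGerm p) := ⟨contDiffAt_const, rfl⟩
  { a := toGerm logFst (contDiffAt_logFst h1)
    b := toGerm logSnd (contDiffAt_logSnd h2)
    z := toGerm Prod.fst cz.1
    w := toGerm Prod.snd cw.1
    zc := toGerm _ czc.1
    wc := toGerm _ cwc.1
    zi := toGerm _ czi.1
    wi := toGerm _ cwi.1
    zci := toGerm _ czci.1
    wci := toGerm _ cwci.1
    z_mul := ((cz.mul czi).eq_iff c1).2 (n1.mono fun y hy => mul_inv_cancel₀ hy)
    w_mul := ((cw.mul cwi).eq_iff c1).2 (n2.mono fun y hy => mul_inv_cancel₀ hy)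
    zc_mul := ((czc.mul czci).eq_iff c1).2 (n1.mono fun y hy =>
      (map_mul (starRingEnd ℂ) _ _).symm.trans (by rw [mul_inv_cancel₀ hy, map_one]))
    wc_mul := ((cwc.mul cwci).eq_iff c1).2 (n2.mono fun y hy =>
      (map_mul (starRingEnd ℂ) _ _).symm.trans (by rw [mul_inv_cancel₀ hy, map_one]))
    z_a := (ca.dZ.eq_iff (czi.smul _)).2 (n1.mono fun y hy => by
      simp [dZ, wirt_logFst hy]; ring)
    w_a := (ca.dW.eq_iff c0).2 (n1.mono fun y hy => by
      simp [dW, wirt_logFst hy])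
    zbar_a := (ca.dZbar.eq_iff (czci.smul _)).2 (n1.mono fun y hy => by
      simp [dZbar, wirtBar_logFst hy]; ring)
    wbar_a := (ca.dWbar.eq_iff c0).2 (n1.mono fun y hy => by
      simp [dWbar, wirtBar_logFst hy])
    z_b := (cb.dZ.eq_iff c0).2 (n2.mono fun y hy => by
      simp [dZ, wirt_logSnd hy])
    w_b := (cb.dW.eq_iff (cwi.smul _)).2 (n2.mono fun y hy => by
      simp [dW, wirt_logSnd hy]; ring)
    zbar_b := (cb.dZbar.eq_iff c0).2 (n2.mono fun y hy => by
      simp [dZbar, wirtBar_logSnd hy])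
    wbar_b := (cb.dWbar.eq_iff (cwci.smul _)).2 (n2.mono fun y hy => by
      simp [dWbar, wirtBar_logSnd hy]; ring)
    z_zi := (czi.dZ.eq_iff (czi.pow 2).neg).2 (n1.mono fun y hy => by
      obtain ⟨L, hL, hLv⟩ := hasFDerivAt_inv_fst hy
      simp only [dZ, wirt_of_holomorphic hL, hLv]; ring)
    w_zi := (czi.dW.eq_iff c0).2 (n1.mono fun y hy => by
      obtain ⟨L, hL, hLv⟩ := hasFDerivAt_inv_fst hy
      simp only [dW, wirt_of_holomorphic hL, hLv]; ring)
    w_wi := (cwi.dW.eq_iff (cwi.pow 2).neg).2 (n2.mono fun y hy => by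
      obtain ⟨L, hL, hLv⟩ := hasFDerivAt_inv_snd hy
      simp only [dW, wirt_of_holomorphic hL, hLv]; ring)
    zbar_z := (cz.dZbar.eq_iff c0).2 (.of_forall fun _ => wirtBar_of_holomorphic hasFDerivAt_fst _)
    wbar_z := (cz.dWbar.eq_iff c0).2 (.of_forall fun _ => wirtBar_of_holomorphic hasFDerivAt_fst _)
    zbar_w := (cw.dZbar.eq_iff c0).2 (.of_forall fun _ => wirtBar_of_holomorphic hasFDerivAt_snd _)
    wbar_w := (cw.dWbar.eq_iff c0).2 (.of_forall fun _ => wirtBar_of_holomorphic hasFDerivAt_snd _)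
    zbar_zi := (czi.dZbar.eq_iff c0).2 (n1.mono fun y hy => by
      obtain ⟨L, hL, -⟩ := hasFDerivAt_inv_fst hy
      exact wirtBar_of_holomorphic hL _)
    wbar_zi := (czi.dWbar.eq_iff c0).2 (n1.mono fun y hy => by
      obtain ⟨L, hL, -⟩ := hasFDerivAt_inv_fst hy
      exact wirtBar_of_holomorphic hL _)
    zbar_wi := (cwi.dZbar.eq_iff c0).2 (n2.mono fun y hy => by
      obtain ⟨L, hL, -⟩ := hasFDerivAt_inv_snd hy
      exact wirtBar_of_holomorphic hL _)
    wbar_wi := (cwi.dWbar.eq_iff c0).2 (n2.mono fun y hy => by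
      obtain ⟨L, hL, -⟩ := hasFDerivAt_inv_snd hy
      exact wirtBar_of_holomorphic hL _) }

variable {p : ℂ × ℂ} (h1 : p.1 ≠ 0) (h2 : p.2 ≠ 0)

theorem hasGerm_a : HasGerm logFst (germLogCoordinates p h1 h2).a :=
  hasGerm_toGerm (contDiffAt_logFst h1)

theorem hasGerm_b : HasGerm logSnd (germLogCoordinates p h1 h2).b :=
  hasGerm_toGerm (contDiffAt_logSnd h2)

theorem hasGerm_zci : HasGerm (fun x => starRingEnd ℂ x.1⁻¹) (germLogCoordinates p h1 h2).zci :=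
  hasGerm_toGerm (contDiffAt_conj (contDiffAt_inv_fst h1))

theorem hasGerm_wci : HasGerm (fun x => starRingEnd ℂ x.2⁻¹) (germLogCoordinates p h1 h2).wci :=
  hasGerm_toGerm (contDiffAt_conj (contDiffAt_inv_snd h2))

end Log

/-- The defining function `(log |z|)² + (log |w|)² - ε²`. -/
def logDefFun (ε : ℝ) (x : ℂ × ℂ) : ℝ := Real.log ‖x.1‖ ^ 2 + Real.log ‖x.2‖ ^ 2 - ε ^ 2

/-- The hypersurface `(log |z|)² + (log |w|)² = ε²`. -/
def logSphere (ε : ℝ) : Set (ℂ × ℂ) := {x | x.1 ≠ 0 ∧ x.2 ≠ 0 ∧ logDefFun ε x = 0}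

variable {ε : ℝ} {p : ℂ × ℂ}

theorem isOpen_offAxes : IsOpen {x : ℂ × ℂ | x.1 ≠ 0 ∧ x.2 ≠ 0} :=
  (isOpen_ne.preimage continuous_fst).inter (isOpen_ne.preimage continuous_snd)

theorem contDiffAt_logDefFun (h1 : p.1 ≠ 0) (h2 : p.2 ≠ 0) : ContDiffAt ℝ ∞ (logDefFun ε) p :=
  (((contDiffAt_log_norm_fst h1).pow 2).add ((contDiffAt_log_norm_snd h2).pow 2)).sub
    contDiffAt_const

theorem hasGerm_logDefFun (h1 : p.1 ≠ 0) (h2 : p.2 ≠ 0) :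
    HasGerm (cplx (logDefFun ε)) ((germLogCoordinates p h1 h2).defFun ((ε : ℂ) ^ 2)) := by
  have ca := hasGerm_a h1 h2
  have cb := hasGerm_b h1 h2
  have h := ((ca.pow 2).add (cb.pow 2)).sub (HasGerm.const ((ε : ℂ) ^ 2))
  have e : cplx (logDefFun ε) = fun x => logFst x ^ 2 + logSnd x ^ 2 - (ε : ℂ) ^ 2 := by
    ext x
    simp [cplx, logDefFun, logFst, logSnd]
  rw [e]
  exact h

theorem dZ_logDefFun (h1 : p.1 ≠ 0) (h2 : p.2 ≠ 0) :
    dZ (cplx (logDefFun ε)) p = Real.log ‖p.1‖ * p.1⁻¹ := by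
  rw [← (hasGerm_logDefFun h1 h2).dZ.eval, WirtingerAlgebra.LogCoordinates.z_defFun, map_mul]
  rfl

theorem dW_logDefFun (h1 : p.1 ≠ 0) (h2 : p.2 ≠ 0) :
    dW (cplx (logDefFun ε)) p = Real.log ‖p.2‖ * p.2⁻¹ := by
  rw [← (hasGerm_logDefFun h1 h2).dW.eval, WirtingerAlgebra.LogCoordinates.w_defFun, map_mul]
  rfl

theorem sq_add_sq_ne_zero (hε : 0 < ε) (hp : p ∈ logSphere ε) :
    Real.log ‖p.1‖ ^ 2 + Real.log ‖p.2‖ ^ 2 ≠ 0 := by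
  have h := hp.2.2
  have h' : 0 < ε ^ 2 := by positivity
  rw [logDefFun, sub_eq_zero] at h
  rw [h]
  exact h'.ne'

theorem fderiv_logDefFun_ne_zero (hε : 0 < ε) (hp : p ∈ logSphere ε) :
    fderiv ℝ (logDefFun ε) p ≠ 0 := by
  intro h
  have h0 : ∀ v, wirt v (cplx (logDefFun ε)) p = 0 := by
    intro v
    have hd := (contDiffAt_logDefFun (ε := ε) hp.1 hp.2.1).differentiableAt (by simp)
    refine (wirt_of_hasFDerivAt (Complex.ofRealCLM.hasFDerivAt.comp p hd.hasFDerivAt) v).trans ?_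
    rw [h]
    simp
  have hz := (dZ_logDefFun (ε := ε) hp.1 hp.2.1).symm.trans (h0 _)
  have hw := (dW_logDefFun (ε := ε) hp.1 hp.2.1).symm.trans (h0 _)
  rw [mul_eq_zero, or_iff_left (inv_ne_zero hp.1), Complex.ofReal_eq_zero] at hz
  rw [mul_eq_zero, or_iff_left (inv_ne_zero hp.2.1), Complex.ofReal_eq_zero] at hw
  exact sq_add_sq_ne_zero hε hp (by rw [hz, hw]; norm_num)

theorem isLocalDefiningFunction_logDefFun (hε : 0 < ε) (hp : p ∈ logSphere ε) :
    IsLocalDefiningFunction (logSphere ε) (logDefFun ε) p := by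
  refine ⟨hp, {x | x.1 ≠ 0 ∧ x.2 ≠ 0}, isOpen_offAxes, ⟨hp.1, hp.2.1⟩, ?_, ?_, ?_⟩
  · intro x hx
    exact (contDiffAt_logDefFun hx.1 hx.2).contDiffWithinAt
  · intro x hx
    exact ⟨fun h => h.2.2, fun h => ⟨hx.1, hx.2, h⟩⟩
  · intro x _ hx
    exact fderiv_logDefFun_ne_zero hε hx

theorem leviForm_logDefFun (h1 : p.1 ≠ 0) (h2 : p.2 ≠ 0) (v : ℂ × ℂ) :
    leviForm (logDefFun ε) p v
      = (Complex.normSq (p.1⁻¹ * v.1) + Complex.normSq (p.2⁻¹ * v.2)) / 2 := by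
  have n1 : ∀ᶠ y in 𝓝 p, y.1 ≠ 0 := continuousAt_fst.eventually_ne h1
  have n2 : ∀ᶠ y in 𝓝 p, y.2 ≠ 0 := continuousAt_snd.eventually_ne h2
  have ca := hasGerm_a h1 h2
  have cb := hasGerm_b h1 h2
  have czi := hasGerm_zci h1 h2
  have cwi := hasGerm_wci h1 h2
  have h := (((hasGerm_logDefFun (ε := ε) h1 h2).wirtBar v).wirt v).eval
  set C := germLogCoordinates p h1 h2
  set k := starRingEnd ℂ v.1
  set l := starRingEnd ℂ v.2
  have ha : wirtBarDer p v C.a = (k / 2) • C.zci :=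
    ((ca.wirtBar v).eq_iff (czi.smul _)).2 (n1.mono fun y hy => by
      simp [wirtBar_logFst hy, k]; ring)
  have hb : wirtBarDer p v C.b = (l / 2) • C.wci :=
    ((cb.wirtBar v).eq_iff (cwi.smul _)).2 (n2.mono fun y hy => by
      simp [wirtBar_logSnd hy, l]; ring)
  have c0 : HasGerm (fun _ => (0 : ℂ)) (0 : SmoothGerm p) := ⟨contDiffAt_const, rfl⟩
  have hzc : wirtDer p v C.zci = 0 := ((czi.wirt v).eq_iff c0).2 (n1.mono fun y hy => by
    obtain ⟨L, hL, -⟩ := hasFDerivAt_inv_fst hy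
    rw [wirt_conj_comp, wirtBar_of_holomorphic hL, map_zero])
  have hwc : wirtDer p v C.wci = 0 := ((cwi.wirt v).eq_iff c0).2 (n2.mono fun y hy => by
    obtain ⟨L, hL, -⟩ := hasFDerivAt_inv_snd hy
    rw [wirt_conj_comp, wirtBar_of_holomorphic hL, map_zero])
  have e1 : wirtBarDer p v (C.defFun ((ε : ℂ) ^ 2)) = C.a * (k • C.zci) + C.b * (l • C.wci) := by
    simp only [WirtingerAlgebra.LogCoordinates.defFun, map_sub, map_add, Derivation.leibniz_pow,
      ha, hb, Derivation.map_algebraMap]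
    simp only [Nat.add_one_sub_one, pow_one, smul_eq_mul, nsmul_eq_mul, Nat.cast_ofNat, sub_zero]
    have hd : ∀ c : ℂ, algebraMap ℂ (SmoothGerm p) c = 2 * algebraMap ℂ (SmoothGerm p) (c / 2) := by
      intro c
      rw [← map_ofNat (algebraMap ℂ (SmoothGerm p)) 2, ← map_mul, mul_div_cancel₀ _ two_ne_zero]
    simp only [Algebra.smul_def, hd k, hd l]
    ring
  rw [e1, map_add, Derivation.leibniz, Derivation.leibniz, Derivation.map_smul,
    Derivation.map_smul, hzc, hwc, smul_zero, smul_zero, smul_zero, zero_add, smul_zero, zero_add,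
    map_add, smul_eq_mul, smul_eq_mul, map_mul, map_mul, (ca.wirt v).eval, (cb.wirt v).eval,
    map_smul, map_smul, czi.eval, cwi.eval, wirt_logFst h1, wirt_logSnd h2] at h
  rw [leviForm, ← h, Complex.normSq_apply, Complex.normSq_apply]
  simp only [k, l]
  rw [smul_eq_mul, smul_eq_mul, ← map_mul, ← map_mul, mul_comm v.1, mul_comm v.2]
  simp
  ring

theorem isLeviPositive_logDefFun (h1 : p.1 ≠ 0) (h2 : p.2 ≠ 0) :
    IsLeviPositive (logDefFun ε) p := by
  intro v hv _
  rw [leviForm_logDefFun h1 h2]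
  have hv' : v.1 ≠ 0 ∨ v.2 ≠ 0 := by
    by_contra! h
    exact hv (Prod.ext h.1 h.2)
  have a1 := Complex.normSq_nonneg (p.1⁻¹ * v.1)
  have a2 := Complex.normSq_nonneg (p.2⁻¹ * v.2)
  rcases hv' with h | h
  · have := Complex.normSq_pos.2 (mul_ne_zero (inv_ne_zero h1) h)
    linarith
  · have := Complex.normSq_pos.2 (mul_ne_zero (inv_ne_zero h2) h)
    linarith

theorem invariants_logDefFun_ne_zero (hε : 0 < ε) (hp : p ∈ logSphere ε) :
    (matA3 (cplx (logDefFun ε)) p).det ≠ 0 ∧ leviDet (cplx (logDefFun ε)) p ≠ 0 := by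
  have hg := hasGerm_logDefFun (ε := ε) hp.1 hp.2.1
  set C := germLogCoordinates p hp.1 hp.2.1
  have hab : evalGerm p (C.a ^ 2 + C.b ^ 2) ≠ 0 := by
    have : evalGerm p (C.a ^ 2 + C.b ^ 2) = logFst p ^ 2 + logSnd p ^ 2 := by
      rw [map_add, map_pow, map_pow]
      rfl
    rw [this, logFst, logSnd]
    exact_mod_cast sq_add_sq_ne_zero hε hp
  have hu : ∀ x y : SmoothGerm p, x * y = 1 → evalGerm p y ≠ 0 := by
    intro x y hxy h0
    simpa [h0] using congrArg (evalGerm p) hxy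
  constructor
  · rw [hg.det_matA3]
    exact C.det_matrixA3_ne_zero _ _ hab
  · rw [hg.leviDet, C.levi_defFun, map_smul, map_mul, map_mul, map_mul, map_mul]
    exact smul_ne_zero (by norm_num) (mul_ne_zero (mul_ne_zero (mul_ne_zero (mul_ne_zero
      (hu _ _ C.z_mul) (hu _ _ C.w_mul)) (hu _ _ C.zc_mul)) (hu _ _ C.wc_mul)) hab)

theorem invariants_ne_zero (hε : 0 < ε) {r : ℂ × ℂ → ℝ}
    (hr : IsLocalDefiningFunction (logSphere ε) r p) :
    (matA3 (cplx r) p).det ≠ 0 ∧ leviDet (cplx r) p ≠ 0 :=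
  have h := invariants_logDefFun_ne_zero hε hr.1
  invariants_ne_zero_of_isLocalDefiningFunction (isLocalDefiningFunction_logDefFun hε hr.1) hr
    h.1 h.2

theorem umbilicalTensor_ne_zero (hε : 0 < ε) {r : ℂ × ℂ → ℝ}
    (hr : IsLocalDefiningFunction (logSphere ε) r p) : umbilicalTensor r p ≠ 0 := by
  obtain ⟨h1, h2⟩ := invariants_ne_zero hε hr
  exact div_ne_zero h1 (by simp [Complex.cpow_eq_zero_iff, h2])

/-! ### Smoothness of holomorphic functions of two variables -/

section Holomorphic

variable {f : ℂ × ℂ → ℂ} {U : Set (ℂ × ℂ)}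

theorem deriv_comp_add_smul {x v : ℂ × ℂ} {ζ : ℂ} (hf : DifferentiableAt ℂ f (x + ζ • v)) :
    HasDerivAt (fun ζ : ℂ => f (x + ζ • v)) (fderiv ℂ f (x + ζ • v) v) ζ := by
  have h1 : HasDerivAt (fun ζ : ℂ => x + ζ • v) v ζ := by
    simpa using ((hasDerivAt_id ζ).smul_const v).const_add x
  exact hf.hasFDerivAt.comp_hasDerivAt ζ h1

/-- Cauchy's estimate: a bound for `f` on a closed ball bounds the differential on a smaller
concentric one. -/
theorem norm_fderiv_le_of_differentiableOn {x₀ : ℂ × ℂ} {r C : ℝ} (hr : 0 < r)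
    (hf : DifferentiableOn ℂ f (Metric.ball x₀ r)) (hC : ∀ x ∈ Metric.ball x₀ r, ‖f x‖ ≤ C)
    {x : ℂ × ℂ} (hx : x ∈ Metric.ball x₀ (r / 2)) : ‖fderiv ℂ f x‖ ≤ C / (r / 4) := by
  have hC0 : 0 ≤ C := (norm_nonneg _).trans (hC x₀ (Metric.mem_ball_self hr))
  have hmem : ∀ v : ℂ × ℂ, ‖v‖ ≤ 1 → ∀ ζ ∈ Metric.closedBall (0 : ℂ) (r / 4),
      x + ζ • v ∈ Metric.ball x₀ r := by
    intro v hv ζ hζ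
    rw [mem_closedBall_zero_iff] at hζ
    rw [Metric.mem_ball, dist_eq_norm] at hx ⊢
    calc ‖x + ζ • v - x₀‖ = ‖(x - x₀) + ζ • v‖ := by congr 1; abel
      _ ≤ ‖x - x₀‖ + ‖ζ‖ * ‖v‖ := (norm_add_le _ _).trans (by rw [norm_smul])
      _ ≤ ‖x - x₀‖ + r / 4 * 1 := by gcongr
      _ < r := by linarith
  refine ContinuousLinearMap.opNorm_le_of_unit_norm (by positivity) fun v hv => ?_
  have hd : ∀ ζ ∈ Metric.closedBall (0 : ℂ) (r / 4),
      HasDerivAt (fun ζ : ℂ => f (x + ζ • v)) (fderiv ℂ f (x + ζ • v) v) ζ := fun ζ hζ =>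
    deriv_comp_add_smul (hf.differentiableAt (Metric.isOpen_ball.mem_nhds (hmem v hv.le ζ hζ)))
  have h := Complex.norm_deriv_le_of_forall_mem_sphere_norm_le (c := 0) (R := r / 4) (C := C)
    (f := fun ζ : ℂ => f (x + ζ • v)) (by positivity)
    (DifferentiableOn.diffContOnCl_ball
      (U := Metric.closedBall (0 : ℂ) (r / 4)) (fun ζ hζ =>
        (hd ζ hζ).differentiableAt.differentiableWithinAt) le_rfl)
    (fun ζ hζ => hC _ (hmem v hv.le ζ (Metric.sphere_subset_closedBall hζ)))
  rw [(hd 0 (Metric.mem_closedBall_self (by positivity))).deriv] at h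
  simpa using h

/-- The directional derivatives of a holomorphic function are holomorphic: differentiate Cauchy's
integral for the derivative under the integral sign. -/
theorem differentiableOn_fderiv_apply (hU : IsOpen U) (hf : DifferentiableOn ℂ f U) (v : ℂ × ℂ) :
    DifferentiableOn ℂ (fun x => fderiv ℂ f x v) U := by
  intro x₀ hx₀
  refine DifferentiableAt.differentiableWithinAt ?_
  -- a ball on which `f` is bounded
  obtain ⟨r, hr, hrU, C, hC⟩ : ∃ r > 0, Metric.ball x₀ r ⊆ U ∧ ∃ C, ∀ x ∈ Metric.ball x₀ r,
      ‖f x‖ ≤ C := by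
    have hc := (hf.differentiableAt (hU.mem_nhds hx₀)).continuousAt
    have hb : ∀ᶠ x in 𝓝 x₀, ‖f x‖ < ‖f x₀‖ + 1 :=
      hc.norm.eventually_lt continuousAt_const (by simp)
    obtain ⟨r, hr, h⟩ := Metric.mem_nhds_iff.1 (Filter.inter_mem (hU.mem_nhds hx₀) hb)
    exact ⟨r, hr, fun x hx => (h hx).1, _, fun x hx => (h hx).2.le⟩
  have hfd : ∀ x ∈ Metric.ball x₀ r, DifferentiableAt ℂ f x := fun x hx =>
    hf.differentiableAt (hU.mem_nhds (hrU hx))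
  set ρ := r / (4 * (‖v‖ + 1)) with hρ
  have hρ0 : 0 < ρ := by positivity
  have hρv : ρ * ‖v‖ ≤ r / 4 := by
    rw [hρ, div_mul_eq_mul_div, div_le_div_iff₀ (by positivity) (by positivity)]
    nlinarith [norm_nonneg v]
  have hmem : ∀ x ∈ Metric.ball x₀ (r / 4), ∀ ζ : ℂ, ‖ζ‖ ≤ ρ →
      x + ζ • v ∈ Metric.ball x₀ (r / 2) := by
    intro x hx ζ hζ
    rw [Metric.mem_ball, dist_eq_norm] at hx ⊢
    calc ‖x + ζ • v - x₀‖ = ‖(x - x₀) + ζ • v‖ := by congr 1; abel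
      _ ≤ ‖x - x₀‖ + ‖ζ‖ * ‖v‖ := (norm_add_le _ _).trans (by rw [norm_smul])
      _ ≤ ‖x - x₀‖ + ρ * ‖v‖ := by gcongr
      _ < r / 2 := by linarith
  have hcirc : ∀ θ : ℝ, ‖circleMap 0 ρ θ‖ = ρ := fun θ => by
    rw [norm_circleMap_zero, abs_of_pos hρ0]
  have hsub : Metric.ball x₀ (r / 2) ⊆ Metric.ball x₀ r := Metric.ball_subset_ball (by linarith)
  set k : ℝ → ℂ := fun θ => deriv (circleMap 0 ρ) θ * ((circleMap 0 ρ θ) ^ 2)⁻¹ with hk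
  have hkc : Continuous k := by
    simp only [hk, deriv_circleMap]
    exact ((continuous_circleMap 0 ρ).mul continuous_const).mul
      (((continuous_circleMap 0 ρ).pow 2).inv₀ fun θ => pow_ne_zero _ (by
        rw [← norm_ne_zero_iff, hcirc]; exact hρ0.ne'))
  -- Cauchy's formula for the derivative along `v`
  have hformula : ∀ x ∈ Metric.ball x₀ (r / 4), fderiv ℂ f x v
      = (2 * Real.pi * Complex.I : ℂ)⁻¹ •
        ∫ θ in (0 : ℝ)..2 * Real.pi, k θ * f (x + circleMap 0 ρ θ • v) := by
    intro x hx
    have hopen : IsOpen ((fun ζ : ℂ => x + ζ • v) ⁻¹' Metric.ball x₀ r) :=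
      Metric.isOpen_ball.preimage (by fun_prop)
    have h := Complex.two_pi_I_inv_smul_circleIntegral_sub_sq_inv_smul_of_differentiable
      (U := (fun ζ : ℂ => x + ζ • v) ⁻¹' Metric.ball x₀ r) hopen
      (c := 0) (w₀ := 0) (R := ρ) (f := fun ζ : ℂ => f (x + ζ • v))
      (fun ζ hζ => hsub (hmem x hx ζ (by simpa using hζ)))
      (fun ζ hζ => (deriv_comp_add_smul (hfd _ hζ)).differentiableAt.differentiableWithinAt)
      (Metric.mem_ball_self hρ0)
    rw [(deriv_comp_add_smul (x := x) (ζ := 0) (by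
      rw [zero_smul, add_zero]
      exact hfd _ (Metric.ball_subset_ball (by linarith) hx))).deriv] at h
    rw [zero_smul, add_zero] at h
    rw [← h, circleIntegral]
    congr 1
    refine intervalIntegral.integral_congr fun θ _ => ?_
    simp only [hk, sub_zero, smul_eq_mul]
    ring
  have hcont : ∀ x ∈ Metric.ball x₀ (r / 4),
      Continuous fun θ => k θ * f (x + circleMap 0 ρ θ • v) := by
    intro x hx
    refine hkc.mul (continuous_iff_continuousAt.2 fun θ => ?_)
    have h1 := (hfd _ (hsub (hmem x hx _ (hcirc θ).le))).continuousAt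
    have h2 : ContinuousAt (fun θ => x + circleMap 0 ρ θ • v) θ :=
      ((continuous_const.add ((continuous_circleMap 0 ρ).smul continuous_const))).continuousAt
    exact ContinuousAt.comp (f := fun θ => x + circleMap 0 ρ θ • v) h1 h2
  have hnhds : Metric.ball x₀ (r / 4) ∈ 𝓝 x₀ := Metric.ball_mem_nhds _ (by positivity)
  have hint := intervalIntegral.hasFDerivAt_integral_of_dominated_of_fderiv_le (𝕜 := ℂ)
    (μ := MeasureTheory.volume) (a := 0) (b := 2 * Real.pi)
    (F := fun x θ => k θ * f (x + circleMap 0 ρ θ • v))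
    (F' := fun x θ => k θ • fderiv ℂ f (x + circleMap 0 ρ θ • v))
    (bound := fun θ => ‖k θ‖ * (C / (r / 4))) hnhds
    (Filter.eventually_of_mem hnhds fun x hx => (hcont x hx).aestronglyMeasurable)
    ((hcont x₀ (Metric.mem_ball_self (by positivity))).intervalIntegrable _ _)
    (by
      refine Measurable.aestronglyMeasurable (Measurable.smul hkc.measurable
        ((measurable_fderiv ℂ f).comp ?_))
      exact (continuous_const.add
        ((continuous_circleMap 0 ρ).smul continuous_const)).measurable)
    (Filter.Eventually.of_forall fun θ _ x hx => by
      rw [norm_smul]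
      exact mul_le_mul_of_nonneg_left (norm_fderiv_le_of_differentiableOn hr
        (fun y hy => (hfd y hy).differentiableWithinAt) hC (hmem x hx _ (hcirc θ).le))
        (norm_nonneg _))
    ((hkc.norm.mul continuous_const).intervalIntegrable _ _)
    (Filter.Eventually.of_forall fun θ _ x hx => by
      have h1 := (hfd _ (hsub (hmem x hx _ (hcirc θ).le))).hasFDerivAt
      have h2 : HasFDerivAt (fun y : ℂ × ℂ => y + circleMap 0 ρ θ • v)
          (ContinuousLinearMap.id ℂ (ℂ × ℂ)) x := (hasFDerivAt_id x).add_const _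
      exact (h1.comp x h2).const_mul (k θ))
  refine ((hint.const_smul (2 * Real.pi * Complex.I : ℂ)⁻¹).congr_of_eventuallyEq
    (Filter.eventually_of_mem hnhds hformula)).differentiableAt

/-- A holomorphic function of two variables is smooth. -/
theorem contDiffOn_of_differentiableOn (hU : IsOpen U) (hf : DifferentiableOn ℂ f U) :
    ContDiffOn ℂ ∞ f U := by
  rw [contDiffOn_infty]
  intro n
  induction n generalizing f with
  | zero => exact contDiffOn_zero.2 hf.continuousOn
  | succ n ih =>
    push_cast
    rw [contDiffOn_succ_iff_fderiv_apply hU.uniqueDiffOn]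
    refine ⟨hf, by simp, fun v => (ih (differentiableOn_fderiv_apply hU hf v)).congr fun x hx => ?_⟩
    rw [fderivWithin_of_isOpen hU hx]

theorem contDiffAt_real_of_differentiableOn (hU : IsOpen U) (hf : DifferentiableOn ℂ f U)
    {x : ℂ × ℂ} (hx : x ∈ U) : ContDiffAt ℝ ∞ f x :=
  ((contDiffOn_of_differentiableOn hU hf).contDiffAt (hU.mem_nhds hx)).restrict_scalars ℝ

end Holomorphic

/-! ### Spherical hypersurfaces -/

section Holomorphic

variable {p : ℂ × ℂ} {f g : ℂ × ℂ → ℂ} {φ ψ : SmoothGerm p}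

theorem HasGerm.conj (hf : HasGerm f φ) :
    HasGerm (fun y => starRingEnd ℂ (f y)) (toGerm _ (contDiffAt_conj hf.1)) :=
  hasGerm_toGerm _

theorem HasGerm.zbar_wbar_eq_zero (hf : HasGerm f φ) (hd : ∀ᶠ x in 𝓝 p, DifferentiableAt ℂ f x) :
    (germWirtinger p).zbar φ = 0 ∧ (germWirtinger p).wbar φ = 0 := by
  have c0 : HasGerm (fun _ => (0 : ℂ)) (0 : SmoothGerm p) := ⟨contDiffAt_const, rfl⟩
  exact ⟨(hf.dZbar.eq_iff c0).2 (hd.mono fun x hx => wirtBar_of_holomorphic hx.hasFDerivAt _),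
    (hf.dWbar.eq_iff c0).2 (hd.mono fun x hx => wirtBar_of_holomorphic hx.hasFDerivAt _)⟩

theorem HasGerm.z_w_conj_eq_zero (hφ : HasGerm (fun y => starRingEnd ℂ (f y)) φ)
    (hd : ∀ᶠ x in 𝓝 p, DifferentiableAt ℂ f x) :
    (germWirtinger p).z φ = 0 ∧ (germWirtinger p).w φ = 0 := by
  have c0 : HasGerm (fun _ => (0 : ℂ)) (0 : SmoothGerm p) := ⟨contDiffAt_const, rfl⟩
  constructor
  · refine (hφ.dZ.eq_iff c0).2 (hd.mono fun x hx => ?_)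
    rw [CRUmbilic.dZ, wirt_conj_comp, wirtBar_of_holomorphic hx.hasFDerivAt, map_zero]
  · refine (hφ.dW.eq_iff c0).2 (hd.mono fun x hx => ?_)
    rw [CRUmbilic.dW, wirt_conj_comp, wirtBar_of_holomorphic hx.hasFDerivAt, map_zero]

theorem z_w_algebraMap (c : ℂ) : (germWirtinger p).z (algebraMap ℂ (SmoothGerm p) c) = 0 ∧
    (germWirtinger p).w (algebraMap ℂ (SmoothGerm p) c) = 0 :=
  ⟨Derivation.map_algebraMap _ _, Derivation.map_algebraMap _ _⟩

/-- An injective differential has a non-zero Jacobian determinant. -/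
theorem jacobian_ne_zero {Ψ : ℂ × ℂ → ℂ × ℂ} (hΨ : DifferentiableAt ℂ Ψ p)
    (hinj : Function.Injective (fderiv ℂ Ψ p)) :
    dZ (fun y => (Ψ y).1) p * dW (fun y => (Ψ y).2) p
      - dW (fun y => (Ψ y).1) p * dZ (fun y => (Ψ y).2) p ≠ 0 := by
  intro h0
  have h1 : ∀ v, wirt v (fun y => (Ψ y).1) p = (fderiv ℂ Ψ p v).1 := fun v =>
    wirt_of_holomorphic hΨ.hasFDerivAt.fst v
  have h2 : ∀ v, wirt v (fun y => (Ψ y).2) p = (fderiv ℂ Ψ p v).2 := fun v =>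
    wirt_of_holomorphic hΨ.hasFDerivAt.snd v
  have key : ∀ v : ℂ × ℂ, wirt v (fun y => (Ψ y).1) p = 0 → wirt v (fun y => (Ψ y).2) p = 0 →
      v = 0 := by
    intro v hv1 hv2
    rw [h1] at hv1
    rw [h2] at hv2
    exact hinj (by rw [map_zero]; exact Prod.ext hv1 hv2)
  simp only [wirt_eq] at key
  set a := dZ (fun y => (Ψ y).1) p
  set b := dW (fun y => (Ψ y).1) p
  set c := dZ (fun y => (Ψ y).2) p
  set d := dW (fun y => (Ψ y).2) p
  have e1 := key (-b, a) (by ring) (by linear_combination h0)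
  have e2 := key (-d, c) (by linear_combination -h0) (by ring)
  simp only [Prod.mk_eq_zero, neg_eq_zero] at e1 e2
  have e3 := key (1, 0) (by simp [e1]) (by simp [e2])
  simp at e3

end Holomorphic

/-- In the defining function of a spherical hypersurface that is pulled back from the sphere,
`A₃` is degenerate. -/
theorem exists_det_matA3_eq_zero_of_isSphericalAt {M : Set (ℂ × ℂ)} {p : ℂ × ℂ} (hp : p ∈ M)
    (h : IsSphericalAt M p) :
    ∃ r, IsLocalDefiningFunction M r p ∧ (matA3 (cplx r) p).det = 0 := by
  obtain ⟨q, -, h, hps, -, hd, hd', hM⟩ := h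
  have hdf : DifferentiableOn ℂ (fun x => (h x).1) h.source := hd.fst
  have hdg : DifferentiableOn ℂ (fun x => (h x).2) h.source := hd.snd
  have hf : ∀ x ∈ h.source, ContDiffAt ℝ ∞ (fun x => (h x).1) x := fun x hx =>
    contDiffAt_real_of_differentiableOn h.open_source hdf hx
  have hg : ∀ x ∈ h.source, ContDiffAt ℝ ∞ (fun x => (h x).2) x := fun x hx =>
    contDiffAt_real_of_differentiableOn h.open_source hdg hx
  have hsrc := h.open_source.mem_nhds hps
  have hinv : ∀ x ∈ h.source, ∃ A : ℂ × ℂ →L[ℂ] ℂ × ℂ,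
      A.comp (fderiv ℂ h x) = ContinuousLinearMap.id ℂ _ ∧
      (fderiv ℂ h x).comp A = ContinuousLinearMap.id ℂ _ := by
    intro x hx
    have h1 := (hd.differentiableAt (h.open_source.mem_nhds hx)).hasFDerivAt
    have h2 := (hd'.differentiableAt (h.open_target.mem_nhds (h.map_source hx))).hasFDerivAt
    refine ⟨_, (h2.comp x h1).unique ((hasFDerivAt_id x).congr_of_eventuallyEq
      (h.eventually_left_inverse hx)), ?_⟩
    have h3 : HasFDerivAt h (fderiv ℂ h x) (h.symm (h x)) := by rwa [h.left_inv hx]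
    exact (h3.comp (h x) h2).unique ((hasFDerivAt_id (h x)).congr_of_eventuallyEq
      (h.eventually_right_inverse (h.map_source hx)))
  set r : ℂ × ℂ → ℝ := fun x => ‖(h x).1‖ ^ 2 + ‖(h x).2‖ ^ 2 - 1 with hr
  have hrdef : IsLocalDefiningFunction M r p := by
    refine ⟨hp, h.source, h.open_source, hps, fun x hx => ?_, fun x hx => ?_, fun x hx hxM => ?_⟩
    · exact ((((hf x hx).norm_sq ℝ).add ((hg x hx).norm_sq ℝ)).sub
        contDiffAt_const).contDiffWithinAt
    · rw [hM x hx, sphere3, Set.mem_ofPred_eq, hr, sub_eq_zero]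
    · intro h0
      obtain ⟨A, -, hA⟩ := hinv x hx
      have h1 := ((hd.differentiableAt (h.open_source.mem_nhds hx)).hasFDerivAt.restrictScalars ℝ)
      have h2 := ((h1.fst.norm_sq.add h1.snd.norm_sq).sub_const 1).fderiv
      have h3 : fderiv ℝ r x (A (h x)) = 0 := by rw [h0]; rfl
      have h4 : fderiv ℂ h x (A (h x)) = h x := DFunLike.congr_fun hA (h x)
      have h5 : fderiv ℝ r x (A (h x)) = 2 * (‖(h x).1‖ ^ 2 + ‖(h x).2‖ ^ 2) := by
        refine (DFunLike.congr_fun h2 (A (h x))).trans ?_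
        simp [h4]
        ring
      have h6 : ‖(h x).1‖ ^ 2 + ‖(h x).2‖ ^ 2 = 1 := (hM x hx).1 hxM
      rw [h5, h6] at h3
      norm_num at h3
  refine ⟨r, hrdef, ?_⟩
  have cf := hasGerm_toGerm (hf p hps)
  have cg := hasGerm_toGerm (hg p hps)
  have ef : ∀ᶠ x in 𝓝 p, DifferentiableAt ℂ (fun x => (h x).1) x := by
    filter_upwards [h.open_source.eventually_mem hps] with x hx
    exact hdf.differentiableAt (h.open_source.mem_nhds hx)
  have eg : ∀ᶠ x in 𝓝 p, DifferentiableAt ℂ (fun x => (h x).2) x := by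
    filter_upwards [h.open_source.eventually_mem hps] with x hx
    exact hdg.differentiableAt (h.open_source.mem_nhds hx)
  have hσ : HasGerm (cplx r) _ := hasGerm_toGerm (contDiffAt_cplx hrdef.contDiffAt)
  rw [hσ.det_matA3]
  refine (germWirtinger p).det_matrixA3_eq_zero
    (((hσ.eq_iff (((cf.mul cf.conj).add (cg.mul cg.conj)).add (HasGerm.const (-1)))).2
      (Filter.Eventually.of_forall fun x => ?_)))
    (cf.zbar_wbar_eq_zero ef) (cg.zbar_wbar_eq_zero eg) (cf.conj.z_w_conj_eq_zero ef)
    (cg.conj.z_w_conj_eq_zero eg) (z_w_algebraMap _) _ ?_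
  · simp only [cplx, hr, Complex.mul_conj, Complex.normSq_eq_norm_sq]
    push_cast
    ring
  · rw [((cf.dZ.mul cg.dW).sub (cf.dW.mul cg.dZ)).eval]
    refine jacobian_ne_zero (hd.differentiableAt hsrc) ?_
    obtain ⟨A, hA, -⟩ := hinv p hps
    exact Function.LeftInverse.injective (g := A) fun v => DFunLike.congr_fun hA v

theorem not_isSphericalAt {ε : ℝ} (hε : 0 < ε) {p : ℂ × ℂ} (hp : p ∈ logSphere ε) :
    ¬ IsSphericalAt (logSphere ε) p := by
  intro h
  obtain ⟨r, hr, h0⟩ := exists_det_matA3_eq_zero_of_isSphericalAt hp h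
  exact (invariants_ne_zero hε hr).1 h0

/-! ### Order of vanishing and derivatives -/

/-- Finite difference weights on the nodes `0, …, k` that are exact for the first derivative at `0`
of polynomials of degree at most `k`. -/
theorem exists_finite_difference (k : ℕ) : ∃ c : Fin (k + 1) → ℝ, ∀ i < k + 1,
    ∑ j, c j * ((j : ℕ) : ℝ) ^ i = if i = 1 then 1 else 0 := by
  have hV : IsUnit (Matrix.vandermonde fun j : Fin (k + 1) => ((j : ℕ) : ℝ)) := by
    rw [Matrix.isUnit_iff_isUnit_det, isUnit_iff_ne_zero, Matrix.det_vandermonde_ne_zero_iff]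
    intro i j hij
    exact Fin.ext (Nat.cast_injective hij)
  obtain ⟨c, hc⟩ := Matrix.vecMul_surjective_iff_isUnit.2 hV
    fun i : Fin (k + 1) => if (i : ℕ) = 1 then (1 : ℝ) else 0
  refine ⟨c, fun i hi => ?_⟩
  have := congrFun hc ⟨i, hi⟩
  simpa [Matrix.vecMul, dotProduct, Matrix.vandermonde_apply] using this

/-- Differentiation lowers the order of vanishing of a smooth function by at most one. This follows
from Taylor's formula on the segments from `y` in the direction `v`, of length comparable to
`‖y - p‖`, by taking the finite difference that isolates the first derivative. -/
theorem isBigO_fderiv_apply {E : Type*} [NormedAddCommGroup E] [NormedSpace ℝ E] {g : E → ℂ}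
    {p : E} (hg : ContDiffAt ℝ ∞ g p) {k : ℕ} (h : g =O[𝓝 p] fun y => ‖y - p‖ ^ (k + 1)) (v : E) :
    (fun y => fderiv ℝ g y v) =O[𝓝 p] fun y => ‖y - p‖ ^ k := by
  rcases Nat.eq_zero_or_pos k with rfl | hk
  · simp only [pow_zero]
    have : ContinuousAt (fun y => fderiv ℝ g y v) p :=
      ((hg.fderiv_right (m := 0) (by simp)).continuousAt).clm_apply continuousAt_const
    exact this.isBigO_one ℝ
  obtain ⟨c, hc⟩ := exists_finite_difference k
  have hle : ((k + 1 : ℕ) : WithTop ℕ∞) ≤ ∞ := WithTop.coe_le_coe.2 le_top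
  have hgk : ContDiffAt ℝ (k + 1 : ℕ) g p := hg.of_le hle
  obtain ⟨A, hA⟩ := h.bound
  have hcont : ContinuousAt (iteratedFDeriv ℝ (k + 1) g) p :=
    (hg.differentiableAt_iteratedFDeriv (m := k + 1)
      (WithTop.coe_lt_coe.2 (WithTop.coe_lt_top _))).continuousAt
  set K := ‖iteratedFDeriv ℝ (k + 1) g p‖ + 1
  have hK : ∀ᶠ y in 𝓝 p, ‖iteratedFDeriv ℝ (k + 1) g y‖ < K :=
    hcont.norm.eventually_lt continuousAt_const (by simp [K])
  obtain ⟨δ, hδ, hball⟩ := Metric.mem_nhds_iff.1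
    (Filter.inter_mem (Filter.inter_mem hA hK) (hgk.eventually (by simp)))
  set B := 1 + k * ‖v‖ with hB
  have hB1 : 1 ≤ B := by
    have : 0 ≤ k * ‖v‖ := by positivity
    linarith
  have hA0 : 0 ≤ |A| := abs_nonneg A
  have hK0 : 0 ≤ K := by positivity
  set C := ∑ j, |c j| * (|A| * B ^ (k + 1) + K * B ^ (k + 1)) with hC
  have key : ∀ y t, 0 < t → ‖y - p‖ ≤ t → t * B < δ → ‖fderiv ℝ g y v‖ ≤ C * t ^ k := by
    intro y t ht hyt htB
    have hpt : ∀ j : Fin (k + 1), ∀ τ ∈ Set.Icc (0 : ℝ) 1,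
        ‖y + τ • ((j : ℕ) * t) • v - p‖ ≤ t * B := by
      intro j τ hτ
      have hj : ((j : ℕ) : ℝ) ≤ k := by exact_mod_cast Nat.lt_succ_iff.1 j.2
      calc ‖y + τ • ((j : ℕ) * t) • v - p‖ = ‖(y - p) + τ • ((j : ℕ) * t) • v‖ := by congr 1; abel
        _ ≤ ‖y - p‖ + τ * (((j : ℕ) * t) * ‖v‖) := by
          refine (norm_add_le _ _).trans ?_
          rw [norm_smul, norm_smul, Real.norm_of_nonneg hτ.1, Real.norm_of_nonneg (by positivity)]
        _ ≤ t + 1 * ((k * t) * ‖v‖) := by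
          have := hτ.1
          have := hτ.2
          gcongr
        _ = t * B := by rw [hB]; ring
    have hmem : ∀ j : Fin (k + 1), ∀ τ ∈ Set.Icc (0 : ℝ) 1,
        y + τ • ((j : ℕ) * t) • v ∈ Metric.ball p δ := fun j τ hτ => by
      rw [Metric.mem_ball, dist_eq_norm]
      exact (hpt j τ hτ).trans_lt htB
    -- Taylor's formula, with remainder `R j`
    set a : ℕ → ℂ := fun i => iteratedFDeriv ℝ i g y fun _ => v with ha
    set R : Fin (k + 1) → ℂ := fun j => (k.factorial : ℝ)⁻¹ • ∫ τ in (0 : ℝ)..1,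
      (1 - τ) ^ k • iteratedFDeriv ℝ (k + 1) g (y + τ • ((j : ℕ) * t) • v)
        (fun _ => ((j : ℕ) * t) • v) with hR
    have htaylor : ∀ j : Fin (k + 1), g (y + ((j : ℕ) * t) • v)
        = ∑ i ∈ Finset.range (k + 1),
          ((i.factorial : ℝ)⁻¹ * t ^ i * ((j : ℕ) : ℝ) ^ i : ℝ) • a i + R j := by
      intro j
      rw [map_add_eq_sum_add_integral_iteratedFDeriv (f := g) (x := y) (n := k)
        (y := ((j : ℕ) * t) • v) fun τ hτ => ?_]
      · congr 1
        refine Finset.sum_congr rfl fun i _ => ?_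
        rw [ContinuousMultilinearMap.map_smul_univ (iteratedFDeriv ℝ i g y)
          (fun _ => ((j : ℕ) : ℝ) * t) (fun _ => v)]
        simp only [Finset.prod_const, Finset.card_univ, Fintype.card_fin, smul_smul, ha]
        congr 1
        ring
      · exact_mod_cast (hball (hmem j τ hτ)).2
    have hRle : ∀ j, ‖R j‖ ≤ K * B ^ (k + 1) * t ^ (k + 1) := by
      intro j
      have hj : ((j : ℕ) : ℝ) ≤ k := by exact_mod_cast Nat.lt_succ_iff.1 j.2
      have h1 : ‖∫ τ in (0 : ℝ)..1, (1 - τ) ^ k •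
          iteratedFDeriv ℝ (k + 1) g (y + τ • ((j : ℕ) * t) • v) (fun _ => ((j : ℕ) * t) • v)‖
          ≤ K * (B * t) ^ (k + 1) * |1 - 0| := by
        refine intervalIntegral.norm_integral_le_of_norm_le_const fun τ hτ => ?_
        rw [Set.uIoc_of_le zero_le_one] at hτ
        have hτ' : τ ∈ Set.Icc (0 : ℝ) 1 := ⟨hτ.1.le, hτ.2⟩
        rw [norm_smul, norm_pow, Real.norm_of_nonneg (by linarith [hτ.2])]
        have h2 := (iteratedFDeriv ℝ (k + 1) g (y + τ • ((j : ℕ) * t) • v)).le_opNorm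
          (fun _ => ((j : ℕ) * t) • v)
        rw [Finset.prod_const, Finset.card_univ, Fintype.card_fin, norm_smul,
          Real.norm_of_nonneg (by positivity)] at h2
        have h3 : ((j : ℕ) : ℝ) * t * ‖v‖ ≤ B * t := by
          have : ((j : ℕ) : ℝ) * ‖v‖ ≤ k * ‖v‖ := by gcongr
          rw [hB]
          nlinarith
        calc (1 - τ) ^ k * _ ≤ 1 * (K * (B * t) ^ (k + 1)) := by
              refine mul_le_mul (pow_le_one₀ (by linarith [hτ.2]) (by linarith [hτ.1])) ?_
                (norm_nonneg _) zero_le_one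
              refine h2.trans ?_
              gcongr
              exact (hball (hmem j τ hτ')).1.2.le
          _ = _ := one_mul _
      rw [hR, norm_smul, norm_inv, Real.norm_natCast]
      calc ((k.factorial : ℝ))⁻¹ * _ ≤ 1 * (K * (B * t) ^ (k + 1) * |1 - 0|) := by
            refine mul_le_mul (inv_le_one_of_one_le₀ ?_) h1 (norm_nonneg _) zero_le_one
            exact_mod_cast Nat.one_le_iff_ne_zero.2 k.factorial_ne_zero
        _ = _ := by rw [mul_pow]; norm_num; ring
    have hgle : ∀ j : Fin (k + 1), ‖g (y + ((j : ℕ) * t) • v)‖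
        ≤ |A| * B ^ (k + 1) * t ^ (k + 1) := by
      intro j
      have h0 := hmem j 1 (by simp)
      have h1 := hpt j 1 (by simp)
      rw [one_smul] at h0 h1
      have h2 : ‖g (y + ((j : ℕ) * t) • v)‖ ≤ A * ‖‖y + ((j : ℕ) * t) • v - p‖ ^ (k + 1)‖ :=
        (hball h0).1.1
      rw [norm_pow, norm_norm] at h2
      calc _ ≤ _ := h2
        _ ≤ |A| * (t * B) ^ (k + 1) := by
          gcongr
          exact le_abs_self A
        _ = _ := by rw [mul_pow]; ring
    have hsum : ∑ j, (c j : ℂ) * (g (y + ((j : ℕ) * t) • v) - R j) = (t : ℂ) * fderiv ℝ g y v := by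
      have h1 : ∀ j : Fin (k + 1), (c j : ℂ) * (g (y + ((j : ℕ) * t) • v) - R j)
          = ∑ i ∈ Finset.range (k + 1),
            ((i.factorial : ℝ)⁻¹ * t ^ i * (c j * ((j : ℕ) : ℝ) ^ i) : ℝ) * a i := by
        intro j
        rw [htaylor j, add_sub_cancel_right, Finset.mul_sum]
        refine Finset.sum_congr rfl fun i _ => ?_
        rw [Complex.real_smul]
        push_cast
        ring
      simp only [h1]
      rw [Finset.sum_comm]
      have h2 : ∀ i ∈ Finset.range (k + 1), ∑ j : Fin (k + 1),
          (((i.factorial : ℝ)⁻¹ * t ^ i * (c j * ((j : ℕ) : ℝ) ^ i) : ℝ) : ℂ) * a i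
          = if i = 1 then (t : ℂ) * fderiv ℝ g y v else 0 := by
        intro i hi
        rw [← Finset.sum_mul, ← Complex.ofReal_sum, ← Finset.mul_sum, hc i (Finset.mem_range.1 hi)]
        split_ifs with hi1
        · subst hi1
          simp [ha]
        · simp
      rw [Finset.sum_congr rfl h2, Finset.sum_ite_eq', if_pos (by simp; omega)]
    have hfin : t * ‖fderiv ℝ g y v‖ ≤ t * (C * t ^ k) := by
      calc t * ‖fderiv ℝ g y v‖ = ‖∑ j, (c j : ℂ) * (g (y + ((j : ℕ) * t) • v) - R j)‖ := by
            rw [hsum, norm_mul, Complex.norm_real, Real.norm_of_nonneg ht.le]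
        _ ≤ ∑ j, |c j| * (|A| * B ^ (k + 1) * t ^ (k + 1) + K * B ^ (k + 1) * t ^ (k + 1)) := by
            refine norm_sum_le_of_le _ fun j _ => ?_
            rw [norm_mul, Complex.norm_real, Real.norm_eq_abs]
            gcongr
            exact (norm_sub_le _ _).trans (add_le_add (hgle j) (hRle j))
        _ = t * (C * t ^ k) := by
            rw [hC, Finset.sum_mul, Finset.mul_sum]
            refine Finset.sum_congr rfl fun j _ => ?_
            ring
    exact le_of_mul_le_mul_left hfin ht
  refine Asymptotics.IsBigO.of_bound C ?_
  have hev : ∀ᶠ y in 𝓝 p, ‖y - p‖ * B < δ := by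
    have : ContinuousAt (fun y => ‖y - p‖ * B) p := by fun_prop
    exact this.eventually_lt continuousAt_const (by simpa using hδ)
  filter_upwards [hev] with y hy
  rw [norm_pow, norm_norm]
  have hlim : Filter.Tendsto (fun t : ℝ => C * t ^ k) (𝓝[>] ‖y - p‖) (𝓝 (C * ‖y - p‖ ^ k)) := by
    have : ContinuousAt (fun t : ℝ => C * t ^ k) ‖y - p‖ := by fun_prop
    exact this.tendsto.mono_left nhdsWithin_le_nhds
  refine ge_of_tendsto hlim ?_
  have hB' : ∀ᶠ t in 𝓝[>] ‖y - p‖, t * B < δ := by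
    have : ContinuousAt (fun t : ℝ => t * B) ‖y - p‖ := by fun_prop
    exact (this.eventually_lt continuousAt_const hy).filter_mono nhdsWithin_le_nhds
  filter_upwards [hB', self_mem_nhdsWithin] with t ht ht'
  exact key y t ((norm_nonneg _).trans_lt ht') (le_of_lt ht') ht

/-! ### Umbilical points -/

/-- The ideal of germs at `p` of functions that vanish to order `k` along the parametrized
hypersurface `γ`. -/
def orderIdeal (p : ℂ × ℂ) (γ : ℂ × ℝ → ℂ × ℂ) (hγ : ContinuousAt γ 0) (hp : γ 0 = p) (k : ℕ) :
    Ideal (SmoothGerm p) where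
  carrier := {φ | ∃ f, HasGerm f φ ∧ (fun x => f (γ x)) =O[𝓝 0] fun x : ℂ × ℝ => ‖x‖ ^ k}
  zero_mem' := ⟨_, ⟨contDiffAt_const, rfl⟩, Asymptotics.isBigO_zero _ _⟩
  add_mem' := by
    rintro _ _ ⟨f, hf, hf0⟩ ⟨g, hg, hg0⟩
    exact ⟨_, hf.add hg, hf0.add hg0⟩
  smul_mem' := by
    rintro φ _ ⟨g, hg, hg0⟩
    obtain ⟨f, hf, rfl⟩ := exists_toGerm φ
    refine ⟨_, (hasGerm_toGerm hf).mul hg, ?_⟩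
    have hc : ContinuousAt (fun x => f (γ x)) 0 :=
      ContinuousAt.comp_of_eq hf.continuousAt hγ hp
    simpa using (hc.isBigO_one ℝ).mul hg0

theorem isBigO_norm_pow_of_le {j k : ℕ} (h : j ≤ k) :
    (fun x : ℂ × ℝ => ‖x‖ ^ k) =O[𝓝 0] fun x => ‖x‖ ^ j := by
  refine Asymptotics.IsBigO.of_bound 1 ?_
  filter_upwards [Metric.ball_mem_nhds (0 : ℂ × ℝ) one_pos] with x hx
  rw [mem_ball_zero_iff] at hx
  simp only [norm_pow, norm_norm, one_mul]
  exact pow_le_pow_of_le_one (norm_nonneg _) hx.le h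

/-- The parametrization `(z, u) ↦ (z, u + i |z|²)` of the sphere `Im w = |z|²`. -/
def paraboloid (x : ℂ × ℝ) : ℂ × ℂ := (x.1, (x.2 : ℂ) + Complex.I * ((‖x.1‖ ^ 2 : ℝ) : ℂ))

theorem contDiff_paraboloid : ContDiff ℝ ∞ paraboloid := by
  have h1 : ContDiff ℝ ∞ fun x : ℂ × ℝ => ((x.2 : ℝ) : ℂ) :=
    Complex.ofRealCLM.contDiff.comp contDiff_snd
  have h2 : ContDiff ℝ ∞ fun x : ℂ × ℝ => ((‖x.1‖ ^ 2 : ℝ) : ℂ) :=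
    Complex.ofRealCLM.contDiff.comp (contDiff_fst.norm_sq ℝ)
  exact contDiff_fst.prodMk (h1.add (contDiff_const.mul h2))

theorem paraboloid_zero : paraboloid 0 = 0 := by
  simp [paraboloid]

/-- The defining function of the sphere in the holomorphic coordinates `Ψ`. -/
def pulledBackSphere (Ψ : ℂ × ℂ → ℂ × ℂ) (y : ℂ × ℂ) : ℝ := (Ψ y).2.im - ‖(Ψ y).1‖ ^ 2

/-- The retraction of `ℂ²` onto the sphere along the direction `i ∂/∂w`, in the coordinates `Ψ`,
followed by the graph parameters. -/
def graphParameters (Ψ : ℂ × ℂ → ℂ × ℂ) (y : ℂ × ℂ) : ℂ × ℝ := ((Ψ y).1, (Ψ y).2.re)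

theorem paraboloid_graphParameters (Ψ : ℂ × ℂ → ℂ × ℂ) (y : ℂ × ℂ) :
    paraboloid (graphParameters Ψ y) = Ψ y - (pulledBackSphere Ψ y) • (0, Complex.I) := by
  refine Prod.ext ?_ (Complex.ext ?_ ?_) <;> simp [paraboloid, graphParameters, pulledBackSphere]
  all_goals norm_cast

section Chart

variable {p : ℂ × ℂ} {e : OpenPartialHomeomorph (ℂ × ℂ) (ℂ × ℂ)}

theorem pulledBackSphere_comp {x : ℂ × ℝ} (hx : paraboloid x ∈ e.source) :
    pulledBackSphere e.symm (e (paraboloid x)) = 0 := by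
  rw [pulledBackSphere, e.left_inv hx]
  simp [paraboloid]
  norm_cast
  simp

/-- Along the sphere, the differential of a function `f` and that of its restriction to the sphere,
extended by the retraction, differ by a multiple of the differential of the defining function. -/
theorem fderiv_retraction (he : ∀ x ∈ e.source, DifferentiableAt ℝ e x)
    (he' : ∀ y ∈ e.target, DifferentiableAt ℝ e.symm y) {f : ℂ × ℂ → ℂ} {y : ℂ × ℂ}
    (hy : y ∈ e.target) (hf : DifferentiableAt ℝ f y)
    (hs : DifferentiableAt ℝ (pulledBackSphere e.symm) y) (hsy : pulledBackSphere e.symm y = 0) :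
    ∃ c : ℂ, ∀ v, fderiv ℝ f y v
      = fderiv ℝ (fun y => f (e (paraboloid (graphParameters e.symm y)))) y v
        + c * fderiv ℝ (cplx (pulledBackSphere e.symm)) y v := by
  set Ψ := e.symm
  set s := pulledBackSphere Ψ
  have hG : DifferentiableAt ℝ (fun x => f (e x)) (Ψ y) :=
    DifferentiableAt.comp (g := f) (Ψ y) (by rwa [e.right_inv hy]) (he _ (e.map_target hy))
  set G := fun x => f (e x)
  have hR : HasFDerivAt (fun y => Ψ y - s y • ((0, Complex.I) : ℂ × ℂ))
      (fderiv ℝ Ψ y - (fderiv ℝ s y).smulRight ((0, Complex.I) : ℂ × ℂ)) y :=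
    (he' y hy).hasFDerivAt.sub (hs.hasFDerivAt.smul_const _)
  have hRy : Ψ y - s y • ((0, Complex.I) : ℂ × ℂ) = Ψ y := by
    rw [hsy, zero_smul, sub_zero]
  have hG' : HasFDerivAt G (fderiv ℝ G (Ψ y)) (Ψ y - s y • ((0, Complex.I) : ℂ × ℂ)) := by
    rw [hRy]
    exact hG.hasFDerivAt
  have h1 := (hG'.comp y hR).fderiv
  have h2 : fderiv ℝ f y = (fderiv ℝ G (Ψ y)).comp (fderiv ℝ Ψ y) := by
    have h3 := hG.hasFDerivAt.comp y (he' y hy).hasFDerivAt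
    refine (h3.congr_of_eventuallyEq ?_).fderiv
    filter_upwards [e.eventually_right_inverse hy] with x hx
    exact (congrArg f hx).symm
  have h4 : ∀ v, fderiv ℝ (cplx s) y v = (fderiv ℝ s y v : ℂ) := by
    intro v
    exact DFunLike.congr_fun (Complex.ofRealCLM.hasFDerivAt.comp y hs.hasFDerivAt).fderiv v
  refine ⟨fderiv ℝ G (Ψ y) (0, Complex.I), fun v => ?_⟩
  have h5 : (fun y => f (e (paraboloid (graphParameters Ψ y))))
      = G ∘ fun y => Ψ y - s y • ((0, Complex.I) : ℂ × ℂ) := by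
    ext y
    simp only [Function.comp_apply, paraboloid_graphParameters]
    rfl
  rw [h5, h1, h2, h4]
  simp only [ContinuousLinearMap.comp_apply, sub_apply,
    ContinuousLinearMap.smulRight_apply, map_sub, map_smul, Complex.real_smul]
  ring

theorem contDiffAt_pulledBackSphere (he' : ContDiffAt ℝ ∞ e.symm p) :
    ContDiffAt ℝ ∞ (pulledBackSphere e.symm) p :=
  (Complex.imCLM.contDiff.contDiffAt.comp p he'.snd).sub (he'.fst.norm_sq ℝ)

theorem contDiffAt_graphParameters (he' : ContDiffAt ℝ ∞ e.symm p) :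
    ContDiffAt ℝ ∞ (graphParameters e.symm) p :=
  he'.fst.prodMk (Complex.reCLM.contDiff.contDiffAt.comp p he'.snd)

/-- Vanishing to order `k` along the sphere, seen in holomorphic coordinates, is a tangential
filtration. -/
theorem tangentialFiltration_orderIdeal (hp : e 0 = p) (h0 : (0 : ℂ × ℂ) ∈ e.source)
    (hd : ∀ x ∈ e.source, DifferentiableAt ℝ e x)
    (hd' : ∀ y ∈ e.target, DifferentiableAt ℝ e.symm y)
    (he : ContDiffAt ℝ ∞ e 0) (he' : ContDiffAt ℝ ∞ e.symm p)
    (hγ : ContinuousAt (fun x => e (paraboloid x)) 0) (hγp : e (paraboloid 0) = p)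
    {σ : SmoothGerm p} (hσ : HasGerm (cplx (pulledBackSphere e.symm)) σ) :
    (germWirtinger p).TangentialFiltration σ (orderIdeal p (fun x => e (paraboloid x)) hγ hγp) := by
  set γ : ℂ × ℝ → ℂ × ℂ := fun x => e (paraboloid x) with hγdef
  set q := graphParameters e.symm with hq
  set s := pulledBackSphere e.symm
  have hpt : p ∈ e.target := hp ▸ e.map_source h0
  have hqp : q p = 0 := by
    have : e.symm p = 0 := by rw [← hp, e.left_inv h0]
    simp [hq, graphParameters, this]
  have hγs : ContDiffAt ℝ ∞ γ 0 := by
    refine ContDiffAt.comp (g := e) (0 : ℂ × ℝ) ?_ contDiff_paraboloid.contDiffAt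
    rwa [paraboloid_zero]
  have hqs : ContDiffAt ℝ ∞ q p := contDiffAt_graphParameters he'
  have hss : ContDiffAt ℝ ∞ s p := contDiffAt_pulledBackSphere he'
  have hsd : ∀ᶠ y in 𝓝 p, DifferentiableAt ℝ s y := by
    filter_upwards [(hss.of_le (m := 1) (by simp)).eventually (by simp)] with x hx
    exact hx.differentiableAt (by simp)
  have hγO : (fun x => ‖γ x - p‖) =O[𝓝 0] fun x : ℂ × ℝ => ‖x‖ := by
    have := (hγs.differentiableAt (by simp)).isBigO_sub
    rw [show γ 0 = p from hγp] at this
    simpa using this.norm_norm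
  have hqO : (fun y => ‖q y‖) =O[𝓝 p] fun y => ‖y - p‖ := by
    have := (hqs.differentiableAt (by simp)).isBigO_sub
    rw [hqp] at this
    simpa using this.norm_norm
  have hγt : Filter.Tendsto γ (𝓝 0) (𝓝 p) := hγp ▸ hγ
  have hqt : Filter.Tendsto q (𝓝 p) (𝓝 0) := hqp ▸ hqs.continuousAt
  have hsrc : ∀ᶠ x in 𝓝 (0 : ℂ × ℝ), paraboloid x ∈ e.source := by
    have : Filter.Tendsto paraboloid (𝓝 0) (𝓝 0) := by
      have := contDiff_paraboloid.continuous.tendsto 0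
      rwa [paraboloid_zero] at this
    exact this.eventually (e.open_source.mem_nhds h0)
  -- a tangential first order operator only sees the restriction to the sphere
  have key : ∀ {f : ℂ × ℂ → ℂ} {k : ℕ}, ContDiffAt ℝ ∞ f p →
      ((fun x => f (γ x)) =O[𝓝 0] fun x : ℂ × ℝ => ‖x‖ ^ (k + 1)) →
      ∃ F : ℂ × ℂ → ℂ, (∀ v, (fun x => wirt v F (γ x)) =O[𝓝 0] fun x : ℂ × ℝ => ‖x‖ ^ k) ∧
        (∀ v, (fun x => wirtBar v F (γ x)) =O[𝓝 0] fun x : ℂ × ℝ => ‖x‖ ^ k) ∧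
        ∀ᶠ x in 𝓝 0, ∃ c : ℂ, ∀ v, wirt v f (γ x) = wirt v F (γ x) + c * wirt v (cplx s) (γ x) ∧
          wirtBar v f (γ x) = wirtBar v F (γ x) + c * wirtBar v (cplx s) (γ x) := by
    intro f k hf hfO
    set F : ℂ × ℂ → ℂ := fun y => f (γ (q y)) with hF
    have hFs : ContDiffAt ℝ ∞ F p := by
      have h1 : ContDiffAt ℝ ∞ (fun x => f (γ x)) (q p) := by
        rw [hqp]
        refine ContDiffAt.comp (g := f) (0 : ℂ × ℝ) ?_ hγs
        rwa [show γ 0 = p from hγp]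
      exact h1.comp p hqs
    have hFO : F =O[𝓝 p] fun y => ‖y - p‖ ^ (k + 1) :=
      (hfO.comp_tendsto hqt).trans (hqO.pow (k + 1))
    have hFv : ∀ v, (fun x => fderiv ℝ F (γ x) v) =O[𝓝 0] fun x : ℂ × ℝ => ‖x‖ ^ k := fun v =>
      ((isBigO_fderiv_apply hFs hFO v).comp_tendsto hγt).trans (hγO.pow k)
    refine ⟨F, fun v => ?_, fun v => ?_, ?_⟩
    · have := ((hFv v).sub ((hFv (Complex.I • v)).const_mul_left Complex.I)).const_mul_left 2⁻¹
      refine this.congr_left fun x => ?_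
      simp only [wirt]
      ring
    · have := ((hFv v).add ((hFv (Complex.I • v)).const_mul_left Complex.I)).const_mul_left 2⁻¹
      refine this.congr_left fun x => ?_
      simp only [wirtBar]
      ring
    · filter_upwards [hγt.eventually (eventually_differentiableAt hf), hγt.eventually hsd, hsrc]
        with x hfx hsx hx
      obtain ⟨c, hc⟩ := fderiv_retraction hd hd' (e.map_source hx) hfx hsx
        (pulledBackSphere_comp hx)
      refine ⟨c, fun v => ?_⟩
      change ∀ v, fderiv ℝ f (γ x) v
        = fderiv ℝ F (γ x) v + c * fderiv ℝ (cplx s) (γ x) v at hc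
      simp only [wirt, wirtBar, hc]
      constructor <;> ring
  have hbdd : ∀ {g : ℂ × ℂ → ℂ} {φ : SmoothGerm p}, HasGerm g φ →
      (fun x => g (γ x)) =O[𝓝 0] fun _ : ℂ × ℝ => (1 : ℝ) := fun hg =>
    (ContinuousAt.comp_of_eq hg.1.continuousAt hγ hγp).isBigO_one ℝ
  refine ⟨?_, ?_, ?_⟩
  · rintro j k hjk φ ⟨f, hf, hfO⟩
    exact ⟨f, hf, hfO.trans (isBigO_norm_pow_of_le hjk)⟩
  · rintro k φ ⟨f, hf, hfO⟩
    refine ⟨_, (hσ.dW.neg.mul hf.dZ).add (hσ.dZ.mul hf.dW), ?_⟩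
    obtain ⟨F, hF, -, hc⟩ := key hf.1 hfO
    have h1 : (fun x => -dW (cplx s) (γ x) * dZ F (γ x) + dZ (cplx s) (γ x) * dW F (γ x))
        =O[𝓝 0] fun x : ℂ × ℝ => ‖x‖ ^ k := by
      simpa [dZ, dW] using
        ((hbdd hσ.dW).neg_left.mul (hF (1, 0))).add ((hbdd hσ.dZ).mul (hF (0, 1)))
    refine h1.congr' ?_ Filter.EventuallyEq.rfl
    filter_upwards [hc] with x ⟨c, hx⟩
    change _ = -dW (cplx s) (γ x) * dZ f (γ x) + dZ (cplx s) (γ x) * dW f (γ x)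
    simp only [dZ, dW, hx]
    ring
  · rintro k φ ⟨f, hf, hfO⟩
    refine ⟨_, (hσ.dWbar.neg.mul hf.dZbar).add (hσ.dZbar.mul hf.dWbar), ?_⟩
    obtain ⟨F, -, hF, hc⟩ := key hf.1 hfO
    have h1 : (fun x => -dWbar (cplx s) (γ x) * dZbar F (γ x)
        + dZbar (cplx s) (γ x) * dWbar F (γ x)) =O[𝓝 0] fun x : ℂ × ℝ => ‖x‖ ^ k := by
      simpa [dZbar, dWbar] using
        ((hbdd hσ.dWbar).neg_left.mul (hF (1, 0))).add ((hbdd hσ.dZbar).mul (hF (0, 1)))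
    refine h1.congr' ?_ Filter.EventuallyEq.rfl
    filter_upwards [hc] with x ⟨c, hx⟩
    change _ = -dWbar (cplx s) (γ x) * dZbar f (γ x) + dZbar (cplx s) (γ x) * dWbar f (γ x)
    simp only [dZbar, dWbar, hx]
    ring

end Chart

/-- Holomorphic coordinates with invertible differential form a local biholomorphism. -/
theorem exists_biholomorphic_chart {Φ : ℂ × ℂ → ℂ × ℂ} (hΦ : AnalyticAt ℂ Φ 0)
    (hbij : Function.Bijective (fderiv ℂ Φ 0)) :
    ∃ e : OpenPartialHomeomorph (ℂ × ℂ) (ℂ × ℂ), (∀ x, e x = Φ x) ∧ 0 ∈ e.source ∧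
      (∀ x ∈ e.source, DifferentiableAt ℂ e x) ∧ (∀ y ∈ e.target, DifferentiableAt ℂ e.symm y) ∧
      ContDiffAt ℂ ∞ e 0 ∧ ContDiffAt ℂ ∞ e.symm (e 0) := by
  have hc : ContDiffAt ℂ ∞ Φ 0 := hΦ.contDiffAt
  set A : (ℂ × ℂ) ≃L[ℂ] (ℂ × ℂ) := ContinuousLinearEquiv.ofBijective (fderiv ℂ Φ 0)
    (LinearMap.ker_eq_bot.2 hbij.1) (LinearMap.range_eq_top.2 hbij.2)
  have hA : HasFDerivAt Φ (A : ℂ × ℂ →L[ℂ] ℂ × ℂ) 0 :=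
    (hc.differentiableAt (by simp)).hasFDerivAt.congr_fderiv (by ext <;> rfl)
  set e := hc.toOpenPartialHomeomorph Φ hA (by simp)
  have he0 : (0 : ℂ × ℂ) ∈ e.source := hc.mem_toOpenPartialHomeomorph_source hA (by simp)
  have hsymm : ContDiffAt ℂ ∞ e.symm (e 0) := hc.to_localInverse hA (by simp)
  have hcd : ∀ {g : ℂ × ℂ → ℂ × ℂ} {y : ℂ × ℂ}, ContDiffAt ℂ ∞ g y →
      ∃ V, IsOpen V ∧ y ∈ V ∧ ∀ x ∈ V, DifferentiableAt ℂ g x := by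
    intro g y hg
    have h1 := (hg.of_le (m := 1) (by simp)).eventually (by simp)
    obtain ⟨V, hV, hVo, hyV⟩ := mem_nhds_iff.1 h1
    refine ⟨V, hVo, hyV, fun x hx => ?_⟩
    have h2 : ContDiffAt ℂ 1 g x := hV hx
    exact h2.differentiableAt (by simp)
  obtain ⟨V, hVo, hV0, hV⟩ := hcd hc
  obtain ⟨W, hWo, hW0, hW⟩ := hcd hsymm
  have hO : IsOpen (V ∩ (e.source ∩ e ⁻¹' W)) :=
    hVo.inter (e.isOpen_inter_preimage hWo)
  refine ⟨e.restrOpen _ hO, fun x => rfl, ⟨he0, hV0, he0, hW0⟩, fun x hx => hV x hx.2.1,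
    fun y hy => hW y ?_, hc, hsymm⟩
  have hy2 : e (e.symm y) ∈ W := hy.2.2.2
  rwa [e.right_inv hy.1] at hy2

/-- At an umbilical point, some defining function has degenerate `A₃`: the determinant only depends
on the jet of order six of the hypersurface, and it vanishes for the sphere in any holomorphic
coordinates. -/
theorem exists_det_matA3_eq_zero_of_isUmbilical {M : Set (ℂ × ℂ)} {p : ℂ × ℂ}
    (h : IsUmbilical M p) :
    ∃ r, IsLocalDefiningFunction M r p ∧ (matA3 (cplx r) p).det = 0 := by
  obtain ⟨r, Φ, hr, hΦ, hΦp, hbij, hO⟩ := h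
  refine ⟨r, hr, ?_⟩
  obtain ⟨e, heΦ, h0, hd, hd', he, he'⟩ := exists_biholomorphic_chart hΦ hbij
  have hp : e 0 = p := (heΦ 0).trans hΦp
  rw [hp] at he'
  have heR := he.restrict_scalars ℝ
  have heR' := he'.restrict_scalars ℝ
  have hpt : p ∈ e.target := hp ▸ e.map_source h0
  set s := pulledBackSphere e.symm with hs
  have hss : ContDiffAt ℝ ∞ s p := contDiffAt_pulledBackSphere heR'
  have hσ := hasGerm_toGerm (contDiffAt_cplx hss)
  have hτ := hasGerm_toGerm (contDiffAt_cplx hr.contDiffAt)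
  set σ := toGerm (cplx s) (contDiffAt_cplx hss)
  set τ := toGerm (cplx r) (contDiffAt_cplx hr.contDiffAt)
  have hγp : e (paraboloid 0) = p := by rw [paraboloid_zero, hp]
  have hγ : ContinuousAt (fun x => e (paraboloid x)) 0 :=
    ContinuousAt.comp_of_eq he.continuousAt contDiff_paraboloid.continuous.continuousAt
      paraboloid_zero
  have hJ := tangentialFiltration_orderIdeal hp h0 (fun x hx => (hd x hx).restrictScalars ℝ)
    (fun y hy => (hd' y hy).restrictScalars ℝ) heR heR' hγ hγp hσ
  set J := orderIdeal p (fun x => e (paraboloid x)) hγ hγp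
  have hτJ : τ ∈ J 7 := by
    refine ⟨_, hτ, ?_⟩
    have : (fun x : ℂ × ℝ => r (e (paraboloid x))) =O[𝓝 0] fun x : ℂ × ℝ => ‖x‖ ^ 7 := by
      simpa [heΦ, paraboloid] using hO
    exact (Complex.isBigO_ofReal_left (f := fun x : ℂ × ℝ => r (e (paraboloid x)))).2 this
  have hev : ∀ φ ∈ J 1, evalGerm p φ = 0 := by
    rintro φ ⟨f, hf, hfO⟩
    rw [hf.eval]
    obtain ⟨c, hc⟩ := hfO.bound
    simpa [hγp] using hc.self_of_nhds
  -- the coordinates and their Jacobian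
  have hinj : Function.Injective (fderiv ℂ e.symm p) ∧
      ∃ v, fderiv ℂ e.symm p v = (0, Complex.I) := by
    have h1 := (hd' p hpt).hasFDerivAt
    have h2 : HasFDerivAt e (fderiv ℂ e 0) (e.symm p) := by
      rw [← hp, e.left_inv h0]
      exact (hd 0 h0).hasFDerivAt
    have h3 : HasFDerivAt e.symm (fderiv ℂ e.symm p) (e 0) := by rwa [hp]
    have h4 := (h2.comp p h1).unique ((hasFDerivAt_id p).congr_of_eventuallyEq
      (e.eventually_right_inverse hpt))
    have h5 := (h3.comp 0 (hd 0 h0).hasFDerivAt).unique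
      ((hasFDerivAt_id (0 : ℂ × ℂ)).congr_of_eventuallyEq (e.eventually_left_inverse h0))
    exact ⟨Function.LeftInverse.injective (g := fderiv ℂ e 0) fun v => DFunLike.congr_fun h4 v,
      _, DFunLike.congr_fun h5 (0, Complex.I)⟩
  have hsymm0 : e.symm p = 0 := by rw [← hp, e.left_inv h0]
  have hds : fderiv ℝ s p ≠ 0 := by
    intro h00
    obtain ⟨v, hv⟩ := hinj.2
    have h1 := (hd' p hpt).hasFDerivAt.restrictScalars ℝ
    have h2 := ((Complex.imCLM.hasFDerivAt.comp p h1.snd).sub h1.fst.norm_sq).fderiv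
    have h3 : fderiv ℝ s p v = 1 := by
      refine (DFunLike.congr_fun h2 v).trans ?_
      simp [hv]
    rw [h00] at h3
    simp at h3
  obtain ⟨u, hu⟩ := exists_gradient_mul_eq_one hσ (hss.differentiableAt (by simp)) hds
  obtain ⟨hz, hw⟩ := WirtingerAlgebra.gradient_sub_mem (n := 6) hJ hu hτJ
  obtain ⟨hz', hw'⟩ := WirtingerAlgebra.gradientBar_sub_mem (n := 6) hJ hu hτJ
  rw [hτ.det_matA3, WirtingerAlgebra.det_matrixA3_change hJ (evalGerm p) hev hz hw hz' hw']
  refine mul_eq_zero_of_left ?_ _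
  -- the defining function of the sphere is linear in `f, g` with antiholomorphic coefficients
  have cf := hasGerm_toGerm heR'.fst
  have cg := hasGerm_toGerm heR'.snd
  have hnear : ∀ᶠ y in 𝓝 p, DifferentiableAt ℂ e.symm y := by
    filter_upwards [e.open_target.mem_nhds hpt] with y hy
    exact hd' y hy
  have ef : ∀ᶠ y in 𝓝 p, DifferentiableAt ℂ (fun y => (e.symm y).1) y :=
    hnear.mono fun y hy => hy.fst
  have eg : ∀ᶠ y in 𝓝 p, DifferentiableAt ℂ (fun y => (e.symm y).2) y :=
    hnear.mono fun y hy => hy.snd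
  have hα := cf.conj.z_w_conj_eq_zero ef
  have hγ' := cg.conj.z_w_conj_eq_zero eg
  refine (germWirtinger p).det_matrixA3_eq_zero
    (((hσ.eq_iff (((cf.mul cf.conj.neg).add (cg.mul (HasGerm.const (1 / (2 * Complex.I))))).add
      (cg.conj.smul (-(1 / (2 * Complex.I)))))).2 (Filter.Eventually.of_forall fun x => ?_)))
    (cf.zbar_wbar_eq_zero ef) (cg.zbar_wbar_eq_zero eg)
    ⟨by rw [map_neg, hα.1, neg_zero], by rw [map_neg, hα.2, neg_zero]⟩ (z_w_algebraMap _)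
    ⟨by rw [Derivation.map_smul, hγ'.1, smul_zero], by rw [Derivation.map_smul, hγ'.2, smul_zero]⟩
    _ ?_
  · have h1 : ((((e.symm x).2.im : ℝ)) : ℂ)
        = ((e.symm x).2 - starRingEnd ℂ (e.symm x).2) * (1 / (2 * Complex.I)) := by
      rw [Complex.sub_conj]
      field_simp
      push_cast
      ring
    simp only [cplx, hs, pulledBackSphere, mul_neg, Complex.mul_conj, Complex.normSq_eq_norm_sq,
      smul_eq_mul]
    rw [Complex.ofReal_sub, h1]
    ring
  · rw [((cf.dZ.mul cg.dW).sub (cf.dW.mul cg.dZ)).eval]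
    exact jacobian_ne_zero (hd' p hpt) hinj.1

theorem not_isUmbilical {ε : ℝ} (hε : 0 < ε) {p : ℂ × ℂ} : ¬ IsUmbilical (logSphere ε) p := by
  intro h
  obtain ⟨r, hr, h0⟩ := exists_det_matA3_eq_zero_of_isUmbilical h
  exact (invariants_ne_zero hε hr).1 h0

/-! ### The covering of the domain by a tube -/

/-- The universal covering `(z, w) ↦ (e^{iz}, e^{iw})` of the complement of the axes. -/
def expMap (x : ℂ × ℂ) : ℂ × ℂ :=
  (Complex.exp (Complex.I * x.1), Complex.exp (Complex.I * x.2))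

/-- The tube over the disc of radius `ε` in the imaginary parts. -/
def tube (ε : ℝ) : Set (ℂ × ℂ) := {x | x.1.im ^ 2 + x.2.im ^ 2 < ε ^ 2}

variable {ε : ℝ}

theorem log_norm_exp_I_mul (z : ℂ) : Real.log ‖Complex.exp (Complex.I * z)‖ = -z.im := by
  simp [Complex.norm_exp]

theorem exists_expMap_eq {y : ℂ × ℂ} (h1 : y.1 ≠ 0) (h2 : y.2 ≠ 0) : ∃ x, expMap x = y := by
  refine ⟨(-Complex.I * Complex.log y.1, -Complex.I * Complex.log y.2), Prod.ext ?_ ?_⟩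
  · simp [expMap, ← mul_assoc, Complex.exp_log h1]
  · simp [expMap, ← mul_assoc, Complex.exp_log h2]

theorem continuous_expMap : Continuous expMap := by
  unfold expMap
  fun_prop

theorem expMap_mem_domainD {x : ℂ × ℂ} : expMap x ∈ domainD ε ↔ x ∈ tube ε := by
  simp only [domainD, tube, Set.mem_ofPred_eq, expMap, log_norm_exp_I_mul, neg_sq]
  simp [Complex.exp_ne_zero]

theorem expMap_mem_logSphere {x : ℂ × ℂ} :
    expMap x ∈ logSphere ε ↔ x.1.im ^ 2 + x.2.im ^ 2 = ε ^ 2 := by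
  simp only [logSphere, logDefFun, Set.mem_ofPred_eq, expMap, log_norm_exp_I_mul, neg_sq,
    sub_eq_zero]
  simp [Complex.exp_ne_zero]

theorem expMap_image_tube : expMap '' tube ε = domainD ε := by
  ext y
  constructor
  · rintro ⟨x, hx, rfl⟩
    exact expMap_mem_domainD.2 hx
  · intro hy
    obtain ⟨x, rfl⟩ := exists_expMap_eq hy.1 hy.2.1
    exact ⟨x, expMap_mem_domainD.1 hy, rfl⟩

theorem isConnected_domainD (hε : 0 < ε) : IsConnected (domainD ε) := by
  have h0 : (0 : ℂ × ℂ) ∈ tube ε := by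
    simpa [tube] using pow_pos hε 2
  have hs : StarConvex ℝ 0 (tube ε) := by
    rw [starConvex_zero_iff]
    intro x hx t ht ht1
    have hx' : x.1.im ^ 2 + x.2.im ^ 2 < ε ^ 2 := hx
    have hn : 0 ≤ x.1.im ^ 2 + x.2.im ^ 2 := by positivity
    have ht2 : t ^ 2 ≤ 1 := pow_le_one₀ ht ht1
    have : (t * x.1.im) ^ 2 + (t * x.2.im) ^ 2 < ε ^ 2 := by nlinarith
    simpa [tube] using this
  rw [← expMap_image_tube]
  exact (hs.isPathConnected h0).isConnected.image _ continuous_expMap.continuousOn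

theorem mem_domainD_iff {x : ℂ × ℂ} :
    x ∈ domainD ε ↔ x ∈ {x : ℂ × ℂ | x.1 ≠ 0 ∧ x.2 ≠ 0} ∧ logDefFun ε x < 0 := by
  simp [domainD, logDefFun, and_assoc]

theorem isOpen_domainD : IsOpen (domainD ε) := by
  refine isOpen_iff_mem_nhds.2 fun x hx => ?_
  rw [mem_domainD_iff] at hx
  filter_upwards [isOpen_offAxes.mem_nhds hx.1,
    (contDiffAt_logDefFun hx.1.1 hx.1.2).continuousAt.eventually_lt continuousAt_const hx.2]
    with y hy hy'
  exact mem_domainD_iff.2 ⟨hy, hy'⟩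

/-- A compact polyannulus containing the domain; it avoids the axes. -/
def polyannulus (ε : ℝ) : Set (ℂ × ℂ) :=
  {x | (‖x.1‖ ∈ Set.Icc (Real.exp (-ε)) (Real.exp ε)) ∧
    ‖x.2‖ ∈ Set.Icc (Real.exp (-ε)) (Real.exp ε)}

theorem norm_mem_Icc {z : ℂ} (hε : 0 < ε) (hz : z ≠ 0) (h : Real.log ‖z‖ ^ 2 < ε ^ 2) :
    ‖z‖ ∈ Set.Icc (Real.exp (-ε)) (Real.exp ε) := by
  have h1 := abs_lt.1 (abs_lt_of_sq_lt_sq h hε.le)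
  have hz' := norm_pos_iff.2 hz
  exact ⟨(Real.le_log_iff_exp_le hz').1 h1.1.le, (Real.log_le_iff_le_exp hz').1 h1.2.le⟩

theorem domainD_subset_polyannulus (hε : 0 < ε) : domainD ε ⊆ polyannulus ε := fun x hx =>
  ⟨norm_mem_Icc hε hx.1 (by nlinarith [hx.2.2, sq_nonneg (Real.log ‖x.2‖)]),
    norm_mem_Icc hε hx.2.1 (by nlinarith [hx.2.2, sq_nonneg (Real.log ‖x.1‖)])⟩

theorem isClosed_polyannulus : IsClosed (polyannulus ε) :=
  (isClosed_Icc.preimage continuous_fst.norm).inter (isClosed_Icc.preimage continuous_snd.norm)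

theorem isBounded_domainD (hε : 0 < ε) : Bornology.IsBounded (domainD ε) :=
  isBounded_iff_forall_norm_le.2 ⟨Real.exp ε, fun _ hx =>
    max_le (domainD_subset_polyannulus hε hx).1.2 (domainD_subset_polyannulus hε hx).2.2⟩

theorem frontier_domainD (hε : 0 < ε) : frontier (domainD ε) = logSphere ε := by
  rw [isOpen_domainD.frontier_eq]
  ext x
  constructor
  · rintro ⟨hx, hxD⟩
    have hK := closure_minimal (domainD_subset_polyannulus hε) isClosed_polyannulus hx
    have h1 : x.1 ≠ 0 := norm_pos_iff.1 ((Real.exp_pos _).trans_le hK.1.1)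
    have h2 : x.2 ≠ 0 := norm_pos_iff.1 ((Real.exp_pos _).trans_le hK.2.1)
    have hle : logDefFun ε x ≤ 0 :=
      (contDiffAt_logDefFun h1 h2).continuousAt.continuousWithinAt.closure_le hx
        continuousWithinAt_const fun y hy => (mem_domainD_iff.1 hy).2.le
    have hge : ¬ logDefFun ε x < 0 := fun h => hxD (mem_domainD_iff.2 ⟨⟨h1, h2⟩, h⟩)
    exact ⟨h1, h2, le_antisymm hle (not_lt.1 hge)⟩
  · intro hx
    obtain ⟨y, rfl⟩ := exists_expMap_eq hx.1 hx.2.1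
    refine ⟨?_, fun h => (mem_domainD_iff.1 h).2.ne hx.2.2⟩
    -- approach the boundary point along the segment from the totally real torus
    have hlim : Filter.Tendsto (fun t : ℝ => expMap (t • y)) (𝓝[<] 1) (𝓝 (expMap y)) := by
      have : Continuous fun t : ℝ => expMap (t • y) :=
        continuous_expMap.comp (continuous_id.smul continuous_const)
      have h := this.tendsto 1
      rw [one_smul] at h
      exact h.mono_left nhdsWithin_le_nhds
    refine mem_closure_of_tendsto hlim ?_
    filter_upwards [Ioo_mem_nhdsLT (zero_lt_one' ℝ)] with t ht
    rw [expMap_mem_domainD]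
    have hy := expMap_mem_logSphere.1 hx
    have ht2 : t ^ 2 < 1 := pow_lt_one₀ ht.1.le ht.2 two_ne_zero
    have hε2 : 0 < ε ^ 2 := pow_pos hε 2
    have : (t * y.1.im) ^ 2 + (t * y.2.im) ^ 2 < ε ^ 2 := by
      rw [mul_pow, mul_pow, ← mul_add, hy]
      nlinarith
    simpa [tube] using this

theorem isBoundedStrictlyPseudoconvexDomain_domainD (hε : 0 < ε) :
    IsBoundedStrictlyPseudoconvexDomain (domainD ε) := by
  refine ⟨isOpen_domainD, isConnected_domainD hε, isBounded_domainD hε, fun p hp => ?_⟩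
  rw [frontier_domainD hε] at hp ⊢
  refine ⟨logDefFun ε, isLocalDefiningFunction_logDefFun hε hp, ?_,
    isLeviPositive_logDefFun hp.1 hp.2.1⟩
  filter_upwards [isOpen_offAxes.mem_nhds ⟨hp.1, hp.2.1⟩] with x hx
  rw [mem_domainD_iff]
  exact and_iff_right hx

theorem isStrictlyPseudoconvexHypersurface_logSphere (hε : 0 < ε) :
    IsStrictlyPseudoconvexHypersurface (logSphere ε) := fun _ hp =>
  ⟨logDefFun ε, isLocalDefiningFunction_logDefFun hε hp, isLeviPositive_logDefFun hp.1 hp.2.1⟩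

theorem logSphere_nonempty : (logSphere ε).Nonempty :=
  ⟨expMap (ε * Complex.I, 0), expMap_mem_logSphere.2 (by simp)⟩

theorem isCompact_frontier_domainD (hε : 0 < ε) : IsCompact (frontier (domainD ε)) :=
  Metric.isCompact_of_isClosed_isBounded isClosed_frontier
    ((isBounded_domainD hε).closure.subset frontier_subset_closure)

variable {ε : ℝ}

/-! ### The Grauert tube of the flat torus -/

/-- The Kähler potential `2 |Im Z|²` of the complexified flat torus. -/
def torusPotential (x : ℂ × ℂ) : ℝ := 2 * (x.1.im ^ 2 + x.2.im ^ 2)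

/-- The differential of `2 |Im Z|²`. -/
def torusPotentialDeriv (x : ℂ × ℂ) : ℂ × ℂ →L[ℝ] ℝ :=
  (4 * x.1.im) • Complex.imCLM.comp (ContinuousLinearMap.fst ℝ ℂ ℂ) +
    (4 * x.2.im) • Complex.imCLM.comp (ContinuousLinearMap.snd ℝ ℂ ℂ)

theorem hasFDerivAt_im_fst (x : ℂ × ℂ) : HasFDerivAt (fun y : ℂ × ℂ => y.1.im)
    (Complex.imCLM.comp (ContinuousLinearMap.fst ℝ ℂ ℂ)) x :=
  (Complex.imCLM.comp (ContinuousLinearMap.fst ℝ ℂ ℂ)).hasFDerivAt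

theorem hasFDerivAt_im_snd (x : ℂ × ℂ) : HasFDerivAt (fun y : ℂ × ℂ => y.2.im)
    (Complex.imCLM.comp (ContinuousLinearMap.snd ℝ ℂ ℂ)) x :=
  (Complex.imCLM.comp (ContinuousLinearMap.snd ℝ ℂ ℂ)).hasFDerivAt

theorem hasFDerivAt_torusPotential (x : ℂ × ℂ) :
    HasFDerivAt torusPotential (torusPotentialDeriv x) x := by
  have h := (((hasFDerivAt_im_fst x).pow 2).add ((hasFDerivAt_im_snd x).pow 2)).const_mul 2
  refine h.congr_fderiv ?_
  ext <;> simp [torusPotentialDeriv] <;> ring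

theorem wirt_const_mul_ofReal {h : ℂ × ℂ → ℝ} {L : ℂ × ℂ →L[ℝ] ℝ} {x : ℂ × ℂ}
    (hL : HasFDerivAt h L x) (c : ℂ) (v : ℂ × ℂ) :
    wirt v (fun y => c * (h y : ℂ)) x
      = c * ((L v : ℂ) - Complex.I * (L (Complex.I • v) : ℂ)) / 2 := by
  refine (wirt_of_hasFDerivAt
    ((Complex.ofRealCLM.hasFDerivAt.comp x hL).const_mul c) v).trans ?_
  simp
  ring

theorem wirt_congr {f g : ℂ × ℂ → ℂ} {x : ℂ × ℂ} (h : f =ᶠ[𝓝 x] g) (v : ℂ × ℂ) :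
    wirt v f x = wirt v g x := by
  rw [wirt, wirt, h.fderiv_eq]

theorem wirtBar_cplx_eq {h : ℂ × ℂ → ℝ} {L : ℂ × ℂ →L[ℝ] ℝ} {x : ℂ × ℂ}
    (hL : HasFDerivAt h L x) (v : ℂ × ℂ) :
    wirtBar v (cplx h) x = ((L v : ℂ) + Complex.I * (L (Complex.I • v) : ℂ)) / 2 := by
  exact wirtBar_of_hasFDerivAt (Complex.ofRealCLM.hasFDerivAt.comp x hL) v

theorem leviForm_torusPotential (x v : ℂ × ℂ) :
    leviForm torusPotential x v = Complex.normSq v.1 + Complex.normSq v.2 := by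
  have h1 : wirtBar v (cplx torusPotential) = fun y =>
      2 * Complex.I * (starRingEnd ℂ v.1 * (y.1.im : ℂ) + starRingEnd ℂ v.2 * (y.2.im : ℂ)) := by
    ext y
    rw [wirtBar_cplx_eq (hasFDerivAt_torusPotential y)]
    apply Complex.ext <;> simp [torusPotentialDeriv] <;> ring
  have h2 := (((Complex.ofRealCLM.hasFDerivAt.comp x (hasFDerivAt_im_fst x)).const_mul
    (starRingEnd ℂ v.1)).add ((Complex.ofRealCLM.hasFDerivAt.comp x
    (hasFDerivAt_im_snd x)).const_mul (starRingEnd ℂ v.2))).const_mul (2 * Complex.I)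
  rw [leviForm, h1]
  refine (congrArg Complex.re (wirt_of_hasFDerivAt h2 v)).trans ?_
  simp [Complex.normSq_apply]
  ring

theorem mongeAmpere_sqrt_torusPotential {x : ℂ × ℂ} (hx : torusPotential x ≠ 0) :
    Matrix.det
      !![dZ (dZbar (cplx fun y => √(torusPotential y))) x,
          dZ (dWbar (cplx fun y => √(torusPotential y))) x;
         dW (dZbar (cplx fun y => √(torusPotential y))) x,
          dW (dWbar (cplx fun y => √(torusPotential y))) x] = 0 := by
  have hroot : ∀ {y}, torusPotential y ≠ 0 → HasFDerivAt (fun y => √(torusPotential y))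
      ((1 / (2 * √(torusPotential y))) • torusPotentialDeriv y) y := fun hy =>
    (hasFDerivAt_torusPotential _).sqrt hy
  have hne : ∀ᶠ y in 𝓝 x, torusPotential y ≠ 0 :=
    (hasFDerivAt_torusPotential x).continuousAt.eventually_ne hx
  have h1 : dZbar (cplx fun y => √(torusPotential y)) =ᶠ[𝓝 x]
      fun y => Complex.I * ((y.1.im * (√(torusPotential y))⁻¹ : ℝ) : ℂ) := by
    filter_upwards [hne] with y hy
    rw [dZbar, wirtBar_cplx_eq (hroot hy)]
    simp [torusPotentialDeriv]
    ring
  have h2 : dWbar (cplx fun y => √(torusPotential y)) =ᶠ[𝓝 x]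
      fun y => Complex.I * ((y.2.im * (√(torusPotential y))⁻¹ : ℝ) : ℂ) := by
    filter_upwards [hne] with y hy
    rw [dWbar, wirtBar_cplx_eq (hroot hy)]
    simp [torusPotentialDeriv]
    ring
  have hg : √(torusPotential x) ≠ 0 := by
    have h0 : 0 ≤ torusPotential x := by unfold torusPotential; positivity
    exact (Real.sqrt_pos.2 (lt_of_le_of_ne h0 hx.symm)).ne'
  have hsq : √(torusPotential x) ^ 2 = 2 * (x.1.im ^ 2 + x.2.im ^ 2) :=
    Real.sq_sqrt (by unfold torusPotential; positivity)
  have hinv := (hasDerivAt_inv hg).comp_hasFDerivAt x (hroot hx)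
  have d1 := (hasFDerivAt_im_fst x).mul hinv
  have d2 := (hasFDerivAt_im_snd x).mul hinv
  have e1 := fun v => (wirt_congr h1 v).trans (wirt_const_mul_ofReal d1 Complex.I v)
  have e2 := fun v => (wirt_congr h2 v).trans (wirt_const_mul_ofReal d2 Complex.I v)
  rw [Matrix.det_fin_two_of, dZ, dZ, dW, dW, e1, e1, e2, e2]
  set g := √(torusPotential x) with hgx
  simp only [torusPotentialDeriv]
  simp [← hgx]
  have hg' : (g : ℂ) ≠ 0 := by exact_mod_cast hg
  have hsq' : (g : ℂ) ^ 2 = 2 * ((x.1.im : ℂ) ^ 2 + (x.2.im : ℂ) ^ 2) := by exact_mod_cast hsq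
  field_simp
  linear_combination 4 * Complex.I ^ 4 * (g : ℂ) ^ 2 * hsq'

theorem isFlatTorusPotential_torusPotential : IsFlatTorusPotential torusPotential where
  smooth := by
    have h1 : ContDiff ℝ ∞ fun x : ℂ × ℂ => x.1.im := Complex.imCLM.contDiff.comp contDiff_fst
    have h2 : ContDiff ℝ ∞ fun x : ℂ × ℂ => x.2.im := Complex.imCLM.contDiff.comp contDiff_snd
    exact contDiff_const.mul ((h1.pow 2).add (h2.pow 2))
  nonneg x := by unfold torusPotential; positivity
  periodic x m n := by simp [torusPotential]
  kaehler x v hv := by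
    rw [leviForm_torusPotential]
    have hv' : v.1 ≠ 0 ∨ v.2 ≠ 0 := by
      by_contra! h
      exact hv (Prod.ext h.1 h.2)
    rcases hv' with h | h
    · exact add_pos_of_pos_of_nonneg (Complex.normSq_pos.2 h) (Complex.normSq_nonneg _)
    · exact add_pos_of_nonneg_of_pos (Complex.normSq_nonneg _) (Complex.normSq_pos.2 h)
  zero_iff x := by
    rw [torusPotential, mul_eq_zero, or_iff_right two_ne_zero,
      add_eq_zero_iff_of_nonneg (sq_nonneg _) (sq_nonneg _), sq_eq_zero_iff, sq_eq_zero_iff]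
  metric a b s t := by
    rw [leviForm_torusPotential, Complex.normSq_ofReal, Complex.normSq_ofReal, sq, sq]
  mongeAmpere x hx := mongeAmpere_sqrt_torusPotential hx

theorem hasFDerivAt_expMap (x : ℂ × ℂ) : ∃ A : (ℂ × ℂ) →L[ℂ] (ℂ × ℂ),
    HasFDerivAt expMap A x ∧ Function.Bijective A := by
  have h : ∀ z : ℂ, HasDerivAt (fun z => Complex.exp (Complex.I * z))
      (Complex.exp (Complex.I * z) * Complex.I) z := fun z => by
    simpa using ((hasDerivAt_id z).const_mul Complex.I).cexp
  have hc : ∀ z : ℂ, Complex.exp (Complex.I * z) * Complex.I ≠ 0 := fun z =>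
    mul_ne_zero (Complex.exp_ne_zero _) Complex.I_ne_zero
  refine ⟨_, ((h x.1).comp_hasFDerivAt x hasFDerivAt_fst).prodMk
    ((h x.2).comp_hasFDerivAt x hasFDerivAt_snd), fun u v huv => ?_, fun v => ?_⟩
  · have h1 := congrArg Prod.fst huv
    have h2 := congrArg Prod.snd huv
    exact Prod.ext (mul_left_cancel₀ (hc x.1) h1) (mul_left_cancel₀ (hc x.2) h2)
  · exact ⟨((Complex.exp (Complex.I * x.1) * Complex.I)⁻¹ * v.1,
      (Complex.exp (Complex.I * x.2) * Complex.I)⁻¹ * v.2),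
      Prod.ext (mul_inv_cancel_left₀ (hc x.1) v.1) (mul_inv_cancel_left₀ (hc x.2) v.2)⟩

theorem exp_I_mul_eq_iff (z w : ℂ) : Complex.exp (Complex.I * z) = Complex.exp (Complex.I * w) ↔
    ∃ m : ℤ, w = z + 2 * Real.pi * m := by
  rw [eq_comm, Complex.exp_eq_exp_iff_exists_int]
  refine exists_congr fun m => ?_
  rw [← mul_right_inj' Complex.I_ne_zero (b := w)]
  refine Eq.congr_right ?_
  ring

/-- The covering `(z, w) ↦ (e^{iz}, e^{iw})` identifies the tube `|Im Z| < ε` modulo `(2πℤ)²` with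
the domain; in the potential `2 |Im Z|²` it is the tube of radius `√2 ε`. -/
theorem isFlatTorusGrauertTube_domainD (ε : ℝ) : IsFlatTorusGrauertTube (√2 * ε) (domainD ε) := by
  have ht : {x | torusPotential x < (√2 * ε) ^ 2} = tube ε := by
    ext x
    simp only [torusPotential, tube, mul_pow, Set.mem_ofPred_eq]
    rw [Real.sq_sqrt zero_le_two, mul_lt_mul_iff_right₀ two_pos]
  refine ⟨torusPotential, expMap, isFlatTorusPotential_torusPotential, fun x _ => ?_,
    fun x _ => ?_, ?_, fun x y _ _ => ?_⟩
  · obtain ⟨A, hA, -⟩ := hasFDerivAt_expMap x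
    exact hA.differentiableAt.differentiableWithinAt
  · obtain ⟨A, hA, hb⟩ := hasFDerivAt_expMap x
    rwa [hA.fderiv]
  · rw [ht, expMap_image_tube]
  · rw [expMap, expMap, Prod.mk.injEq, exp_I_mul_eq_iff, exp_I_mul_eq_iff]
    simp only [Prod.ext_iff, exists_and_left, exists_and_right]

/-! ### Local homogeneity -/

/-- The action on `ℂ²` of the real rotation with cosine `c` and sine `s`. -/
def rotation (c s : ℝ) : (ℂ × ℂ) →L[ℂ] (ℂ × ℂ) :=
  ((c : ℂ) • ContinuousLinearMap.fst ℂ ℂ ℂ - (s : ℂ) • ContinuousLinearMap.snd ℂ ℂ ℂ).prod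
    ((s : ℂ) • ContinuousLinearMap.fst ℂ ℂ ℂ + (c : ℂ) • ContinuousLinearMap.snd ℂ ℂ ℂ)

theorem rotation_apply (c s : ℝ) (x : ℂ × ℂ) :
    rotation c s x = (c * x.1 - s * x.2, s * x.1 + c * x.2) := rfl

theorem rotation_rotation {c s : ℝ} (h : c ^ 2 + s ^ 2 = 1) (x : ℂ × ℂ) :
    rotation c s (rotation c (-s) x) = x := by
  have h' : (c : ℂ) ^ 2 + (s : ℂ) ^ 2 = 1 := by exact_mod_cast h
  simp only [rotation_apply, Complex.ofReal_neg]
  refine Prod.ext ?_ ?_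
  · linear_combination x.1 * h'
  · linear_combination x.2 * h'

theorem rotation_bijective {c s : ℝ} (h : c ^ 2 + s ^ 2 = 1) :
    Function.Bijective (rotation c s) := by
  have h' : c ^ 2 + (-s) ^ 2 = 1 := by rwa [neg_sq]
  refine ⟨Function.LeftInverse.injective (g := rotation c (-s)) fun x => ?_,
    Function.RightInverse.surjective (g := rotation c (-s)) (rotation_rotation h)⟩
  simpa using rotation_rotation h' x

/-- Around any point, the covering precomposed with an affine automorphism restricts to a
biholomorphic chart. -/
theorem exists_chart_expMap (y : ℂ × ℂ) {A : (ℂ × ℂ) →L[ℂ] (ℂ × ℂ)} (hA : Function.Bijective A) :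
    ∃ e : OpenPartialHomeomorph (ℂ × ℂ) (ℂ × ℂ), (∀ x, e x = expMap (y + A x)) ∧ 0 ∈ e.source ∧
      (∀ x ∈ e.source, DifferentiableAt ℂ e x) ∧
      (∀ y ∈ e.target, DifferentiableAt ℂ e.symm y) := by
  have han : AnalyticAt ℂ (fun x => expMap (y + A x)) 0 := by
    have h : AnalyticAt ℂ (fun x => y + A x) 0 := analyticAt_const.add (A.analyticAt 0)
    have h1 : AnalyticAt ℂ (fun x => (y + A x).1) 0 := analyticAt_fst.comp h
    have h2 : AnalyticAt ℂ (fun x => (y + A x).2) 0 := analyticAt_snd.comp h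
    exact (analyticAt_const.mul h1).cexp.prod (analyticAt_const.mul h2).cexp
  obtain ⟨B, hB, hBb⟩ := hasFDerivAt_expMap (y + A 0)
  have hd : fderiv ℂ (fun x => expMap (y + A x)) 0 = B.comp A :=
    (HasFDerivAt.comp (g := expMap) (0 : ℂ × ℂ) hB (A.hasFDerivAt.const_add y)).fderiv
  obtain ⟨e, h1, h2, h3, h4, -⟩ := exists_biholomorphic_chart han
    (by rw [hd]; exact hBb.comp hA)
  exact ⟨e, h1, h2, h3, h4⟩

/-- In the tube coordinates `(i log z, i log w)`, the translations by real vectors and the real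
rotations act transitively on the boundary of the tube. -/
theorem isLocallyHomogeneous_logSphere (hε : 0 < ε) : IsLocallyHomogeneous (logSphere ε) := by
  intro p hp q hq
  obtain ⟨x, rfl⟩ := exists_expMap_eq hp.1 hp.2.1
  obtain ⟨y, rfl⟩ := exists_expMap_eq hq.1 hq.2.1
  rw [expMap_mem_logSphere] at hp hq
  have hε2 : ε ^ 2 ≠ 0 := (pow_pos hε 2).ne'
  set c := (x.1.im * y.1.im + x.2.im * y.2.im) / ε ^ 2 with hc
  set s := (x.1.im * y.2.im - x.2.im * y.1.im) / ε ^ 2 with hs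
  have hcs : c ^ 2 + s ^ 2 = 1 := by
    rw [hc, hs, div_pow, div_pow, ← add_div, div_eq_one_iff_eq (pow_ne_zero 2 hε2)]
    linear_combination (y.1.im ^ 2 + y.2.im ^ 2) * hp + ε ^ 2 * hq
  have hy1 : y.1.im = c * x.1.im - s * x.2.im := by
    rw [hc, hs]
    field_simp
    linear_combination -y.1.im * hp
  have hy2 : y.2.im = s * x.1.im + c * x.2.im := by
    rw [hc, hs]
    field_simp
    linear_combination -y.2.im * hp
  obtain ⟨e, he, he0, hed, hed'⟩ := exists_chart_expMap x (A := .id ℂ _) Function.bijective_id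
  obtain ⟨f, hf, hf0, hfd, hfd'⟩ := exists_chart_expMap y (rotation_bijective hcs)
  have hex : e 0 = expMap x := by simp [he]
  have hfy : f 0 = expMap y := by simp [hf]
  have hxt : expMap x ∈ e.target := hex ▸ e.map_source he0
  have hx0 : e.symm (expMap x) = 0 := by rw [← hex, e.left_inv he0]
  refine ⟨e.symm.trans f, ?_, ?_, fun u hu => ?_, fun u hu => ?_, fun u hu => ?_⟩
  · rw [OpenPartialHomeomorph.trans_source]
    refine ⟨hxt, ?_⟩
    rwa [Set.mem_preimage, hx0]
  · rw [OpenPartialHomeomorph.trans_apply, hx0, hfy]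
  · rw [OpenPartialHomeomorph.trans_source] at hu
    exact ((hfd _ hu.2).comp u (hed' u hu.1)).differentiableWithinAt
  · rw [OpenPartialHomeomorph.trans_target] at hu
    exact ((hed _ hu.2).comp u (hfd' u hu.1)).differentiableWithinAt
  · rw [OpenPartialHomeomorph.trans_source] at hu
    have hu' : u = expMap (x + e.symm u) := by
      have := he (e.symm u)
      rwa [e.right_inv hu.1] at this
    rw [OpenPartialHomeomorph.trans_apply, hf]
    generalize e.symm u = t at hu'
    rw [hu', expMap_mem_logSphere, expMap_mem_logSphere]
    simp only [rotation_apply, Prod.fst_add, Prod.snd_add, Complex.add_im, Complex.sub_im,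
      Complex.im_ofReal_mul, hy1, hy2]
    refine Eq.congr_left ?_
    linear_combination -((x.1.im + t.1.im) ^ 2 + (x.2.im + t.2.im) ^ 2) * hcs

end CRUmbilic

end

open CRUmbilic in
theorem theorem1p1 (ε : ℝ) (hε : 0 < ε) :
    IsBoundedStrictlyPseudoconvexDomain (domainD ε) ∧
    (frontier (domainD ε)).Nonempty ∧
    IsCompact (frontier (domainD ε)) ∧
    IsStrictlyPseudoconvexHypersurface (frontier (domainD ε)) ∧
    (∀ p ∈ frontier (domainD ε), ¬ IsUmbilical (frontier (domainD ε)) p) ∧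
    (∀ p ∈ frontier (domainD ε), ∀ r : ℂ × ℂ → ℝ,
      IsLocalDefiningFunction (frontier (domainD ε)) r p → umbilicalTensor r p ≠ 0) ∧
    IsFlatTorusGrauertTube (√2 * ε) (domainD ε) ∧
    IsLocallyHomogeneous (frontier (domainD ε)) ∧
    (∀ p ∈ frontier (domainD ε), ¬ IsSphericalAt (frontier (domainD ε)) p) := by
  refine ⟨isBoundedStrictlyPseudoconvexDomain_domainD hε, ?_, isCompact_frontier_domainD hε, ?_⟩
  · rw [frontier_domainD hε]
    exact logSphere_nonempty
  rw [frontier_domainD hε]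
  exact ⟨isStrictlyPseudoconvexHypersurface_logSphere hε, fun _ _ => not_isUmbilical hε,
    fun _ _ _ hr => umbilicalTensor_ne_zero hε hr, isFlatTorusGrauertTube_domainD ε,
    isLocallyHomogeneous_logSphere hε, fun _ hp => not_isSphericalAt hε hp⟩
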